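/- **Conventions.** Let $D^2\subset\mathbb C$ be the closed unit disc, $T^2=S^1\times S^1$, $T^3=T^2\times S^1=\partial(T^2\times D^2)$. For $x\in T^3$ let $\alpha,\beta,\gamma$ be the loops at $x$ which run once through the first, second and third circle factor; their classes form a basis of $\pi_1(T^3,x)\cong\mathbb Z^3$. The matrix of a homeomorphism $\varphi:T^3\to T^3$ is the matrix of $\varphi_*$ on $\pi_1$ in these bases (its columns are the images of $\alpha,\beta,\gamma$). The case of interest is that of orientation-preserving diffeomorphisms, i.e. matrices in $\mathrm{SL}(3,\mathbb Z)$. Put $\gcd(0,0)=0$ and $\mathbb Z/0=\mathbb Z$. A space is a *homology Hopf surface* if its integral singular homology groups are isomorphic, in every degree, to those of the Hopf surface $S^1\times S^3$. **(1)** Let $\varphi$ be a homeomorphism of $T^3$ whose matrix has third column $(g,h,k)^{T}$, and let $X_\varphi=(T^2\times D^2)\cup_\varphi(T^2\times D^2)$ be the space obtained from two copies of $T^2\times D^2$ by identifying each boundary point $x$ of the second copy with the boundary point $\varphi(x)$ of the first. Let $m=\gcd(g,h)$ and let $g',h'\in\mathbb Z$ satisfy $g=mg'$, $h=mh'$. Then,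 for every base point on the boundary of the first copy, $$\pi_1(X_\varphi)=\langle\alpha,\beta\mid[\alpha,\beta]=1,\ (\alpha^{g'}\beta^{h'})^{m}=1\rangle ,$$ where $\alpha,\beta$ correspond to the classes of the loops $\alpha,\beta$ in the first copy. Consequently, for every base point, $\pi_1(X_\varphi)\cong\mathbb Z\oplus\mathbb Z/m\mathbb Z$. Moreover, $X_\varphi$ is a homology Hopf surface if and only if $\gcd(g,h)=1$. **(2)** Let $S^3=\{(z,w)\in\mathbb C^2: |z|^2+|w|^2=2\}$ and consider the fibration $S^1\times S^3\to\mathbb{CP}^1$, $(u,(z,w))\mapsto[z:w]$, with fibres $F_+$ over $[1:0]$ and $F_-$ over $[0:1]$. Remove the open neighbourhoods $\{|w/z|<\tfrac12\}$ of $F_+$ and $\{|z/w|<\tfrac12\}$ of $F_-$, and identify the two resulting boundary components with $T^3$: the point $((v,u),\xi)\in T^3$ corresponds to the boundary point $(u,(z,w))$ with $z/|z|=v$, $w/z=\xi/2$ near $F_+$, respectively with $w/|w|=v$, $z/w=\xi/2$ near $F_-$. Let $\varphi_+,\varphi_-$ be homeomorphisms of $T^3$ whose matrices have third columns $(a,b,p)^T$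 and $(c,d,q)^T$, and let $X'$ be the result of the logarithmic transformations on $F_+$ and $F_-$ given by $\varphi_\pm$: for each sign, a copy of $T^2\times D^2$ is glued in along the boundary component around $F_\pm$ by identifying $x\in\partial(T^2\times D^2)$ with $\varphi_\pm(x)$. Then, for every base point on the boundary component around $F_-$, $$\pi_1(X')=\langle\alpha,\beta,\gamma\mid[\alpha,\beta]=[\alpha,\gamma]=[\beta,\gamma]=1,\ \alpha^a\beta^b(\alpha\gamma^{-1})^p=1,\ \alpha^c\beta^d\gamma^q=1\rangle ,$$ where $\alpha,\beta,\gamma$ correspond to the classes of the loops $\alpha,\beta,\gamma$ of that boundary component. Consequently, for every base point, $\pi_1(X')\cong\mathbb Z\oplus\mathbb Z/\mu\mathbb Z$, where $\mu$ is the greatest common divisor of all $2\times2$ minors of the presentation matrix $\begin{pmatrix}a+p&b&-p\\c&d&q\end{pmatrix}$. -/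

import Mathlib

open CategoryTheory

noncomputable section

namespace HopfLog

/-! ### The 3-torus, the solid piece `T² × D²`, and coordinate loops -/

/-- The two-dimensional torus `T² = S¹ × S¹`. -/
abbrev T2 : Type := Circle × Circle

/-- The three-dimensional torus `T³ = T² × S¹`. -/
abbrev T3 : Type := T2 × Circle

/-- The closed unit disc `D²` in the complex plane. -/
abbrev Disc : Type := {z : ℂ // ‖z‖ ≤ 1}

/-- The piece `T² × D²`. -/
abbrev Solid : Type := T2 × Disc

/-- The identification of `T³ = T² × S¹` with the boundary of `T² × D²`. -/
def bdry : C(T3, Solid) where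
  toFun x := (x.1, ⟨(x.2 : ℂ), (Circle.norm_coe x.2).le⟩)
  continuous_toFun := by fun_prop

/-- The point `e^{2πit}` of the unit circle. -/
def circ (t : unitInterval) : Circle := Circle.exp (2 * Real.pi * (t : ℝ))

@[fun_prop]
theorem continuous_circ : Continuous circ := by
  unfold circ; fun_prop

theorem circ_zero : circ 0 = 1 := by simp [circ]

theorem circ_one : circ 1 = 1 := by simp [circ]

/-- The loop `α` at `x` in `T³`: the first circle factor is run through once. -/
def loopα (x : T3) : Path x x where
  toFun t := ((x.1.1 * circ t, x.1.2), x.2)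
  continuous_toFun := by fun_prop
  source' := by simp [circ_zero]
  target' := by simp [circ_one]

/-- The loop `β` at `x` in `T³`: the second circle factor is run through once. -/
def loopβ (x : T3) : Path x x where
  toFun t := ((x.1.1, x.1.2 * circ t), x.2)
  continuous_toFun := by fun_prop
  source' := by simp [circ_zero]
  target' := by simp [circ_one]

/-- The loop `γ` at `x` in `T³`: the third circle factor is run through once. -/
def loopγ (x : T3) : Path x x where
  toFun t := (x.1, x.2 * circ t)
  continuous_toFun := by fun_prop
  source' := by simp [circ_zero]
  target' := by simp [circ_one]

/-- The classes of `α`, `β`, `γ` (in this order), a basis of `π₁(T³, x) ≅ ℤ³`. -/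
def basisClass (x : T3) (i : Fin 3) : FundamentalGroup T3 x :=
  FundamentalGroup.fromPath
    (Path.Homotopic.Quotient.mk (![loopα x, loopβ x, loopγ x] i))

/-- `A` is the matrix of `φ_*` on fundamental groups in the bases `(α, β, γ)`: the `j`-th column
of `A` consists of the exponents of the image of the `j`-th basis element. -/
def IsMatrixOf (φ : C(T3, T3)) (A : Matrix (Fin 3) (Fin 3) ℤ) : Prop :=
  ∀ (x : T3) (j : Fin 3),
    FundamentalGroup.map φ x (basisClass x j) =
      basisClass (φ x) 0 ^ A 0 j * basisClass (φ x) 1 ^ A 1 j * basisClass (φ x) 2 ^ A 2 j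

/-! ### Gluing in a copy of `T² × D²` -/

section Glue

variable {Y : Type} [TopologicalSpace Y]

/-- The elementary identification `∂(T² × D²) ∋ x ∼ f x ∈ Y` on `Y ⊔ T² × D²`. -/
inductive GlueRel (f : C(T3, Y)) : Y ⊕ Solid → Y ⊕ Solid → Prop
  | glue (x : T3) : GlueRel f (Sum.inr (bdry x)) (Sum.inl (f x))

/-- The space `Y ∪_f (T² × D²)`, i.e. the quotient of `Y ⊔ T² × D²` by the equivalence relation
generated by `x ∼ f x` for `x ∈ ∂(T² × D²) = T³`, with the quotient topology. -/
def Glue (f : C(T3, Y)) : Type := Quot (GlueRel f)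

instance (f : C(T3, Y)) : TopologicalSpace (Glue f) :=
  inferInstanceAs (TopologicalSpace (Quot (GlueRel f)))

/-- The canonical map `Y → Y ∪_f (T² × D²)`. -/
def Glue.inl (f : C(T3, Y)) : C(Y, Glue f) where
  toFun y := Quot.mk (GlueRel f) (Sum.inl y)
  continuous_toFun := continuous_quot_mk.comp continuous_inl

end Glue

/-! ### The manifold `X_φ` -/

/-- `X_φ = (T² × D²) ∪_φ (T² × D²)`: a boundary point `x` of the second copy is identified with
the boundary point `φ x` of the first copy. -/
abbrev XGlue (φ : T3 ≃ₜ T3) : Type := Glue (bdry.comp (φ : C(T3, T3)))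

/-- The boundary `T³` of the first copy of `T² × D²`, mapped to `X_φ`. -/
def XGlue.torus (φ : T3 ≃ₜ T3) : C(T3, XGlue φ) :=
  (Glue.inl (bdry.comp (φ : C(T3, T3)))).comp bdry

/-! ### The Hopf surface and homology Hopf surfaces -/

/-- The 3-sphere `|z|² + |w|² = 2` in `ℂ²`. -/
abbrev S3 : Type := {p : ℂ × ℂ // ‖p.1‖ ^ 2 + ‖p.2‖ ^ 2 = 2}

/-- The Hopf surface `S¹ × S³`. -/
abbrev HopfSurface : Type := Circle × S3

/-- Singular homology `H_n(X; ℤ)`. -/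
def Hlgy (n : ℕ) (X : Type) [TopologicalSpace X] : ModuleCat.{0} ℤ :=
  ((AlgebraicTopology.singularHomologyFunctor (ModuleCat.{0} ℤ) n).obj (ModuleCat.of ℤ ℤ)).obj
    (TopCat.of X)

/-- `X` has the same integral homology as the Hopf surface `S¹ × S³`. -/
def IsHomologyHopfSurface (X : Type) [TopologicalSpace X] : Prop :=
  ∀ n : ℕ, Nonempty (Hlgy n X ≅ Hlgy n HopfSurface)

/-! ### Two logarithmic transformations on the Hopf surface

The elliptic fibration is `S¹ × S³ → ℂP¹`, `(u, (z, w)) ↦ [z : w]`. The fibre `F₊` over `[1 : 0]`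
is `w = 0`, and the fibre `F₋` over `[0 : 1]` is `z = 0`. -/

/-- The Hopf surface with the open tubular neighbourhoods `|w / z| < 1/2` of `F₊` and
`|z / w| < 1/2` of `F₋` removed. -/
abbrev HopfExterior : Type :=
  {x : HopfSurface // ‖x.2.1.1‖ ≤ 2 * ‖x.2.1.2‖ ∧ ‖x.2.1.2‖ ≤ 2 * ‖x.2.1.1‖}

/-- The large and the small coordinate radius `√(8/5)`, `√(8/5)/2` on the boundary tori. -/
def rad : ℝ := Real.sqrt (8 / 5)

theorem rad_sq : rad ^ 2 = 8 / 5 := Real.sq_sqrt (by norm_num)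

theorem rad_nonneg : 0 ≤ rad := Real.sqrt_nonneg _

theorem norm_big (v : Circle) : ‖(rad : ℂ) * (v : ℂ)‖ = rad := by
  rw [norm_mul, Circle.norm_coe, mul_one, Complex.norm_real, Real.norm_of_nonneg rad_nonneg]

theorem norm_small (v ξ : Circle) : ‖(ξ : ℂ) / 2 * ((rad : ℂ) * (v : ℂ))‖ = rad / 2 := by
  rw [norm_mul, norm_big, norm_div, Circle.norm_coe, Complex.norm_ofNat]; ring

/-- The identification of `T³` with the boundary component of the exterior around `F₊`. In the
trivialisation `(u, (z, w)) ↦ (z / |z|, u, w / z)` near `F₊` it sends `((v, u), ξ)` to the point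
with coordinates `(v, u, ξ / 2)`. -/
def jPlus : C(T3, HopfExterior) where
  toFun x :=
    ⟨(x.1.2, ⟨((rad : ℂ) * (x.1.1 : ℂ), (x.2 : ℂ) / 2 * ((rad : ℂ) * (x.1.1 : ℂ))), by
        simp only [norm_big, norm_small]; nlinarith [rad_sq]⟩), by
      simp only [norm_big, norm_small]
      constructor <;> linarith [rad_nonneg]⟩
  continuous_toFun := by fun_prop

/-- The identification of `T³` with the boundary component of the exterior around `F₋`. In the
trivialisation `(u, (z, w)) ↦ (w / |w|, u, z / w)` near `F₋` it sends `((v, u), ξ)` to the point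
with coordinates `(v, u, ξ / 2)`. -/
def jMinus : C(T3, HopfExterior) where
  toFun x :=
    ⟨(x.1.2, ⟨((x.2 : ℂ) / 2 * ((rad : ℂ) * (x.1.1 : ℂ)), (rad : ℂ) * (x.1.1 : ℂ)), by
        simp only [norm_big, norm_small]; nlinarith [rad_sq]⟩), by
      simp only [norm_big, norm_small]
      constructor <;> linarith [rad_nonneg]⟩
  continuous_toFun := by fun_prop

/-- The exterior with one copy of `T² × D²` glued in along the boundary component around `F₊`. -/
abbrev XLogPlus (φp : T3 ≃ₜ T3) : Type := Glue (jPlus.comp (φp : C(T3, T3)))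

/-- The attaching map of the second copy of `T² × D²`, along the component around `F₋`. -/
def attachMinus (φp φm : T3 ≃ₜ T3) : C(T3, XLogPlus φp) :=
  (Glue.inl (jPlus.comp (φp : C(T3, T3)))).comp (jMinus.comp (φm : C(T3, T3)))

/-- The result `X'` of the logarithmic transformations on the fibres `F₊`, `F₋` of the Hopf
surface given by `φp`, `φm`: neighbourhoods of both fibres are removed, and two copies of
`T² × D²` are glued in. -/
abbrev XLog (φp φm : T3 ≃ₜ T3) : Type := Glue (attachMinus φp φm)

/-- The boundary torus around `F₋`, mapped to `X'`. -/
def XLog.torus (φp φm : T3 ≃ₜ T3) : C(T3, XLog φp φm) :=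
  (Glue.inl (attachMinus φp φm)).comp ((Glue.inl (jPlus.comp (φp : C(T3, T3)))).comp jMinus)

/-! ### The presentations -/

/-- The relators `[α, β]` and `(α^{g'} β^{h'})^m`. -/
def relsGlue (g' h' : ℤ) (m : ℕ) : Set (FreeGroup (Fin 2)) :=
  let α : FreeGroup (Fin 2) := FreeGroup.of 0
  let β : FreeGroup (Fin 2) := FreeGroup.of 1
  {α * β * α⁻¹ * β⁻¹, (α ^ g' * β ^ h') ^ m}

/-- The relators `[α, β]`, `[α, γ]`, `[β, γ]`, `α^a β^b (α γ⁻¹)^p` and `α^c β^d γ^q`. -/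
def relsLog (a b p c d q : ℤ) : Set (FreeGroup (Fin 3)) :=
  let α : FreeGroup (Fin 3) := FreeGroup.of 0
  let β : FreeGroup (Fin 3) := FreeGroup.of 1
  let γ : FreeGroup (Fin 3) := FreeGroup.of 2
  {α * β * α⁻¹ * β⁻¹, α * γ * α⁻¹ * γ⁻¹, β * γ * β⁻¹ * γ⁻¹,
    α ^ a * β ^ b * (α * γ⁻¹) ^ p, α ^ c * β ^ d * γ ^ q}

/-- The presentation matrix of the abelian group with generators `α, β, γ` and relations
`α^a β^b (α γ⁻¹)^p = 1`, `α^c β^d γ^q = 1`; its rows are the exponents of the relations. -/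
def presMatrix (a b p c d q : ℤ) : Matrix (Fin 2) (Fin 3) ℤ :=
  !![a + p, b, -p; c, d, q]

/-- The greatest common divisor of all `2 × 2` minors of a `2 × 3` integer matrix. -/
def minorsGcd (M : Matrix (Fin 2) (Fin 3) ℤ) : ℕ :=
  (Finset.univ : Finset (Fin 3 × Fin 3)).gcd
    fun s => ((M.submatrix id ![s.1, s.2]).det).natAbs

end HopfLog

end

noncomputable section

namespace HopfLog

open unitInterval Set Topology

/-! ### Additive cocycles on paths -/

section Cocycle

variable {X Y Z : Type*} [TopologicalSpace X] [TopologicalSpace Y] [TopologicalSpace Z]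
variable {A : Type*} [AddCommGroup A]

/-! All spaces here are built from a torus by attaching copies of `T² × D²` along maps of `T³`. The
fundamental group of `T³` is `ℤ³` through the degrees of the coordinates (`degEquiv`), and attaching
`T² × D²` should kill the class of its meridian and nothing else. The statement `HasKer j K` says
that `j` maps the fundamental group of `T³` onto that of the target, with kernel `K` in terms of
degrees. The main tool is `HasKer.glue`: attaching a piece enlarges `K` by the degree vector of the
meridian.

The argument is van Kampen's, split into two halves. The complement of the core `T² × {0}` and the
interior of `T² × D²` form an open cover. Paths in either set can be pushed into `Y`, so every class
comes from `Y` (`Glue.exists_map_inl_eq`). For the kernel, all groups that occur are quotients of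
`ℤ³`, hence abelian, so it suffices to detect classes by additive functions on paths, the path
cocycles. A cocycle on `Y` which vanishes on the meridian extends over the attached piece
(`Glue.exists_extension`), because a local cocycle extends along an open cover
(`IsLocalCocycle.exists_extension`). Applied to the degrees modulo the enlarged subgroup, this shows
that no further classes die.

For `X_φ` one starts with `T² × D²`, whose kernel is generated by `γ`, and adds the third column of
the matrix. For `X'` one starts with the exterior of the two fibres, which deformation retracts to
the boundary torus around `F₋`. In the coordinates of this torus the loop `γ` around `F₊` is `αγ⁻¹`,
which turns `(a, b, p)` into `(a + p, b, -p)`. The presentations follow by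
`HasKer.exists_presentation`, and the isomorphism types by Bézout's identity and unimodular changes
of basis (`exists_hom_meridian`, `exists_hom_pair`).

For the homology, a cocycle also induces a map on `H₁`, and every class in `H₁` is represented by a
loop (`exists_loopHlgy_eq`). If `H₁(X_φ)` agrees with `H₁` of the Hopf surface, it is cyclic and
maps onto `ℤ ⊕ ℤ/m`, so `m = 1`. Conversely, the homotopy type of `X_φ` depends only on the homotopy
class of `T³ → T² × D²`, hence on the first two rows of the matrix. If the gcd is one, automorphisms
of the two pieces reduce these rows to those of a cyclic permutation
(`Glue.nonempty_homeomorph_cyc`), whose gluing is `S¹ × S³` (`nonempty_homeomorph_hopf`). -/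

/-- The part of `p` from time `s` to time `t`, reparametrised affinely. -/
def seg (p : C(I, X)) (s t : I) : C(I, X) :=
  p.comp ⟨Icc.convexComb s t, Icc.continuous_convexComb s t⟩

@[simp]
theorem seg_apply (p : C(I, X)) (s t u : I) : seg p s t u = p (Icc.convexComb s t u) := rfl

theorem seg_seg (p : C(I, X)) (s t a b : I) :
    seg (seg p s t) a b = seg p (Icc.convexComb s t a) (Icc.convexComb s t b) := by
  ext u
  simp only [seg_apply]
  congr 1
  ext
  simp only [Icc.coe_convexComb]
  ring

theorem seg_zero_one (p : C(I, X)) : seg p 0 1 = p := by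
  ext u
  simp

/-- The path `H (a, ·)` in a square. -/
def row (H : C(I × I, X)) (a : I) : C(I, X) := H.comp ((ContinuousMap.const I a).prodMk (.id I))

/-- The path `H (·, b)` in a square. -/
def col (H : C(I × I, X)) (b : I) : C(I, X) := H.comp ((ContinuousMap.id I).prodMk (.const I b))

@[simp]
theorem row_apply (H : C(I × I, X)) (a u : I) : row H a u = H (a, u) := rfl

@[simp]
theorem col_apply (H : C(I × I, X)) (b u : I) : col H b u = H (u, b) := rfl

/-- The restriction of a square to the rectangle `[a, b] × [s, t]`. -/
def subsquare (H : C(I × I, X)) (a b s t : I) : C(I × I, X) :=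
  H.comp (ContinuousMap.prodMap ⟨Icc.convexComb a b, Icc.continuous_convexComb a b⟩
    ⟨Icc.convexComb s t, Icc.continuous_convexComb s t⟩)

@[simp]
theorem subsquare_apply (H : C(I × I, X)) (a b s t : I) (u : I × I) :
    subsquare H a b s t u = H (Icc.convexComb a b u.1, Icc.convexComb s t u.2) := rfl

variable (X A) in
/-- An additive function on paths which is additive under subdivision and satisfies the
boundary relation on squares. -/
structure PathCocycle where
  toFun : C(I, X) → A
  seg_add' : ∀ p s t u, toFun (seg p s u) = toFun (seg p s t) + toFun (seg p t u)
  square' : ∀ H : C(I × I, X),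
    toFun (row H 0) + toFun (col H 1) = toFun (col H 0) + toFun (row H 1)

namespace PathCocycle

instance : CoeFun (PathCocycle X A) fun _ => C(I, X) → A := ⟨toFun⟩

variable (c : PathCocycle X A)

theorem seg_add (p : C(I, X)) (s t u : I) : c (seg p s u) = c (seg p s t) + c (seg p t u) :=
  c.seg_add' p s t u

theorem square (H : C(I × I, X)) : c (row H 0) + c (col H 1) = c (col H 0) + c (row H 1) :=
  c.square' H

theorem seg_self (p : C(I, X)) (s : I) : c (seg p s s) = 0 := by
  simpa using c.seg_add p s s s

theorem const (x : X) : c (.const I x) = 0 := c.seg_self (.const I x) 0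

theorem homotopic {x y : X} {p q : Path x y} (h : p.Homotopic q) :
    c (p : C(I, X)) = c (q : C(I, X)) := by
  obtain ⟨H⟩ := h
  have := c.square (H : C(I × I, X))
  have h0 : row (H : C(I × I, X)) 0 = p := by ext u; exact H.apply_zero u
  have h1 : row (H : C(I × I, X)) 1 = q := by ext u; exact H.apply_one u
  have h2 : col (H : C(I × I, X)) 0 = .const I x := by ext u; simp
  have h3 : col (H : C(I × I, X)) 1 = .const I y := by ext u; simp
  rw [h0, h1, h2, h3, c.const, c.const] at this
  simpa using this

theorem trans {x y z : X} (p : Path x y) (q : Path y z) :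
    c (p.trans q : C(I, X)) = c (p : C(I, X)) + c (q : C(I, X)) := by
  have h := c.seg_add (p.trans q : C(I, X)) 0 ⟨1 / 2, by norm_num, by norm_num⟩ 1
  rw [seg_zero_one] at h
  rw [h]
  congr 2
  · ext u
    simp only [seg_apply, ContinuousMap.coe_coe, Path.trans_apply]
    have : ((Icc.convexComb 0 ⟨1 / 2, by norm_num, by norm_num⟩ u : I) : ℝ) = u / 2 := by
      simp only [Icc.coe_convexComb]; simp; ring
    rw [dif_pos (by rw [this]; linarith [u.2.2])]
    congr 1
    ext
    simp only [this]; ring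
  · ext u
    simp only [seg_apply, ContinuousMap.coe_coe, Path.trans_apply]
    have : ((Icc.convexComb ⟨1 / 2, by norm_num, by norm_num⟩ 1 u : I) : ℝ) = 1 / 2 + u / 2 := by
      simp only [Icc.coe_convexComb]; simp; ring
    split_ifs with h'
    -- At `u = 0` the time is exactly `1/2`, which belongs to the first branch of `Path.trans`. The
    -- two branches agree there, at the common end point.
    · have hu : u = 0 := by
        ext
        have := u.2.1
        rw [‹((Icc.convexComb _ 1 u : I) : ℝ) = _›] at h'
        simp only [Icc.coe_zero]
        linarith
      subst hu
      rw [q.source]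
      convert p.target
      simp
    · congr 1
      ext
      simp only [this]; ring

/-- The value of a cocycle on a homotopy class of paths. -/
def onQuot {x y : X} (q : Path.Homotopic.Quotient x y) : A :=
  Quotient.lift (fun p : Path x y => c (p : C(I, X))) (fun _ _ h => c.homotopic h) q

@[simp]
theorem onQuot_mk {x y : X} (p : Path x y) : c.onQuot (.mk p) = c (p : C(I, X)) := rfl

@[simp]
theorem onQuot_trans {x y z : X} (p : Path.Homotopic.Quotient x y)
    (q : Path.Homotopic.Quotient y z) : c.onQuot (p.trans q) = c.onQuot p + c.onQuot q := by
  induction p using Path.Homotopic.Quotient.ind with | mk p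
  induction q using Path.Homotopic.Quotient.ind with | mk q
  rw [← Path.Homotopic.Quotient.mk_trans]
  exact c.trans p q

@[simp]
theorem onQuot_refl (x : X) : c.onQuot (.refl x) = 0 := c.const x

@[simp]
theorem onQuot_symm {x y : X} (p : Path.Homotopic.Quotient x y) :
    c.onQuot p.symm = - c.onQuot p := by
  rw [eq_neg_iff_add_eq_zero, ← onQuot_trans, Path.Homotopic.Quotient.symm_trans, onQuot_refl]

/-- The pullback of a cocycle along a continuous map. -/
def comap (f : C(Y, X)) : PathCocycle Y A where
  toFun p := c (f.comp p)
  seg_add' p s t u := c.seg_add (f.comp p) s t u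
  square' H := c.square (f.comp H)

@[simp]
theorem comap_apply (f : C(Y, X)) (p : C(I, Y)) : c.comap f p = c (f.comp p) := rfl

@[simp]
theorem comap_onQuot (f : C(Y, X)) {x y : Y} (q : Path.Homotopic.Quotient x y) :
    (c.comap f).onQuot q = c.onQuot (q.map f) := by
  induction q using Path.Homotopic.Quotient.ind with | mk q
  rfl

end PathCocycle

/-- A map from the interval as a path between its end points. -/
def asPath (p : C(I, X)) : Path (p 0) (p 1) := ⟨p, rfl, rfl⟩

@[simp]
theorem asPath_apply (p : C(I, X)) (t : I) : asPath p t = p t := rfl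

theorem asPath_seg_trans (p : C(I, X)) (s t u : I) :
    (((asPath p).subpath s t).trans ((asPath p).subpath t u)).Homotopic
      ((asPath p).subpath s u) :=
  ⟨Path.Homotopy.subpathTransSubpath _ s t u⟩

/-- The square is contractible, so its two boundary paths between opposite corners are homotopic;
`H` carries this homotopy to `X`. -/
theorem square_homotopic (H : C(I × I, X)) :
    (((asPath (row H 0)).trans (asPath (col H 1))) : Path (H (0, 0)) (H (1, 1))).Homotopic
      ((asPath (col H 0)).trans (asPath (row H 1))) := by
  let p₁ : Path ((0, 0) : I × I) (0, 1) := asPath (row (.id _) 0)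
  let p₂ : Path ((0, 1) : I × I) (1, 1) := asPath (col (.id _) 1)
  let q₁ : Path ((0, 0) : I × I) (1, 0) := asPath (col (.id _) 0)
  let q₂ : Path ((1, 0) : I × I) (1, 1) := asPath (row (.id _) 1)
  have h : (p₁.trans p₂).Homotopic (q₁.trans q₂) := by
    have hs : ContractibleSpace I := (convex_Icc (0 : ℝ) 1).contractibleSpace ⟨0, by simp⟩
    exact SimplyConnectedSpace.paths_homotopic _ _
  have := h.map H
  rw [Path.map_trans, Path.map_trans] at this
  exact this

theorem square_class (H : C(I × I, X)) {x y z w : X} {p : Path x y} {q : Path y w} {p' : Path x z}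
    {q' : Path z w} (hp : ∀ u, p u = H (0, u)) (hq : ∀ u, q u = H (u, 1))
    (hp' : ∀ u, p' u = H (u, 0)) (hq' : ∀ u, q' u = H (1, u)) :
    (Path.Homotopic.Quotient.mk p).trans (.mk q) =
      (Path.Homotopic.Quotient.mk p').trans (.mk q') := by
  obtain rfl : x = H (0, 0) := by rw [← hp, p.source]
  obtain rfl : y = H (0, 1) := by rw [← hp, p.target]
  obtain rfl : z = H (1, 0) := by rw [← hp', p'.target]
  obtain rfl : w = H (1, 1) := by rw [← hq', q'.target]
  obtain rfl : p = asPath (row H 0) := by ext u; exact hp u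
  obtain rfl : q = asPath (col H 1) := by ext u; exact hq u
  obtain rfl : p' = asPath (col H 0) := by ext u; exact hp' u
  obtain rfl : q' = asPath (row H 1) := by ext u; exact hq' u
  exact Path.Homotopic.Quotient.eq.2 (square_homotopic H)

theorem map_trans_class (f : C(X, Y)) {x y z : X} (p : Path.Homotopic.Quotient x y)
    (q : Path.Homotopic.Quotient y z) : (p.trans q).map f = (p.map f).trans (q.map f) := by
  induction p using Path.Homotopic.Quotient.ind with | mk p
  induction q using Path.Homotopic.Quotient.ind with | mk q
  exact congrArg _ (Path.map_trans _ _ _)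

/-- A cocycle from an additive function on homotopy classes of paths. -/
def PathCocycle.ofQuot (g : ∀ {x y : X}, Path.Homotopic.Quotient x y → A)
    (hg : ∀ {x y z : X} (p : Path.Homotopic.Quotient x y) (q : Path.Homotopic.Quotient y z),
      g (p.trans q) = g p + g q) : PathCocycle X A where
  toFun p := g (.mk (asPath p))
  seg_add' p s t u := by
    -- A segment of `p` has end points which agree with values of `p` only up to a proof, so
    -- equality of values of `g` has to be transported.
    have hcast : ∀ {x y : X} (r : Path x y) (r' : C(I, X)), (∀ t, r t = r' t) →
        g (.mk (asPath r')) = g (.mk r) := by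
      intro x y r r' h
      have hx : x = r' 0 := by rw [← h, r.source]
      have hy : y = r' 1 := by rw [← h, r.target]
      subst hx hy
      congr 2
      ext t
      simp [h]
    rw [hcast ((asPath p).subpath s u) (seg p s u) (fun _ => rfl),
      hcast ((asPath p).subpath s t) (seg p s t) (fun _ => rfl),
      hcast ((asPath p).subpath t u) (seg p t u) (fun _ => rfl), ← hg,
      ← Path.Homotopic.Quotient.mk_trans, Path.Homotopic.Quotient.eq.2 (asPath_seg_trans p s t u)]
  square' H := by
    have := congrArg g (Path.Homotopic.Quotient.eq.2 (square_homotopic H))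
    let p₁ : Path (H (0, 0)) (H (0, 1)) := asPath (row H 0)
    let p₂ : Path (H (0, 1)) (H (1, 1)) := asPath (col H 1)
    let q₁ : Path (H (0, 0)) (H (1, 0)) := asPath (col H 0)
    let q₂ : Path (H (1, 0)) (H (1, 1)) := asPath (row H 1)
    exact (hg (.mk p₁) (.mk p₂)).symm.trans (this.trans (hg (.mk q₁) (.mk q₂)))

theorem PathCocycle.ofQuot_path (g : ∀ {x y : X}, Path.Homotopic.Quotient x y → A)
    (hg : ∀ {x y z : X} (p : Path.Homotopic.Quotient x y) (q : Path.Homotopic.Quotient y z),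
      g (p.trans q) = g p + g q) {x y : X} (p : Path x y) :
    PathCocycle.ofQuot g hg (p : C(I, X)) = g (.mk p) := by
  obtain ⟨p, rfl, rfl⟩ := p
  rfl

@[simp]
theorem PathCocycle.ofQuot_onQuot (g : ∀ {x y : X}, Path.Homotopic.Quotient x y → A)
    (hg : ∀ {x y z : X} (p : Path.Homotopic.Quotient x y) (q : Path.Homotopic.Quotient y z),
      g (p.trans q) = g p + g q) {x y : X} (p : Path.Homotopic.Quotient x y) :
    (PathCocycle.ofQuot g hg).onQuot p = g p := by
  induction p using Path.Homotopic.Quotient.ind with | mk p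
  exact PathCocycle.ofQuot_path g hg p

end Cocycle

/-! ### From local cocycles to global cocycles -/

section LocalGlobal

variable {X : Type*} [TopologicalSpace X] {A : Type*} [AddCommGroup A]
variable {ι : Type*} (W : ι → Set X) (c : C(I, X) → A)

/-- `c` is a cocycle as long as paths and squares stay in one of the sets `W i`. -/
structure IsLocalCocycle : Prop where
  seg_add' : ∀ i (p : C(I, X)) s t u, (∀ v, p v ∈ W i) →
    c (seg p s u) = c (seg p s t) + c (seg p t u)
  square : ∀ i (H : C(I × I, X)), (∀ u, H u ∈ W i) →
    c (row H 0) + c (col H 1) = c (col H 0) + c (row H 1)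

/-- A development of a path: a primitive of a local cocycle. -/
def IsDevelopment (p : C(I, X)) (r : I) (D : I → A) : Prop :=
  ∀ i s t, s ≤ r → t ≤ r → (∀ v ∈ uIcc s t, p v ∈ W i) → D t = D s + c (seg p s t)

variable {W c}

/-- Only the part of `p` between the three times has to lie in `W i`: additivity is applied to the
segment over their convex hull, and the times are then translated back. -/
theorem IsLocalCocycle.seg_add (h : IsLocalCocycle W c) (i : ι) (p : C(I, X)) (s t u : I)
    (hp : ∀ v ∈ uIcc s t ∪ uIcc t u, p v ∈ W i) :
    c (seg p s u) = c (seg p s t) + c (seg p t u) := by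
  set a := min s (min t u)
  set b := max s (max t u)
  have hab : a ≤ b := (min_le_left _ _).trans (le_max_left _ _)
  have hr : range (Icc.convexComb a b) = Icc a b := by
    rw [Path.range_subpathAux, uIcc_of_le hab]
  have hmem : ∀ v ∈ Icc a b, v ∈ uIcc s t ∪ uIcc t u := by
    rintro v ⟨h1, h2⟩
    simp only [a, b, inf_le_iff, le_sup_iff] at h1 h2
    simp only [mem_union, mem_uIcc]
    rcases le_total v s with h | h <;> rcases le_total v t with h' | h' <;>
      rcases le_total v u with h'' | h'' <;> grind
  obtain ⟨s', hs'⟩ : s ∈ range (Icc.convexComb a b) := by rw [hr]; simp [a, b]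
  obtain ⟨t', ht'⟩ : t ∈ range (Icc.convexComb a b) := by rw [hr]; simp [a, b]
  obtain ⟨u', hu'⟩ : u ∈ range (Icc.convexComb a b) := by rw [hr]; simp [a, b]
  have := h.seg_add' i (HopfLog.seg p a b) s' t' u' fun v =>
    hp _ (hmem _ (hr ▸ mem_range_self v))
  rwa [seg_seg, seg_seg, seg_seg, hs', ht', hu'] at this

theorem IsLocalCocycle.seg_self (h : IsLocalCocycle W c) {i : ι} {p : C(I, X)} {s : I}
    (hs : p s ∈ W i) : c (seg p s s) = 0 := by
  have := h.seg_add i p s s s (by simpa using hs)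
  simpa using this

theorem IsLocalCocycle.seg_symm (h : IsLocalCocycle W c) {i : ι} {p : C(I, X)} {s t : I}
    (hst : ∀ v ∈ uIcc s t, p v ∈ W i) : c (seg p t s) = - c (seg p s t) := by
  rw [eq_neg_iff_add_eq_zero, ← h.seg_add i p t s t (by simpa [uIcc_comm t s] using hst)]
  exact h.seg_self (hst t right_mem_uIcc)

theorem exists_partition (hW : ∀ i, IsOpen (W i)) (hc : ∀ x, ∃ i, x ∈ W i) (p : C(I, X)) :
    ∃ t : ℕ → I, t 0 = 0 ∧ Monotone t ∧ (∃ n, ∀ m ≥ n, t m = 1) ∧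
      ∀ n, ∃ i, ∀ u ∈ Icc (t n) (t (n + 1)), p u ∈ W i :=
  exists_monotone_Icc_subset_open_cover_unitInterval (c := fun i => p ⁻¹' W i)
    (fun i => (hW i).preimage p.continuous) (fun u _ => mem_iUnion.2 (hc (p u)))

/-- By compactness the interval splits into pieces mapped into single members of the cover. A
primitive is continued over one piece at a time by the value of `c` on that piece. -/
theorem exists_isDevelopment (hW : ∀ i, IsOpen (W i)) (hcov : ∀ x, ∃ i, x ∈ W i)
    (hc : IsLocalCocycle W c) (p : C(I, X)) : ∃ D, IsDevelopment W c p 1 D := by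
  obtain ⟨t, t0, tm, ⟨N, hN⟩, ht⟩ := exists_partition hW hcov p
  suffices ∀ n, ∃ D, IsDevelopment W c p (t n) D by
    obtain ⟨D, hD⟩ := this N
    exact ⟨D, by rwa [hN N le_rfl] at hD⟩
  intro n
  induction n with
  | zero =>
    refine ⟨fun _ => 0, fun i s u hs hu hv => ?_⟩
    obtain rfl : s = 0 := le_antisymm (t0 ▸ hs) bot_le
    obtain rfl : u = 0 := le_antisymm (t0 ▸ hu) bot_le
    rw [hc.seg_self (hv 0 (by simp))]
    simp
  | succ n ih =>
    obtain ⟨D, hD⟩ := ih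
    obtain ⟨j, hj⟩ := ht n
    let D' : I → A := fun s => if s ≤ t n then D s else D (t n) + c (seg p (t n) s)
    have key : ∀ i s u, s ≤ u → u ≤ t (n + 1) → (∀ v ∈ uIcc s u, p v ∈ W i) →
        D' u = D' s + c (seg p s u) := by
      intro i s u hsu hu hv
      by_cases h1 : u ≤ t n
      · simp only [D', if_pos h1, if_pos (hsu.trans h1)]
        exact hD i s u (hsu.trans h1) h1 hv
      · push Not at h1
        by_cases h2 : s ≤ t n
        · simp only [D', if_neg (not_le.2 h1), if_pos h2]
          have hsub : ∀ v ∈ uIcc s (t n), p v ∈ W i := fun v hv' => hv v (by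
            rw [uIcc_of_le h2] at hv'
            rw [uIcc_of_le hsu]
            exact ⟨hv'.1, hv'.2.trans h1.le⟩)
          rw [hD i s (t n) h2 le_rfl hsub, add_assoc]
          congr 1
          refine (hc.seg_add i p s (t n) u fun v hv' => hv v ?_).symm
          rw [uIcc_of_le h2, uIcc_of_le h1.le, Icc_union_Icc_eq_Icc h2 h1.le] at hv'
          rwa [uIcc_of_le hsu]
        · push Not at h2
          simp only [D', if_neg (not_le.2 h1), if_neg (not_le.2 h2)]
          -- Both times lie in the last piece. The member `j` containing this whole piece is used
          -- here, since `W i` need not contain `p (t n)`.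
          rw [hc.seg_add j p (t n) s u, add_assoc]
          intro v hv'
          rw [uIcc_of_le h2.le, uIcc_of_le hsu, Icc_union_Icc_eq_Icc h2.le hsu] at hv'
          exact hj v ⟨hv'.1, hv'.2.trans hu⟩
    refine ⟨D', fun i s u hs hu hv => ?_⟩
    rcases le_total s u with h | h
    · exact key i s u h hu hv
    · rw [uIcc_comm] at hv
      rw [key i u s h hs hv, hc.seg_symm hv]
      abel

/-- Two primitives have the same increments on every piece of a fine partition, so they differ by a
constant. -/
theorem IsDevelopment.sub_eq (hW : ∀ i, IsOpen (W i)) (hcov : ∀ x, ∃ i, x ∈ W i)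
    {p : C(I, X)} {D D' : I → A} (hD : IsDevelopment W c p 1 D)
    (hD' : IsDevelopment W c p 1 D') : D 1 - D 0 = D' 1 - D' 0 := by
  obtain ⟨t, t0, tm, ⟨N, hN⟩, ht⟩ := exists_partition hW hcov p
  have : ∀ n, D (t n) - D 0 = D' (t n) - D' 0 := by
    intro n
    induction n with
    | zero => simp [t0]
    | succ n ih =>
      obtain ⟨j, hj⟩ := ht n
      rw [← uIcc_of_le (tm n.le_succ)] at hj
      rw [hD j _ _ le_top le_top hj, hD' j _ _ le_top le_top hj, add_sub_right_comm, ih]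
      abel
  simpa [hN N le_rfl] using this N

theorem IsDevelopment.seg {p : C(I, X)} {D : I → A} (hD : IsDevelopment W c p 1 D) (a b : I) :
    IsDevelopment W c (seg p a b) 1 (fun u => D (Icc.convexComb a b u)) := by
  intro i s t _ _ h
  rw [seg_seg]
  refine hD i _ _ le_top le_top fun v hv => ?_
  have : v ∈ Icc.convexComb a b '' uIcc s t := by
    have hc : ContinuousOn (Icc.convexComb a b) (uIcc s t) :=
      (Icc.continuous_convexComb a b).continuousOn
    exact intermediate_value_uIcc hc hv
  obtain ⟨w, hw, rfl⟩ := this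
  exact h w hw

/-- The value on an arbitrary path of the extension of a local cocycle. -/
def develop (W : ι → Set X) (c : C(I, X) → A) (p : C(I, X)) : A :=
  open Classical in
  -- For a local cocycle on an open cover a development always exists, so the default value `0` does
  -- not occur.
  if h : ∃ D, IsDevelopment W c p 1 D then h.choose 1 - h.choose 0 else 0

theorem IsDevelopment.develop_eq (hW : ∀ i, IsOpen (W i)) (hcov : ∀ x, ∃ i, x ∈ W i)
    {p : C(I, X)} {D : I → A} (hD : IsDevelopment W c p 1 D) : develop W c p = D 1 - D 0 := by
  have h : ∃ D, IsDevelopment W c p 1 D := ⟨D, hD⟩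
  rw [develop, dif_pos h]
  exact h.choose_spec.sub_eq hW hcov hD

/-- One primitive of `p` serves for all its segments, and differences of its values telescope. -/
theorem develop_seg_add (hW : ∀ i, IsOpen (W i)) (hcov : ∀ x, ∃ i, x ∈ W i)
    (hc : IsLocalCocycle W c) (p : C(I, X)) (s t u : I) :
    develop W c (seg p s u) = develop W c (seg p s t) + develop W c (seg p t u) := by
  obtain ⟨D, hD⟩ := exists_isDevelopment hW hcov hc p
  rw [(hD.seg s u).develop_eq hW hcov, (hD.seg s t).develop_eq hW hcov,
    (hD.seg t u).develop_eq hW hcov]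
  simp

theorem develop_eq_self (hW : ∀ i, IsOpen (W i)) (hcov : ∀ x, ∃ i, x ∈ W i)
    (hc : IsLocalCocycle W c) {i : ι} {p : C(I, X)} (hp : ∀ u, p u ∈ W i) :
    develop W c p = c p := by
  obtain ⟨D, hD⟩ := exists_isDevelopment hW hcov hc p
  rw [hD.develop_eq hW hcov, hD i 0 1 le_top le_top fun v _ => hp v, seg_zero_one]
  abel

/-- The square relation for a rectangle in a square. -/
def SquareRel (d : C(I, X) → A) (H : C(I × I, X)) (a b s t : I) : Prop :=
  d (seg (row H a) s t) + d (seg (col H t) a b) = d (seg (col H s) a b) + d (seg (row H b) s t)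

/-- The square is cut into cells mapped into single members of the cover, where the relation is
local. Adding cells gives strips, adding strips gives the square; the inner edges cancel. -/
theorem develop_square (hW : ∀ i, IsOpen (W i)) (hcov : ∀ x, ∃ i, x ∈ W i)
    (hc : IsLocalCocycle W c) (H : C(I × I, X)) :
    develop W c (row H 0) + develop W c (col H 1) =
      develop W c (col H 0) + develop W c (row H 1) := by
  obtain ⟨t, t0, tm, ⟨N, hN⟩, ht⟩ := exists_monotone_Icc_subset_open_cover_unitInterval_prod_self
    (c := fun i => H ⁻¹' W i) (fun i => (hW i).preimage H.continuous)
    (fun u _ => mem_iUnion.2 (hcov (H u)))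
  set d := develop W c
  have hadd : ∀ (p : C(I, X)) s t u, d (seg p s u) = d (seg p s t) + d (seg p t u) :=
    develop_seg_add hW hcov hc
  have hself : ∀ (p : C(I, X)) s, d (seg p s s) = 0 := fun p s => by simpa using hadd p s s s
  have cell : ∀ n m, SquareRel d H (t n) (t (n + 1)) (t m) (t (m + 1)) := by
    intro n m
    obtain ⟨i, hi⟩ := ht n m
    have hmem : ∀ u v, H (Icc.convexComb (t n) (t (n + 1)) u,
        Icc.convexComb (t m) (t (m + 1)) v) ∈ W i := fun u v => hi
      ⟨⟨Icc.le_convexComb (tm n.le_succ) u, Icc.convexComb_le (tm n.le_succ) u⟩,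
        ⟨Icc.le_convexComb (tm m.le_succ) v, Icc.convexComb_le (tm m.le_succ) v⟩⟩
    have hS : ∀ u, subsquare H (t n) (t (n + 1)) (t m) (t (m + 1)) u ∈ W i := fun u => hmem _ _
    have h := hc.square i _ hS
    have e1 : row (subsquare H (t n) (t (n + 1)) (t m) (t (m + 1))) 0 =
        seg (row H (t n)) (t m) (t (m + 1)) := by ext u; simp
    have e2 : row (subsquare H (t n) (t (n + 1)) (t m) (t (m + 1))) 1 =
        seg (row H (t (n + 1))) (t m) (t (m + 1)) := by ext u; simp
    have e3 : col (subsquare H (t n) (t (n + 1)) (t m) (t (m + 1))) 0 =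
        seg (col H (t m)) (t n) (t (n + 1)) := by ext u; simp
    have e4 : col (subsquare H (t n) (t (n + 1)) (t m) (t (m + 1))) 1 =
        seg (col H (t (m + 1))) (t n) (t (n + 1)) := by ext u; simp
    have hs : ∀ p : C(I, X), (∀ u, p u ∈ W i) → c p = d p := fun p hp =>
      (develop_eq_self hW hcov hc hp).symm
    rw [hs _ fun u => hS (0, u), hs _ fun u => hS (u, 1), hs _ fun u => hS (u, 0),
      hs _ fun u => hS (1, u), e1, e2, e3, e4] at h
    exact h
  have strip : ∀ n m, SquareRel d H (t n) (t (n + 1)) 0 (t m) := by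
    intro n m
    induction m with
    | zero => simp [SquareRel, t0, hself]
    | succ m ih =>
      have h := cell n m
      unfold SquareRel at *
      rw [hadd (row H (t n)) 0 (t m), hadd (row H (t (n + 1))) 0 (t m), add_assoc, h,
        ← add_assoc, ih, add_assoc]
  have full : ∀ n, SquareRel d H 0 (t n) 0 1 := by
    intro n
    induction n with
    | zero => simp [SquareRel, t0, hself]
    | succ n ih =>
      have h := strip n N
      rw [hN N le_rfl] at h
      unfold SquareRel at *
      rw [hadd (col H 1) 0 (t n), hadd (col H 0) 0 (t n), ← add_assoc, ih, add_assoc, h, add_assoc]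
  have h := full N
  simpa [SquareRel, hN N le_rfl, seg_zero_one] using h

/-- A local cocycle with respect to an open cover extends to all paths. -/
theorem IsLocalCocycle.exists_extension (hc : IsLocalCocycle W c) (hW : ∀ i, IsOpen (W i))
    (hcov : ∀ x, ∃ i, x ∈ W i) :
    ∃ d : PathCocycle X A, ∀ i (p : C(I, X)), (∀ u, p u ∈ W i) → d p = c p :=
  ⟨⟨develop W c, develop_seg_add hW hcov hc, develop_square hW hcov hc⟩,
    fun _ _ hp => develop_eq_self hW hcov hc hp⟩

/-- A property of path classes holds for all of them if it is stable under composition and holds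
for the paths in the members of an open cover. -/
theorem pathClass_induction_of_cover {W : ι → Set X} (hW : ∀ i, IsOpen (W i))
    (hcov : ∀ x, ∃ i, x ∈ W i)
    (P : ∀ {x y : X}, Path.Homotopic.Quotient x y → Prop)
    (htrans : ∀ {x y z : X} (p : Path.Homotopic.Quotient x y) (q : Path.Homotopic.Quotient y z),
      P p → P q → P (p.trans q))
    (hsmall : ∀ i {x y : X} (p : Path x y), (∀ u, p u ∈ W i) → P (.mk p))
    {x y : X} (p : Path.Homotopic.Quotient x y) : P p := by
  induction p using Path.Homotopic.Quotient.ind with | mk p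
  obtain ⟨t, t0, tm, ⟨N, hN⟩, ht⟩ := exists_partition hW hcov (p : C(I, X))
  have key : ∀ n, P (.mk (p.subpath 0 (t n))) := by
    intro n
    induction n with
    | zero =>
      obtain ⟨i, hi⟩ := ht 0
      refine hsmall i _ fun u => ?_
      rw [t0, Path.subpath_self]
      exact hi 0 (by simp [t0])
    | succ n ih =>
      rw [← Path.Homotopic.Quotient.eq.2 ⟨Path.Homotopy.subpathTransSubpath p 0 (t n) (t (n + 1))⟩,
        Path.Homotopic.Quotient.mk_trans]
      obtain ⟨i, hi⟩ := ht n
      exact htrans _ _ ih (hsmall i _ fun u =>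
        hi _ ⟨Icc.le_convexComb (tm n.le_succ) u, Icc.convexComb_le (tm n.le_succ) u⟩)
  have := key N
  rw [hN N le_rfl] at this
  obtain ⟨p, rfl, rfl⟩ := p
  rw [Path.subpath_zero_one] at this
  exact this

end LocalGlobal

/-! ### The degree of paths in the circle -/

section Degree

theorem exists_lift_path (p : C(I, Circle)) : ∃ L : C(I, ℝ), ∀ u, Circle.exp (L u) = p u := by
  obtain ⟨L, hL, -⟩ := Circle.isCoveringMap_exp.exists_path_lifts p (Complex.arg (p 0))
    (Circle.exp_arg _).symm
  exact ⟨L, fun u => congrFun hL u⟩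

/-- Lifts are unique once a starting value is fixed, so two lifts of one path differ by a constant.
-/
theorem lift_sub_eq {L L' : C(I, ℝ)} (h : ∀ u, Circle.exp (L u) = Circle.exp (L' u)) :
    L 1 - L 0 = L' 1 - L' 0 := by
  have : (fun u => L u + (L' 0 - L 0)) = L' := by
    refine Circle.isCoveringMap_exp.eq_of_comp_eq (by fun_prop) L'.continuous ?_ 0 (by ring)
    ext u
    simp only [Function.comp_apply, Circle.exp_add, Circle.exp_sub, h]
    simp
  have h1 := congrFun this 1
  linarith

/-- The degree of a path in the circle, in full turns. -/
def degFun (p : C(I, Circle)) : ℝ :=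
  ((exists_lift_path p).choose 1 - (exists_lift_path p).choose 0) / (2 * Real.pi)

theorem degFun_eq {p : C(I, Circle)} {L : C(I, ℝ)} (h : ∀ u, Circle.exp (L u) = p u) :
    degFun p = (L 1 - L 0) / (2 * Real.pi) := by
  rw [degFun, lift_sub_eq fun u => ((exists_lift_path p).choose_spec u).trans (h u).symm]

/-- The degree as a cocycle on the circle. -/
def deg : PathCocycle Circle ℝ where
  toFun := degFun
  seg_add' p s t u := by
    obtain ⟨L, hL⟩ := exists_lift_path p
    have : ∀ a b, degFun (seg p a b) = (L b - L a) / (2 * Real.pi) := fun a b => by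
      rw [degFun_eq (L := seg L a b) fun u => hL _]
      simp
    rw [this, this, this]
    ring
  square' H := by
    obtain ⟨L, hL⟩ := exists_lift_path (row H 0)
    have h0 : ∀ a, H (0, a) = Circle.exp (L a) := fun a => (hL a).symm
    -- A single lift of the whole square computes the degrees of all four sides.
    let K := Circle.isCoveringMap_exp.liftHomotopy H L h0
    have hK : ∀ u, Circle.exp (K u) = H u :=
      fun u => congrFun (Circle.isCoveringMap_exp.liftHomotopy_lifts H L h0) u
    have hr : ∀ a, degFun (row H a) = (K (a, 1) - K (a, 0)) / (2 * Real.pi) := fun a =>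
      degFun_eq (L := row K a) fun u => hK _
    have hc : ∀ b, degFun (col H b) = (K (1, b) - K (0, b)) / (2 * Real.pi) := fun b =>
      degFun_eq (L := col K b) fun u => hK _
    rw [hr, hr, hc, hc]
    ring

theorem deg_eq {p : C(I, Circle)} {L : C(I, ℝ)} (h : ∀ u, Circle.exp (L u) = p u) :
    deg p = (L 1 - L 0) / (2 * Real.pi) := degFun_eq h

theorem deg_mul (p q : C(I, Circle)) : deg (p * q) = deg p + deg q := by
  obtain ⟨L, hL⟩ := exists_lift_path p
  obtain ⟨M, hM⟩ := exists_lift_path q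
  rw [deg_eq hL, deg_eq hM, deg_eq (L := L + M) fun u => by simp [Circle.exp_add, hL, hM]]
  simp only [ContinuousMap.add_apply]
  ring

theorem deg_zpow (p : C(I, Circle)) (n : ℤ) : deg (p ^ n) = n * deg p := by
  obtain ⟨L, hL⟩ := exists_lift_path p
  rw [deg_eq hL, deg_eq (L := (n : ℝ) • L) fun u => by simp [hL]]
  simp only [ContinuousMap.smul_apply, smul_eq_mul]
  ring

/-- Lifts with the same start and the same increment have the same end, and paths in `ℝ` with common
end points are homotopic. -/
theorem deg_homotopic {x y : Circle} {p q : Path x y}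
    (h : deg (p : C(I, Circle)) = deg (q : C(I, Circle))) : p.Homotopic q := by
  obtain ⟨L, hL⟩ := exists_lift_path (p : C(I, Circle))
  obtain ⟨M, hM⟩ := exists_lift_path (q : C(I, Circle))
  rw [deg_eq hL, deg_eq hM, div_left_inj' (by positivity)] at h
  have hL0 : Circle.exp (L 0) = x := (hL 0).trans p.source
  have hM0 : Circle.exp (M 0) = x := (hM 0).trans q.source
  have hL1 : Circle.exp (L 1) = y := (hL 1).trans p.target
  have h1 : L 0 + (M 1 - M 0) = L 1 := by linarith
  let P : Path (L 0) (L 1) := ⟨L, rfl, rfl⟩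
  let Q : Path (L 0) (L 1) := ⟨⟨fun u => L 0 + (M u - M 0), by fun_prop⟩, by simp, h1⟩
  have hPQ : P.Homotopic Q := SimplyConnectedSpace.paths_homotopic P Q
  have := (hPQ.map (⟨Circle.exp, Circle.isCoveringMap_exp.continuous⟩ : C(ℝ, Circle))).pathCast
    hL0.symm hL1.symm
  convert this using 1
  · ext u
    simp [P, hL]
  · ext u
    simp [Q, hM, Circle.exp_add, Circle.exp_sub, hL0]

theorem deg_loop {x : Circle} (p : Path x x) : ∃ n : ℤ, deg (p : C(I, Circle)) = n := by
  obtain ⟨L, hL⟩ := exists_lift_path (p : C(I, Circle))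
  have : Circle.exp (L 1) = Circle.exp (L 0) := by rw [hL, hL]; simp
  obtain ⟨n, hn⟩ := Circle.exp_eq_exp.1 this
  refine ⟨n, ?_⟩
  rw [deg_eq hL, hn]
  field_simp
  ring

theorem deg_circ (x : Circle) :
    deg (⟨fun t => x * circ t, by fun_prop⟩ : C(I, Circle)) = 1 := by
  rw [deg_eq (L := ⟨fun t => Complex.arg x + 2 * Real.pi * (t : ℝ), by fun_prop⟩)
    fun u => by simp [Circle.exp_add, circ, Circle.exp_arg]]
  simp

instance : PathConnectedSpace Circle :=
  Circle.exp_surjective.pathConnectedSpace Circle.isCoveringMap_exp.continuous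

end Degree

/-! ### Paths in the 3-torus -/

section Torus

/-- The coordinate projections of `T³`. -/
def proj : Fin 3 → C(T3, Circle) :=
  ![⟨fun x => x.1.1, by fun_prop⟩, ⟨fun x => x.1.2, by fun_prop⟩, ⟨fun x => x.2, by fun_prop⟩]

/-- The degrees of a path in `T³`. -/
def degT (i : Fin 3) : PathCocycle T3 ℝ := deg.comap (proj i)

theorem T3.path_ext {x y : T3} {p q : Path.Homotopic.Quotient x y}
    (h : ∀ i, (degT i).onQuot p = (degT i).onQuot q) : p = q := by
  induction p using Path.Homotopic.Quotient.ind with | mk p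
  induction q using Path.Homotopic.Quotient.ind with | mk q
  obtain ⟨⟨x0, x1⟩, x2⟩ := x
  obtain ⟨⟨y0, y1⟩, y2⟩ := y
  let p0 : ∀ r : Path ((x0, x1), x2) ((y0, y1), y2), Path x0 y0 := fun r => r.map (proj 0).continuous
  let p1 : ∀ r : Path ((x0, x1), x2) ((y0, y1), y2), Path x1 y1 := fun r => r.map (proj 1).continuous
  let p2 : ∀ r : Path ((x0, x1), x2) ((y0, y1), y2), Path x2 y2 := fun r => r.map (proj 2).continuous
  have h0 : (p0 p).Homotopic (p0 q) := deg_homotopic (h 0)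
  have h1 : (p1 p).Homotopic (p1 q) := deg_homotopic (h 1)
  have h2 : (p2 p).Homotopic (p2 q) := deg_homotopic (h 2)
  refine Path.Homotopic.Quotient.eq.2 ?_
  have hp : ∀ r, r = ((p0 r).prod (p1 r)).prod (p2 r) := fun r => by ext u <;> rfl
  rw [hp p, hp q]
  obtain ⟨h0⟩ := h0
  obtain ⟨h1⟩ := h1
  obtain ⟨h2⟩ := h2
  exact ⟨Path.Homotopic.prodHomotopy (Path.Homotopic.prodHomotopy h0 h1) h2⟩

theorem degT_loop {x : T3} (q : Path.Homotopic.Quotient x x) (i : Fin 3) :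
    ∃ n : ℤ, (degT i).onQuot q = n := by
  induction q using Path.Homotopic.Quotient.ind with | mk q
  exact deg_loop (q.map (proj i).continuous)

/-- The vector of degrees of a loop in `T³`. -/
def degVec {x : T3} (q : Path.Homotopic.Quotient x x) (i : Fin 3) : ℤ := (degT_loop q i).choose

theorem degVec_cast {x : T3} (q : Path.Homotopic.Quotient x x) (i : Fin 3) :
    (degVec q i : ℝ) = (degT i).onQuot q := (degT_loop q i).choose_spec.symm

theorem degVec_injective {x : T3} : Function.Injective (degVec (x := x)) := fun p q h =>
  T3.path_ext fun i => by rw [← degVec_cast, ← degVec_cast, h]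

theorem degVec_trans {x : T3} (p q : Path.Homotopic.Quotient x x) :
    degVec (p.trans q) = degVec p + degVec q := by
  ext i
  rw [← Int.cast_inj (α := ℝ), degVec_cast]
  simp [degVec_cast]

theorem degVec_refl (x : T3) : degVec (Path.Homotopic.Quotient.refl x) = 0 := by
  ext i
  rw [← Int.cast_inj (α := ℝ), degVec_cast]
  simp

theorem degVec_symm {x : T3} (p : Path.Homotopic.Quotient x x) : degVec p.symm = - degVec p := by
  ext i
  rw [← Int.cast_inj (α := ℝ), degVec_cast]
  simp [degVec_cast]

/-- The degrees of a loop, as a homomorphism on the fundamental group. -/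
def degHom (x : T3) : FundamentalGroup T3 x →* Multiplicative (Fin 3 → ℤ) where
  toFun q := .ofAdd (degVec (FundamentalGroup.toPath q))
  map_one' := congrArg Multiplicative.ofAdd (degVec_refl x)
  map_mul' p q := by
    -- The product `p * q` in the fundamental group runs through `q` first; commutativity of the
    -- target absorbs the reversal.
    rw [mul_comm]
    exact congrArg Multiplicative.ofAdd (degVec_trans q.toPath p.toPath)

theorem degHom_injective (x : T3) : Function.Injective (degHom x) := fun _ _ h =>
  degVec_injective (Multiplicative.ofAdd.injective h)

theorem degVec_basisClass (x : T3) (i : Fin 3) :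
    degVec (FundamentalGroup.toPath (basisClass x i)) = Pi.single i 1 := by
  have e : ∀ j, (proj j).comp ((![loopα x, loopβ x, loopγ x] i : Path x x) : C(I, T3)) =
      ⟨fun t => proj j x * (if i = j then circ t else 1), by split_ifs <;> fun_prop⟩ := by
    intro j
    ext1 t
    fin_cases i <;> fin_cases j <;> simp [proj, loopα, loopβ, loopγ]
  ext j
  rw [← Int.cast_inj (α := ℝ), degVec_cast]
  change deg ((proj j).comp ((![loopα x, loopβ x, loopγ x] i : Path x x) : C(I, T3))) = _
  rw [e]
  by_cases h : i = j
  · subst h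
    simpa using deg_circ _
  · simp only [if_neg h, mul_one, Pi.single_apply, if_neg (Ne.symm h), Int.cast_zero]
    exact deg.const (proj j x)

theorem degHom_basisClass (x : T3) (i : Fin 3) :
    degHom x (basisClass x i) = .ofAdd (Pi.single i 1) :=
  congrArg Multiplicative.ofAdd (degVec_basisClass x i)

/-- The class with prescribed degrees. -/
def classOf (x : T3) (n : Fin 3 → ℤ) : FundamentalGroup T3 x :=
  basisClass x 0 ^ n 0 * basisClass x 1 ^ n 1 * basisClass x 2 ^ n 2

theorem degHom_classOf (x : T3) (n : Fin 3 → ℤ) : degHom x (classOf x n) = .ofAdd n := by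
  simp only [classOf, map_mul, map_zpow, degHom_basisClass, ← ofAdd_zsmul, ← ofAdd_add]
  congr 1
  ext i
  fin_cases i <;> simp

/-- The fundamental group of `T³` is `ℤ³`. -/
def degEquiv (x : T3) : FundamentalGroup T3 x ≃* Multiplicative (Fin 3 → ℤ) :=
  MulEquiv.ofBijective (degHom x)
    ⟨degHom_injective x, fun n => ⟨classOf x n.toAdd, degHom_classOf x _⟩⟩

theorem classOf_degVec {x : T3} (q : FundamentalGroup T3 x) :
    classOf x (degVec (FundamentalGroup.toPath q)) = q :=
  degHom_injective x (degHom_classOf x _)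

theorem degVec_classOf (x : T3) (n : Fin 3 → ℤ) :
    degVec (FundamentalGroup.toPath (classOf x n)) = n :=
  Multiplicative.ofAdd.injective (degHom_classOf x n)

/-- Conjugation by a path does not change degrees. -/
theorem degVec_conj {x y : T3} (s : Path.Homotopic.Quotient x y)
    (q : Path.Homotopic.Quotient y y) : degVec ((s.trans q).trans s.symm) = degVec q := by
  ext i
  rw [← Int.cast_inj (α := ℝ), degVec_cast, degVec_cast]
  simp

theorem degVec_map {φ : C(T3, T3)} {A : Matrix (Fin 3) (Fin 3) ℤ} (h : IsMatrixOf φ A) {x : T3}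
    (q : Path.Homotopic.Quotient x x) : degVec (q.map φ) = A.mulVec (degVec q) := by
  have h1 : ∀ j, degHom (φ x) (FundamentalGroup.map φ x (basisClass x j)) =
      .ofAdd (A.col j) := by
    intro j
    rw [h x j]
    exact degHom_classOf (φ x) (A.col j)
  have h2 : ∀ n, degHom (φ x) (FundamentalGroup.map φ x (classOf x n)) = .ofAdd (A.mulVec n) := by
    intro n
    simp only [classOf, map_mul, map_zpow, h1, ← ofAdd_zsmul, ← ofAdd_add]
    congr 1
    ext i
    simp [Matrix.mulVec, dotProduct, Fin.sum_univ_three, mul_comm]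
  have h3 := h2 (degVec q)
  have h4 : classOf x (degVec q) = q := classOf_degVec (x := x) q
  rw [h4] at h3
  exact Multiplicative.ofAdd.injective h3

/-- The matrix of a homeomorphism has an integral inverse. -/
theorem IsMatrixOf.exists_inverse {φ : T3 ≃ₜ T3} {A : Matrix (Fin 3) (Fin 3) ℤ}
    (h : IsMatrixOf (φ : C(T3, T3)) A) : ∃ B : Matrix (Fin 3) (Fin 3) ℤ, A * B = 1 ∧ B * A = 1 := by
  let x : T3 := 1
  suffices ∃ B : Matrix (Fin 3) (Fin 3) ℤ, A * B = 1 by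
    obtain ⟨B, hB⟩ := this
    exact ⟨B, hB, mul_eq_one_comm.1 hB⟩
  refine ⟨.of fun i j => degVec (((FundamentalGroup.toPath (basisClass x j)).map
    (φ.symm : C(T3, T3)))) i, ?_⟩
  ext i j
  have := degVec_map h ((FundamentalGroup.toPath (basisClass x j)).map (φ.symm : C(T3, T3)))
  have h2 := congrFun this i
  -- The loop lives at `φ (φ.symm x)`, which is not literally `x`. Pulling the degree cocycle back
  -- along both maps avoids comparing base points.
  rw [← Int.cast_inj (α := ℝ), degVec_cast, ← PathCocycle.comap_onQuot,
    ← PathCocycle.comap_onQuot] at h2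
  have e : (((degT i).comap (φ : C(T3, T3))).comap (φ.symm : C(T3, T3))) = degT i := by
    simp only [PathCocycle.comap, degT]
    congr 1
    ext p
    congr 1
    ext u
    simp
  rw [e, ← degVec_cast, degVec_basisClass, Int.cast_inj] at h2
  rw [Matrix.mul_apply', Matrix.one_apply, Pi.single_apply] at *
  exact h2.symm

end Torus

/-! ### Topology of `Y ∪_f (T² × D²)` -/

/-- The direction `z / |z|` of a complex number, with value `1` at `0`. -/
def nrm (z : ℂ) : Circle := Circle.exp z.arg

theorem norm_mul_nrm (z : ℂ) : (‖z‖ : ℂ) * (nrm z : ℂ) = z := Complex.norm_mul_exp_arg_mul_I z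

theorem nrm_coe (z : Circle) : nrm (z : ℂ) = z := Circle.exp_arg z

theorem coe_nrm {z : ℂ} (hz : z ≠ 0) : (nrm z : ℂ) = z / ‖z‖ := by
  rw [eq_div_iff (by simpa using hz), mul_comm, norm_mul_nrm]

theorem nrm_ofReal_mul {r : ℝ} (hr : 0 < r) (z : ℂ) : nrm ((r : ℂ) * z) = nrm z := by
  rw [nrm, nrm, Complex.arg_real_mul z hr]

theorem isInducing_coe_circle : IsInducing fun z : Circle => (z : ℂ) := ⟨rfl⟩

theorem continuousOn_nrm : ContinuousOn nrm {0}ᶜ := by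
  rw [continuousOn_iff_continuous_domRestrict, isInducing_coe_circle.continuous_iff]
  have : ((fun z : Circle => (z : ℂ)) ∘ ({0}ᶜ : Set ℂ).domRestrict nrm) =
      fun z : ({0}ᶜ : Set ℂ) => (z : ℂ) / (‖(z : ℂ)‖ : ℂ) := by
    ext z
    exact coe_nrm z.2
  rw [this]
  refine continuous_subtype_val.div (by fun_prop) fun z =>
    Complex.ofReal_ne_zero.2 (norm_ne_zero_iff.2 z.2)

section Glue

variable {Y : Type} [TopologicalSpace Y] (f : C(T3, Y))

namespace Glue

/-- The canonical map `T² × D² → Y ∪_f (T² × D²)`. -/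
def inr : C(Solid, Glue f) where
  toFun s := Quot.mk (GlueRel f) (Sum.inr s)
  continuous_toFun := continuous_quot_mk.comp continuous_inr

theorem inr_bdry (x : T3) : inr f (bdry x) = inl f (f x) := Quot.sound (.glue x)

theorem inr_comp_bdry : (inr f).comp bdry = (inl f).comp f := by
  ext x
  exact inr_bdry f x

@[elab_as_elim]
theorem ind {P : Glue f → Prop} (hl : ∀ y, P (inl f y)) (hr : ∀ s, P (inr f s)) (x : Glue f) :
    P x := by
  induction x using Quot.ind with | mk x
  cases x with
  | inl y => exact hl y
  | inr s => exact hr s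

/-- A map out of the glued space. -/
def desc {Z : Type*} (g : Y → Z) (h : Solid → Z) (hgh : ∀ x, h (bdry x) = g (f x)) : Glue f → Z :=
  Quot.lift (Sum.elim g h) fun _ _ r => by
    cases r with
    | glue x => exact hgh x

@[simp]
theorem desc_inl {Z : Type*} (g : Y → Z) (h : Solid → Z) (hgh : ∀ x, h (bdry x) = g (f x)) (y : Y) :
    desc f g h hgh (inl f y) = g y := rfl

@[simp]
theorem desc_inr {Z : Type*} (g : Y → Z) (h : Solid → Z) (hgh : ∀ x, h (bdry x) = g (f x))
    (s : Solid) : desc f g h hgh (inr f s) = h s := rfl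

theorem continuous_desc {Z : Type*} [TopologicalSpace Z] {g : Y → Z} {h : Solid → Z}
    (hgh : ∀ x, h (bdry x) = g (f x)) (hg : Continuous g) (hh : Continuous h) :
    Continuous (desc f g h hgh) :=
  continuous_quot_lift _ (continuous_sum_dom.2 ⟨hg, hh⟩)

theorem isOpen_iff {U : Set (Glue f)} :
    IsOpen U ↔ IsOpen (inl f ⁻¹' U) ∧ IsOpen (inr f ⁻¹' U) := by
  exact (isQuotientMap_quot_mk (r := GlueRel f)).isOpen_preimage.symm.trans isOpen_sum_iff

theorem continuousOn_desc {Z : Type*} [TopologicalSpace Z] {g : Y → Z} {h : Solid → Z}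
    (hgh : ∀ x, h (bdry x) = g (f x)) {U : Set (Glue f)} (hU : IsOpen U)
    (hg : ContinuousOn g (inl f ⁻¹' U)) (hh : ContinuousOn h (inr f ⁻¹' U)) :
    ContinuousOn (desc f g h hgh) U := by
  have hU' := (isOpen_iff f).1 hU
  rw [continuousOn_open_iff hU]
  intro t ht
  rw [isOpen_iff]
  exact ⟨(continuousOn_open_iff hU'.1).1 hg t ht, (continuousOn_open_iff hU'.2).1 hh t ht⟩

/-- The radius, equal to `1` on `Y`. -/
def radius : Glue f → ℝ :=
  desc f (fun _ => 1) (fun s => ‖(s.2 : ℂ)‖) fun x => Circle.norm_coe x.2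

theorem continuous_radius : Continuous (radius f) :=
  continuous_desc f _ (by fun_prop) (by fun_prop)

/-- The complement of the core `T² × {0}`. -/
def outer : Set (Glue f) := {x | 0 < radius f x}

/-- The interior of `T² × D²`. -/
def inner : Set (Glue f) := {x | radius f x < 1}

theorem isOpen_outer : IsOpen (outer f) := isOpen_lt continuous_const (continuous_radius f)

theorem isOpen_inner : IsOpen (inner f) := isOpen_lt (continuous_radius f) continuous_const

/-- The open cover by `outer` and `inner`. -/
def cover : Bool → Set (Glue f) := fun b => cond b (outer f) (inner f)

theorem isOpen_cover (b : Bool) : IsOpen (cover f b) := by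
  cases b
  exacts [isOpen_inner f, isOpen_outer f]

theorem exists_mem_cover (x : Glue f) : ∃ b, x ∈ cover f b := by
  rcases lt_or_ge 0 (radius f x) with h | h
  · exact ⟨true, h⟩
  · exact ⟨false, h.trans_lt one_pos⟩

theorem inl_mem_outer (y : Y) : inl f y ∈ outer f := zero_lt_one (α := ℝ)

/-- The boundary point in the direction of a point of `T² × D²`. -/
def toBdry (s : Solid) : T3 := (s.1, nrm s.2)

theorem toBdry_bdry (x : T3) : toBdry (bdry x) = x := Prod.ext rfl (nrm_coe x.2)

theorem continuousOn_toBdry : ContinuousOn toBdry {s | 0 < ‖(s.2 : ℂ)‖} := by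
  refine continuousOn_fst.prodMk (continuousOn_nrm.comp (by fun_prop) fun s hs => ?_)
  simpa using hs

/-- The retraction to `Y`, continuous away from the core. -/
def ret : Glue f → Y := desc f id (fun s => f (toBdry s)) fun x => by rw [toBdry_bdry]; rfl

@[simp]
theorem ret_inr (s : Solid) : ret f (inr f s) = f (toBdry s) := rfl

theorem continuousOn_ret : ContinuousOn (ret f) (outer f) :=
  continuousOn_desc f _ (isOpen_outer f) continuousOn_id
    (f.continuous.comp_continuousOn continuousOn_toBdry)

/-- The coordinates of an interior point of `T² × D²`. -/
def core : Glue f → Solid :=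
  open Classical in
  -- Off the interior a constant filler is used; boundary points have norm `1`, so it is compatible
  -- with the gluing.
  desc f (fun _ => (1, ⟨0, by simp⟩)) (fun s => if ‖(s.2 : ℂ)‖ < 1 then s else (1, ⟨0, by simp⟩))
    fun x => if_neg (by simpa [bdry] using (Circle.norm_coe x.2).ge)

theorem core_inr {s : Solid} (hs : ‖(s.2 : ℂ)‖ < 1) : core f (inr f s) = s := if_pos hs

theorem continuousOn_core : ContinuousOn (core f) (inner f) := by
  refine continuousOn_desc f _ (isOpen_inner f) continuousOn_const (continuousOn_id.congr ?_)
  exact fun s hs => if_pos hs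

theorem inr_core {x : Glue f} (hx : x ∈ inner f) : inr f (core f x) = x := by
  induction x using ind with
  | hl y => exact absurd hx (lt_irrefl (1 : ℝ))
  | hr s => rw [core_inr f hx]

theorem ret_eq {x : Glue f} (hx : x ∈ inner f) : ret f x = f (toBdry (core f x)) := by
  rw [← ret_inr, inr_core f hx]

end Glue

/-! ### Extension of cocycles -/

variable {A : Type*} [AddCommGroup A]

/-- The homomorphism on the fundamental group given by a cocycle. -/
def PathCocycle.hom {X : Type*} [TopologicalSpace X] (c : PathCocycle X A) (x : X) :
    FundamentalGroup X x →* Multiplicative A where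
  toFun q := .ofAdd (c.onQuot (FundamentalGroup.toPath q))
  map_one' := congrArg Multiplicative.ofAdd (c.onQuot_refl x)
  map_mul' p q := by
    rw [mul_comm]
    exact congrArg Multiplicative.ofAdd (c.onQuot_trans q.toPath p.toPath)

/-- Following one path backwards and then the other gives a loop whose first two degrees vanish,
hence a power of `γ`, on which `d` is zero. Thus `d` sees only the `T²`-coordinate of a path with
given end points. -/
theorem PathCocycle.onQuot_eq_of_degT (d : PathCocycle T3 A)
    (hd : ∀ x, d (loopγ x : C(I, T3)) = 0) {x y : T3} (p q : Path.Homotopic.Quotient x y)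
    (h0 : (degT 0).onQuot p = (degT 0).onQuot q) (h1 : (degT 1).onQuot p = (degT 1).onQuot q) :
    d.onQuot p = d.onQuot q := by
  have e : d.hom y (classOf y (degVec (p.symm.trans q))) = .ofAdd (d.onQuot (p.symm.trans q)) := by
    rw [show degVec (p.symm.trans q) = degVec (FundamentalGroup.toPath (x := y) (p.symm.trans q))
      from rfl, classOf_degVec]
    rfl
  have z0 : degVec (p.symm.trans q) 0 = 0 := by
    rw [← Int.cast_inj (α := ℝ), degVec_cast]
    simp [h0]
  have z1 : degVec (p.symm.trans q) 1 = 0 := by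
    rw [← Int.cast_inj (α := ℝ), degVec_cast]
    simp [h1]
  have hγ : d.hom y (basisClass y 2) = 1 := congrArg Multiplicative.ofAdd (hd y)
  simp only [classOf, z0, z1, map_mul, map_zpow, hγ, zpow_zero, one_zpow, map_one, mul_one] at e
  have := Multiplicative.ofAdd.injective (ofAdd_zero.trans e)
  simp only [onQuot_trans, onQuot_symm] at this
  rw [eq_comm, ← sub_eq_zero, sub_eq_neg_add, this]

theorem PathCocycle.add_eq_of_deg (d : PathCocycle T3 A)
    (hd : ∀ x, d (loopγ x : C(I, T3)) = 0) {p q p' q' : C(I, T3)} (hp : p 1 = q 0)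
    (hp' : p' 1 = q' 0) (h0 : p 0 = p' 0) (h1 : q 1 = q' 1)
    (e0 : degT 0 p + degT 0 q = degT 0 p' + degT 0 q')
    (e1 : degT 1 p + degT 1 q = degT 1 p' + degT 1 q') : d p + d q = d p' + d q' := by
  let P : Path (p 0) (p 1) := ⟨p, rfl, rfl⟩
  let Q : Path (p 1) (q 1) := ⟨q, hp.symm, rfl⟩
  let P' : Path (p 0) (p' 1) := ⟨p', h0.symm, rfl⟩
  let Q' : Path (p' 1) (q 1) := ⟨q', hp'.symm, h1.symm⟩
  have := d.onQuot_eq_of_degT hd ((Path.Homotopic.Quotient.mk P).trans (.mk Q))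
    ((Path.Homotopic.Quotient.mk P').trans (.mk Q')) (by rw [onQuot_trans, onQuot_trans]; exact e0)
    (by rw [onQuot_trans, onQuot_trans]; exact e1)
  rwa [onQuot_trans, onQuot_trans] at this

namespace Glue

theorem continuous_core_comp {p : C(I, Glue f)} (hp : ∀ u, p u ∈ inner f) :
    Continuous fun u => core f (p u) :=
  (continuousOn_core f).comp_continuous p.continuous hp

/-- A path in `T³` following the `T²`-coordinate of a path in the interior of `T² × D²`. -/
def torusPath (p : C(I, Glue f)) (hp : ∀ u, p u ∈ inner f) : C(I, T3) where
  -- The direction in the disc makes no sense at the core. Only its end values are kept, and an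
  -- arbitrary path joins them; a cocycle vanishing on `γ` does not notice the choice.
  toFun u := ((core f (p u)).1, PathConnectedSpace.somePath (nrm (core f (p 0)).2)
    (nrm (core f (p 1)).2) u)
  continuous_toFun := by
    have := continuous_core_comp f hp
    fun_prop

theorem torusPath_zero (p : C(I, Glue f)) (hp : ∀ u, p u ∈ inner f) :
    torusPath f p hp 0 = toBdry (core f (p 0)) := by
  simp [torusPath, toBdry]

theorem torusPath_one (p : C(I, Glue f)) (hp : ∀ u, p u ∈ inner f) :
    torusPath f p hp 1 = toBdry (core f (p 1)) := by
  simp [torusPath, toBdry]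

/-- The path in `Y` obtained by retracting a path which avoids the core. -/
def retPath (p : C(I, Glue f)) (hp : ∀ u, p u ∈ outer f) : C(I, Y) where
  toFun u := ret f (p u)
  continuous_toFun := (continuousOn_ret f).comp_continuous p.continuous hp

/-- The local cocycle on `Y ∪_f (T² × D²)` determined by a cocycle on `Y`. -/
def localCocycle (c : PathCocycle Y A) (p : C(I, Glue f)) : A :=
  open Classical in
  if hp : ∀ u, p u ∈ outer f then c (retPath f p hp)
  else if hp : ∀ u, p u ∈ inner f then c.comap f (torusPath f p hp)
  else 0

variable {f}

theorem localCocycle_outer (c : PathCocycle Y A) {p : C(I, Glue f)} (hp : ∀ u, p u ∈ outer f) :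
    localCocycle f c p = c (retPath f p hp) := dif_pos hp

/-- This is the compatibility on the overlap: for a path avoiding the core, its radial projection
and `torusPath` have the same end points and the same `T²`-coordinate, so the two definitions agree.
-/
theorem localCocycle_inner (c : PathCocycle Y A) (hc : ∀ x, c (f.comp (loopγ x : C(I, T3))) = 0)
    {p : C(I, Glue f)} (hp : ∀ u, p u ∈ inner f) :
    localCocycle f c p = c.comap f (torusPath f p hp) := by
  by_cases h : ∀ u, p u ∈ outer f
  · rw [localCocycle_outer c h]
    let q : C(I, T3) := ⟨fun u => toBdry (core f (p u)), by
      refine continuousOn_toBdry.comp_continuous (continuous_core_comp f hp) fun u => ?_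
      have := h u
      rw [← inr_core f (hp u)] at this
      exact this⟩
    have e : retPath f p h = f.comp q := by
      ext u
      exact ret_eq f (hp u)
    rw [e]
    have := (c.comap f).add_eq_of_deg hc (p := q) (q := .const I (q 1)) (p' := torusPath f p hp)
      (q' := .const I (q 1)) rfl (torusPath_one f p hp) (torusPath_zero f p hp).symm rfl rfl rfl
    rw [(c.comap f).const] at this
    simpa using this
  · rw [localCocycle, dif_neg h, dif_pos hp]

/-- Away from the core everything is pulled back along the continuous retraction to `Y`. In the
interior only end points and the first two degrees matter, and these degrees are cocycles of the
continuous `T²`-coordinate. -/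
theorem isLocalCocycle (c : PathCocycle Y A) (hc : ∀ x, c (f.comp (loopγ x : C(I, T3))) = 0) :
    IsLocalCocycle (cover f) (localCocycle f c) where
  seg_add' i p s t u hp := by
    cases i with
    | true =>
      have hp : ∀ v, p v ∈ outer f := hp
      have hseg : ∀ a b v, seg p a b v ∈ outer f := fun a b v => hp _
      rw [localCocycle_outer c (hseg s u), localCocycle_outer c (hseg s t),
        localCocycle_outer c (hseg t u)]
      exact c.seg_add (retPath f p hp) s t u
    | false =>
      have hp : ∀ v, p v ∈ inner f := hp
      have hseg : ∀ a b v, seg p a b v ∈ inner f := fun a b v => hp _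
      rw [localCocycle_inner c hc (hseg s u), localCocycle_inner c hc (hseg s t),
        localCocycle_inner c hc (hseg t u)]
      have := (c.comap f).add_eq_of_deg hc (p := torusPath f _ (hseg s u))
        (q := .const I (toBdry (core f (p u)))) (p' := torusPath f _ (hseg s t))
        (q' := torusPath f _ (hseg t u)) ?_ ?_ ?_ ?_ ?_ ?_
      · rwa [(c.comap f).const, add_zero] at this
      · rw [torusPath_one]; simp
      · rw [torusPath_one, torusPath_zero]; simp
      · rw [torusPath_zero, torusPath_zero]; simp
      · rw [torusPath_one]; simp
      · rw [(degT 0).const, add_zero]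
        exact (degT 0).seg_add (torusPath f p hp) s t u
      · rw [(degT 1).const, add_zero]
        exact (degT 1).seg_add (torusPath f p hp) s t u
  square i H hH := by
    cases i with
    | true =>
      rw [localCocycle_outer c fun u => hH (0, u), localCocycle_outer c fun u => hH (u, 1),
        localCocycle_outer c fun u => hH (u, 0), localCocycle_outer c fun u => hH (1, u)]
      exact c.square ⟨fun u => ret f (H u),
        (continuousOn_ret f).comp_continuous H.continuous hH⟩
    | false =>
      have hr : ∀ a u, row H a u ∈ inner f := fun a u => hH (a, u)
      have hl : ∀ b u, col H b u ∈ inner f := fun b u => hH (u, b)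
      rw [localCocycle_inner c hc (hr 0), localCocycle_inner c hc (hl 1),
        localCocycle_inner c hc (hl 0), localCocycle_inner c hc (hr 1)]
      let K : C(I × I, T2) := ⟨fun u => (core f (H u)).1,
        continuous_fst.comp ((continuousOn_core f).comp_continuous H.continuous hH)⟩
      refine (c.comap f).add_eq_of_deg hc ?_ ?_ ?_ ?_ ?_ ?_
      · rw [torusPath_one, torusPath_zero]; rfl
      · rw [torusPath_one, torusPath_zero]; rfl
      · rw [torusPath_zero, torusPath_zero]; rfl
      · rw [torusPath_one, torusPath_one]; rfl
      · exact deg.square (ContinuousMap.fst.comp K)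
      · exact deg.square (ContinuousMap.snd.comp K)

/-- A cocycle on `Y` which vanishes on the image of the meridian loops extends to the glued
space. -/
theorem exists_extension (c : PathCocycle Y A) (hc : ∀ x, c (f.comp (loopγ x : C(I, T3))) = 0) :
    ∃ d : PathCocycle (Glue f) A, ∀ p : C(I, Y), d ((inl f).comp p) = c p := by
  obtain ⟨d, hd⟩ := (isLocalCocycle c hc).exists_extension (isOpen_cover f) (exists_mem_cover f)
  have ho : ∀ (p : C(I, Y)) u, (inl f).comp p u ∈ outer f := fun p u => inl_mem_outer f (p u)
  exact ⟨d, fun p => (hd true _ (ho p)).trans (localCocycle_outer c (ho p))⟩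

end Glue

end Glue

/-! ### Surjectivity on fundamental groups -/

theorem disc_norm_le {a b : ℝ} (ha : 0 ≤ a) (hb : 0 ≤ b) (hab : a + b = 1) {z w : ℂ}
    (hz : ‖z‖ ≤ 1) (hw : ‖w‖ ≤ 1) : ‖(a : ℂ) * z + (b : ℂ) * w‖ ≤ 1 := by
  refine (norm_add_le _ _).trans ?_
  rw [norm_mul, norm_mul, Complex.norm_real, Complex.norm_real, Real.norm_of_nonneg ha,
    Real.norm_of_nonneg hb, ← hab]
  gcongr <;> nlinarith [norm_nonneg z, norm_nonneg w]

/-- The straight line between two points of the disc. -/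
def discLine (t : I) (z w : Disc) : Disc :=
  ⟨((1 - (t : ℝ) : ℝ) : ℂ) * (z : ℂ) + ((t : ℝ) : ℂ) * (w : ℂ),
    disc_norm_le (by linarith [t.2.2]) t.2.1 (by ring) z.2 w.2⟩

@[fun_prop]
theorem continuous_discLine {Z : Type*} [TopologicalSpace Z] {t : Z → I} {z w : Z → Disc}
    (ht : Continuous t) (hz : Continuous z) (hw : Continuous w) :
    Continuous fun x => discLine (t x) (z x) (w x) := by
  unfold discLine
  fun_prop

@[simp]
theorem discLine_zero (z w : Disc) : discLine 0 z w = z := by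
  ext
  simp [discLine]

@[simp]
theorem discLine_one (z w : Disc) : discLine 1 z w = w := by
  ext
  simp [discLine]

@[simp]
theorem discLine_self (t : I) (z : Disc) : discLine t z z = z := by
  ext
  simp only [discLine]
  push_cast
  ring

instance : ContractibleSpace Disc where
  hequiv_unit' := ⟨{
    toFun := .const _ ()
    invFun := .const _ ⟨0, by simp⟩
    left_inv := ⟨{
      toFun := fun x => discLine x.1 ⟨0, by simp⟩ x.2
      continuous_toFun := by fun_prop
      map_zero_left := fun x => by simp
      map_one_left := fun x => by simp }⟩
    right_inv := ⟨.refl _⟩ }⟩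

/-- Paths in `T² × D²` are determined up to homotopy by their first component. -/
theorem Solid.path_homotopic {x y : Solid} {p q : Path x y}
    (h : (p.map continuous_fst).Homotopic (q.map continuous_fst)) : p.Homotopic q := by
  obtain ⟨h1⟩ := h
  obtain ⟨h2⟩ : (p.map continuous_snd).Homotopic (q.map continuous_snd) :=
    SimplyConnectedSpace.paths_homotopic _ _
  exact ⟨Path.Homotopic.prodHomotopy h1 h2⟩

section Glue

variable {Y : Type} [TopologicalSpace Y] {f : C(T3, Y)}

namespace Glue

/-- The radial path from the boundary point `toBdry s` to `s`. -/
def radial (s : Solid) : Path (bdry (toBdry s)) s where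
  toFun t := (s.1, discLine t (bdry (toBdry s)).2 s.2)
  continuous_toFun := by fun_prop
  source' := by simp [bdry, toBdry]
  target' := by simp

variable (f) in
/-- The path from the retraction of a point to the point, as a map on the interval. -/
def rhoMap : Glue f → C(I, Glue f) :=
  desc f (fun y => .const I (inl f y)) (fun s => (inr f).comp (radial s : C(I, Solid))) fun x => by
    ext1 t
    have : radial (bdry x) t = bdry x := by
      ext1
      · rfl
      · change discLine t (bdry (toBdry (bdry x))).2 (bdry x).2 = _
        rw [toBdry_bdry, discLine_self]
    simp only [ContinuousMap.comp_apply, ContinuousMap.coe_coe, this, inr_bdry]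
    rfl

variable (f) in
/-- The path from the retraction of a point to the point. -/
def rho (x : Glue f) : Path (inl f (ret f x)) x where
  toContinuousMap := rhoMap f x
  source' := by
    induction x using ind with
    | hl y => rfl
    | hr s =>
      change inr f (radial s 0) = _
      rw [(radial s).source, inr_bdry]
      rfl
  target' := by
    induction x using ind with
    | hl y => rfl
    | hr s => exact congrArg (inr f) (radial s).target

theorem continuousOn_rhoMap : ContinuousOn (rhoMap f) (outer f) := by
  refine continuousOn_desc f _ (isOpen_outer f) ?_ ?_
  · exact Continuous.continuousOn (ContinuousMap.continuous_const'.comp (inl f).continuous)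
  · rw [continuousOn_iff_continuous_domRestrict]
    refine (ContinuousMap.continuous_postcomp (inr f)).comp (?_ : Continuous
      fun s : inr f ⁻¹' outer f => (radial s.1 : C(I, Solid)))
    refine ContinuousMap.continuous_of_continuous_uncurry _ ?_
    have h : Continuous fun s : inr f ⁻¹' outer f => toBdry s.1 :=
      continuousOn_iff_continuous_domRestrict.1 continuousOn_toBdry
    change Continuous fun q : (inr f ⁻¹' outer f) × I =>
      (q.1.1.1, discLine q.2 (bdry (toBdry q.1.1)).2 q.1.1.2)
    have h2 : Continuous fun q : (inr f ⁻¹' outer f) × I => (bdry (toBdry q.1.1)).2 :=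
      continuous_snd.comp (bdry.continuous.comp (h.comp continuous_fst))
    exact (by fun_prop : Continuous fun q : (inr f ⁻¹' outer f) × I => q.1.1.1).prodMk
      (continuous_discLine continuous_snd h2 (by fun_prop))

/-- A class of paths in the glued space which comes from `Y` after moving the end points to `Y`. -/
def FromBase {x y : Glue f} (q : Path.Homotopic.Quotient x y) : Prop :=
  ∃ q' : Path.Homotopic.Quotient (ret f x) (ret f y),
    (Path.Homotopic.Quotient.mk (rho f x)).trans q =
      (q'.map (inl f)).trans (.mk (rho f y))

theorem FromBase.trans {x y z : Glue f} {p : Path.Homotopic.Quotient x y}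
    {q : Path.Homotopic.Quotient y z} (hp : FromBase p) (hq : FromBase q) :
    FromBase (p.trans q) := by
  obtain ⟨p', hp⟩ := hp
  obtain ⟨q', hq⟩ := hq
  refine ⟨p'.trans q', ?_⟩
  rw [map_trans_class, ← Path.Homotopic.Quotient.trans_assoc, hp, Path.Homotopic.Quotient.trans_assoc, hq,
    Path.Homotopic.Quotient.trans_assoc]

/-- The radial paths over the points of `p` sweep out a square, with `p` and its retraction on
opposite sides. -/
theorem fromBase_outer {x y : Glue f} (p : Path x y) (hp : ∀ u, p u ∈ outer f) :
    FromBase (.mk p) := by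
  let q : Path (ret f x) (ret f y) :=
    ⟨⟨fun u => ret f (p u), (continuousOn_ret f).comp_continuous p.continuous hp⟩, by simp, by simp⟩
  refine ⟨.mk q, ?_⟩
  have hc : Continuous fun u => rhoMap f (p u) :=
    continuousOn_rhoMap.comp_continuous p.continuous hp
  let H : C(I × I, Glue f) := ⟨fun u => rhoMap f (p u.2) u.1,
    (hc.comp continuous_snd).eval continuous_fst⟩
  refine (square_class H (fun u => ?_) (fun u => ?_) (fun u => ?_) fun u => ?_).symm
  · exact (rho f (p u)).source.symm
  · change rhoMap f y u = rhoMap f (p 1) u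
    rw [p.target]
  · change rhoMap f x u = rhoMap f (p 0) u
    rw [p.source]
  · exact (rho f (p u)).target.symm

/-- A path through the core is replaced by a boundary path with the same `T²`-coordinate and an
arbitrary circle coordinate; contractibility of the disc makes the choice irrelevant. -/
theorem fromBase_inner {x y : Glue f} (p : Path x y) (hp : ∀ u, p u ∈ inner f) :
    FromBase (.mk p) := by
  let P : Path (core f x) (core f y) :=
    ⟨⟨fun u => core f (p u), continuous_core_comp f hp⟩, by simp, by simp⟩
  have hx : x ∈ inner f := by simpa using hp 0
  have hy : y ∈ inner f := by simpa using hp 1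
  let q : Path (toBdry (core f x)) (toBdry (core f y)) :=
    (P.map continuous_fst).prod (PathConnectedSpace.somePath _ _)
  have h : ((radial (core f x)).trans P).Homotopic ((q.map bdry.continuous).trans
      (radial (core f y))) := by
    refine Solid.path_homotopic ?_
    rw [Path.map_trans, Path.map_trans]
    exact Path.Homotopic.trans ⟨Path.Homotopy.reflTrans (P.map continuous_fst)⟩
      (Path.Homotopic.symm ⟨Path.Homotopy.transRefl (P.map continuous_fst)⟩)
  have h0 : inl f (ret f x) = inr f (bdry (toBdry (core f x))) := by rw [ret_eq f hx, inr_bdry]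
  have h1 : y = inr f (core f y) := (inr_core f hy).symm
  have h' := (h.map (inr f)).pathCast h0 h1
  refine ⟨.mk ((q.map f.continuous).cast (ret_eq f hx) (ret_eq f hy)), ?_⟩
  rw [← Path.Homotopic.Quotient.mk_map, ← Path.Homotopic.Quotient.mk_trans,
    ← Path.Homotopic.Quotient.mk_trans, Path.Homotopic.Quotient.eq]
  convert h' using 1
  · ext u
    simp only [Path.trans_apply, Path.cast_coe, Path.map_coe, Function.comp_apply]
    split_ifs
    · change rhoMap f x _ = _
      conv_lhs => rw [← inr_core f hx]
      rfl
    · exact (inr_core f (hp _)).symm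
  · ext u
    simp only [Path.trans_apply, Path.cast_coe, Path.map_coe, Function.comp_apply]
    split_ifs
    · exact (inr_bdry f _).symm
    · change rhoMap f y _ = _
      conv_lhs => rw [← inr_core f hy]
      rfl

theorem fromBase {x y : Glue f} (q : Path.Homotopic.Quotient x y) : FromBase q := by
  refine pathClass_induction_of_cover (isOpen_cover f) (exists_mem_cover f)
    (fun q => FromBase q) (fun p q => FromBase.trans) (fun b x y p hp => ?_) q
  cases b with
  | true => exact fromBase_outer p hp
  | false => exact fromBase_inner p hp

/-- Every class of paths between points of `Y` comes from `Y`. -/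
theorem exists_map_inl_eq {x y : Y} (q : Path.Homotopic.Quotient (inl f x) (inl f y)) :
    ∃ q' : Path.Homotopic.Quotient x y, q'.map (inl f) = q := by
  obtain ⟨q', h⟩ := fromBase q
  -- On points of `Y` the connecting paths `rho` are constant, so they drop out of the relation.
  have e1 : Path.Homotopic.Quotient.trans (.refl (inl f x)) q = q :=
    Path.Homotopic.Quotient.refl_trans q
  have e2 : Path.Homotopic.Quotient.trans (q'.map (inl f)) (.refl (inl f y)) = q'.map (inl f) :=
    Path.Homotopic.Quotient.trans_refl _
  exact ⟨q', e2.symm.trans (h.symm.trans e1)⟩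

instance [PathConnectedSpace Y] : PathConnectedSpace (Glue f) where
  nonempty := ⟨inr f (1, ⟨0, by simp⟩)⟩
  joined x y := by
    have h : ∀ z : Glue f, Joined (inl f (ret f z)) z := fun z => ⟨rho f z⟩
    have h' : Joined (inl f (ret f x)) (inl f (ret f y)) :=
      ⟨(PathConnectedSpace.somePath (ret f x) (ret f y)).map (inl f).continuous⟩
    exact (h x).symm.trans (h'.trans (h y))

end Glue

end Glue

/-! ### Maps from the 3-torus which are surjective on fundamental groups -/

theorem map_comp_class {X Y Z : Type*} [TopologicalSpace X] [TopologicalSpace Y]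
    [TopologicalSpace Z] (g : C(Y, Z)) (f : C(X, Y)) {x y : X} (q : Path.Homotopic.Quotient x y) :
    q.map (g.comp f) = (q.map f).map g := by
  induction q using Path.Homotopic.Quotient.ind with | mk q
  rfl

theorem map_symm_class {X Y : Type*} [TopologicalSpace X] [TopologicalSpace Y]
    (f : C(X, Y)) {x y : X} (q : Path.Homotopic.Quotient x y) :
    q.symm.map f = (q.map f).symm := by
  induction q using Path.Homotopic.Quotient.ind with | mk q
  rfl

/-- A conjugate of a loop class by a path in `T³`, with the same degrees. -/
theorem exists_conj_eq {x y : T3} (p : Path.Homotopic.Quotient x x)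
    (q : Path.Homotopic.Quotient y y) (h : degVec p = degVec q) :
    ∃ t : Path.Homotopic.Quotient x y, p = (t.trans q).trans t.symm :=
  ⟨.mk (PathConnectedSpace.somePath x y), degVec_injective (by rw [degVec_conj, h])⟩

theorem conj_refl {X : Type*} [TopologicalSpace X] {x y : X} (t : Path.Homotopic.Quotient x y) :
    (t.trans (.refl y)).trans t.symm = .refl x := by
  rw [Path.Homotopic.Quotient.trans_refl, Path.Homotopic.Quotient.trans_symm]

/-- `j` is surjective on fundamental groups, with kernel given by `K` in terms of degrees. -/
structure HasKer {X : Type*} [TopologicalSpace X] (j : C(T3, X)) (K : AddSubgroup (Fin 3 → ℤ)) :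
    Prop where
  surj : ∀ x (r : Path.Homotopic.Quotient (j x) (j x)),
    ∃ q : Path.Homotopic.Quotient x x, q.map j = r
  ker : ∀ x (q : Path.Homotopic.Quotient x x), q.map j = .refl (j x) ↔ degVec q ∈ K

theorem loopγ_map_bdry (x : T3) :
    (Path.Homotopic.Quotient.mk (loopγ x)).map bdry = .refl (bdry x) := by
  refine Path.Homotopic.Quotient.eq.2 (Solid.path_homotopic ?_)
  have : ((loopγ x).map bdry.continuous).map continuous_fst = Path.refl x.1 := by
    ext t <;> rfl
  rw [this]
  exact Path.Homotopic.refl _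

namespace HasKer

variable {Y : Type} [TopologicalSpace Y] {j : C(T3, Y)} {K : AddSubgroup (Fin 3 → ℤ)}

theorem mk_degVec_eq {X : Type*} [TopologicalSpace X] {j : C(T3, X)}
    (h : HasKer j K) {x : T3} {p q : Path.Homotopic.Quotient x x}
    (hpq : p.map j = q.map j) : (degVec p - degVec q) ∈ K := by
  rw [sub_eq_add_neg, ← degVec_symm, ← degVec_trans, ← h.ker, map_trans_class, hpq, map_symm_class,
    Path.Homotopic.Quotient.trans_symm]

/-- The degrees of a loop class, modulo a subgroup containing the kernel. -/
def quotDeg (h : HasKer j K) (L : AddSubgroup (Fin 3 → ℤ)) (x : T3)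
    (r : Path.Homotopic.Quotient (j x) (j x)) : (Fin 3 → ℤ) ⧸ L :=
  (degVec (h.surj x r).choose : (Fin 3 → ℤ) ⧸ L)

theorem quotDeg_map (h : HasKer j K) {L : AddSubgroup (Fin 3 → ℤ)} (hL : K ≤ L) {x : T3}
    (q : Path.Homotopic.Quotient x x) :
    h.quotDeg L x (q.map j) = (degVec q : (Fin 3 → ℤ) ⧸ L) := by
  rw [quotDeg, QuotientAddGroup.eq_iff_sub_mem]
  exact hL (h.mk_degVec_eq (h.surj x (q.map j)).choose_spec)

theorem quotDeg_trans (h : HasKer j K) {L : AddSubgroup (Fin 3 → ℤ)} (hL : K ≤ L) {x : T3}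
    (r r' : Path.Homotopic.Quotient (j x) (j x)) :
    h.quotDeg L x (r.trans r') = h.quotDeg L x r + h.quotDeg L x r' := by
  obtain ⟨q, rfl⟩ := h.surj x r
  obtain ⟨q', rfl⟩ := h.surj x r'
  rw [← map_trans_class, h.quotDeg_map hL, h.quotDeg_map hL, h.quotDeg_map hL, degVec_trans]
  rfl

/-- The degrees modulo `L` are additive with values in an abelian group, so conjugation cancels. -/
theorem quotDeg_conj (h : HasKer j K) {L : AddSubgroup (Fin 3 → ℤ)} (hL : K ≤ L) {x : T3}
    (t r : Path.Homotopic.Quotient (j x) (j x)) :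
    h.quotDeg L x ((t.trans r).trans t.symm) = h.quotDeg L x r := by
  have h1 : h.quotDeg L x (t.trans t.symm) = 0 := by
    have := h.quotDeg_trans hL (.refl (j x)) (.refl (j x))
    rw [Path.Homotopic.Quotient.trans_refl] at this
    rw [Path.Homotopic.Quotient.trans_symm]
    simpa using this
  rw [h.quotDeg_trans hL] at h1
  rw [h.quotDeg_trans hL, h.quotDeg_trans hL, add_right_comm, h1, zero_add]

/-- Fixed paths from the base point to all points of `Y` turn every path into a loop at the base
point, whose degrees modulo `L` are the value. For loops from `T³` at other base points, a
conjugating path inside `T³` preserves degrees. -/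
theorem exists_cocycle [PathConnectedSpace Y] (h : HasKer j K) {L : AddSubgroup (Fin 3 → ℤ)}
    (hL : K ≤ L) : ∃ c : PathCocycle Y ((Fin 3 → ℤ) ⧸ L),
      ∀ x (q : Path.Homotopic.Quotient x x), c.onQuot (q.map j) = (degVec q : (Fin 3 → ℤ) ⧸ L) := by
  let x₀ : T3 := 1
  let τ : ∀ y, Path.Homotopic.Quotient (j x₀) y :=
    fun y => .mk (PathConnectedSpace.somePath (j x₀) y)
  let c : PathCocycle Y ((Fin 3 → ℤ) ⧸ L) := PathCocycle.ofQuot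
    (fun {y z} p => h.quotDeg L x₀ (((τ y).trans p).trans (τ z).symm)) fun {x y z} p q => by
      rw [← h.quotDeg_trans hL]
      congr 1
      simp only [Path.Homotopic.Quotient.trans_assoc]
      rw [← Path.Homotopic.Quotient.trans_assoc (τ y).symm (τ y),
        Path.Homotopic.Quotient.symm_trans, Path.Homotopic.Quotient.refl_trans]
  refine ⟨c, fun x q => ?_⟩
  obtain ⟨t, ht⟩ := exists_conj_eq (classOf x₀ (degVec q)) q (degVec_classOf _ _)
  have e : c.onQuot (q.map j) = c.onQuot ((FundamentalGroup.toPath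
      (classOf x₀ (degVec q))).map j) := by
    rw [show FundamentalGroup.toPath (classOf x₀ (degVec q)) = _ from ht, map_trans_class,
      map_trans_class, map_symm_class]
    simp
  rw [e, PathCocycle.ofQuot_onQuot, h.quotDeg_conj hL, h.quotDeg_map hL, degVec_classOf]

/-- Meridian loops at different points are conjugate, so vanishing on one of them gives the
hypothesis of the extension theorem. -/
theorem onQuot_loopγ_eq {A : Type*} [AddCommGroup A] (d : PathCocycle T3 A) (x y : T3) :
    d (loopγ x : C(I, T3)) = d (loopγ y : C(I, T3)) := by
  obtain ⟨t, ht⟩ := exists_conj_eq (.mk (loopγ x)) (.mk (loopγ y))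
    ((degVec_basisClass x 2).trans (degVec_basisClass y 2).symm)
  have := congrArg d.onQuot ht
  simpa using this

/-- Gluing in `T² × D²` along `f` adds the class of the meridian to the kernel. -/
theorem glue [PathConnectedSpace Y] (h : HasKer j K) (f : C(T3, Y)) {x₀ x₁ : T3}
    (s : Path.Homotopic.Quotient (j x₀) (f x₁)) (q : Path.Homotopic.Quotient x₀ x₀)
    (hs : (q.map j).trans s = s.trans ((Path.Homotopic.Quotient.mk (loopγ x₁)).map f)) :
    HasKer ((Glue.inl f).comp j) (K ⊔ AddSubgroup.zmultiples (degVec q)) where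
  surj x r := by
    obtain ⟨r', hr'⟩ := Glue.exists_map_inl_eq (f := f) (x := j x) (y := j x) r
    obtain ⟨p, rfl⟩ := h.surj x r'
    exact ⟨p, (map_comp_class _ _ p).trans hr'⟩
  ker x p := by
    constructor
    · intro hp
      -- The degrees modulo `L` form a cocycle on `Y`. It vanishes on the attached meridian, which
      -- `s` conjugates to `q`, so it extends to the glued space; a loop which dies there must then
      -- have degrees in `L`.
      set L := K ⊔ AddSubgroup.zmultiples (degVec q)
      obtain ⟨c, hc⟩ := h.exists_cocycle (L := L) le_sup_left
      have hq : (degVec q : (Fin 3 → ℤ) ⧸ L) = 0 :=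
        (QuotientAddGroup.eq_zero_iff _).2
          ((le_sup_right : _ ≤ L) (AddSubgroup.mem_zmultiples (degVec q)))
      have h1 : c (f.comp (loopγ x₁ : C(I, T3))) = 0 := by
        have := congrArg c.onQuot hs
        rw [c.onQuot_trans, c.onQuot_trans, add_comm, hc, hq] at this
        exact (add_left_cancel this).symm
      obtain ⟨d, hd⟩ := Glue.exists_extension c fun y =>
        (onQuot_loopγ_eq (c.comap f) y x₁).trans h1
      have e : d.onQuot (p.map ((Glue.inl f).comp j)) = c.onQuot (p.map j) := by
        induction p using Path.Homotopic.Quotient.ind with | mk p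
        exact hd (j.comp p)
      rw [hp, d.onQuot_refl, hc] at e
      exact (QuotientAddGroup.eq_zero_iff _).1 e.symm
    · intro hp
      obtain ⟨k, hk, w, hw, hkw⟩ := AddSubgroup.mem_sup.1 hp
      obtain ⟨m, rfl⟩ := AddSubgroup.mem_zmultiples_iff.1 hw
      let θ := FundamentalGroup.map ((Glue.inl f).comp j) x
      have hθk : θ (classOf x k) = 1 := by
        have h1 := (h.ker x (classOf x k)).2 (by
          rw [show degVec (classOf x k) = k from degVec_classOf x k]; exact hk)
        exact (map_comp_class _ _ _).trans (congrArg (·.map (Glue.inl f)) h1)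
      have hq : q.map ((Glue.inl f).comp j) = .refl _ := by
        have h2 := congrArg (·.map (Glue.inl f)) hs
        simp only [map_trans_class] at h2
        -- In the glued space the attached meridian runs through `T² × D²`, where it bounds a disc.
        have h3 : ((Path.Homotopic.Quotient.mk (loopγ x₁)).map f).map (Glue.inl f) = .refl _ := by
          have h6 : ∀ g, g = (Glue.inr f).comp bdry →
              (Path.Homotopic.Quotient.mk (loopγ x₁)).map g = .refl (g x₁) := by
            rintro _ rfl
            rw [map_comp_class, loopγ_map_bdry]
            rfl
          exact (map_comp_class _ _ _).symm.trans (h6 _ (Glue.inr_comp_bdry f).symm)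
        rw [h3, Path.Homotopic.Quotient.trans_refl] at h2
        have h4 := congrArg (·.trans (s.map (Glue.inl f)).symm) h2
        simp only [Path.Homotopic.Quotient.trans_assoc, Path.Homotopic.Quotient.trans_symm,
          Path.Homotopic.Quotient.trans_refl] at h4
        exact (map_comp_class _ _ q).trans h4
      have hθq : θ (classOf x (degVec q)) = 1 := by
        obtain ⟨t, ht⟩ := exists_conj_eq (classOf x (degVec q)) q (degVec_classOf _ _)
        have h5 : θ (classOf x (degVec q)) =
            ((t.trans q).trans t.symm).map ((Glue.inl f).comp j) :=
          congrArg (·.map ((Glue.inl f).comp j)) ht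
        rw [h5, map_trans_class, map_trans_class, map_symm_class, hq, conj_refl]
        rfl
      have hpe : p = classOf x k * classOf x (degVec q) ^ m := by
        refine degHom_injective x (Eq.trans (?_ : degHom x p = .ofAdd (degVec p)) ?_)
        · rfl
        · rw [map_mul, map_zpow, degHom_classOf, degHom_classOf, ← hkw]
          rfl
      have : θ p = 1 := by rw [hpe, map_mul, map_zpow, hθk, hθq, one_zpow, mul_one]
      exact this

end HasKer

/-! ### The boundary torus in `T² × D²` -/

/-- The subgroup generated by the meridian. -/
def meridian : AddSubgroup (Fin 3 → ℤ) := AddSubgroup.zmultiples (Pi.single 2 1)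

/-- Since the disc is contractible, classes in `T² × D²` are those of the `T²`-coordinate. The first
two degrees survive and the third is lost. -/
theorem hasKer_bdry : HasKer bdry meridian where
  surj x r := by
    induction r using Path.Homotopic.Quotient.ind with | mk r
    refine ⟨.mk ((r.map continuous_fst).prod (Path.refl x.2)), ?_⟩
    exact Path.Homotopic.Quotient.eq.2 (Solid.path_homotopic (.refl _))
  ker x q := by
    constructor
    · intro h
      let P : Fin 2 → C(Solid, Circle) :=
        ![⟨fun s => s.1.1, by fun_prop⟩, ⟨fun s => s.1.2, by fun_prop⟩]
      have h0 := congrArg (deg.comap (P 0)).onQuot h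
      have h1 := congrArg (deg.comap (P 1)).onQuot h
      rw [PathCocycle.onQuot_refl, ← PathCocycle.comap_onQuot] at h0 h1
      have z0 : degVec q 0 = 0 := by
        rw [← Int.cast_inj (α := ℝ), degVec_cast, Int.cast_zero]
        exact h0
      have z1 : degVec q 1 = 0 := by
        rw [← Int.cast_inj (α := ℝ), degVec_cast, Int.cast_zero]
        exact h1
      refine AddSubgroup.mem_zmultiples_iff.2 ⟨degVec q 2, ?_⟩
      ext i
      fin_cases i <;> simp [z0, z1]
    · intro h
      obtain ⟨m, hm⟩ := AddSubgroup.mem_zmultiples_iff.1 h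
      have : q = basisClass x 2 ^ m := degHom_injective x (by
        rw [map_zpow, degHom_basisClass, ← ofAdd_zsmul, hm]
        rfl)
      have h2 : FundamentalGroup.map bdry x (basisClass x 2) = 1 := loopγ_map_bdry x
      have h3 : FundamentalGroup.map bdry x q = 1 := by rw [this, map_zpow, h2, one_zpow]
      exact h3

theorem hasKer_XGlue {φ : T3 ≃ₜ T3} {A : Matrix (Fin 3) (Fin 3) ℤ}
    (h : IsMatrixOf (φ : C(T3, T3)) A) :
    HasKer (XGlue.torus φ) (meridian ⊔ AddSubgroup.zmultiples (A.col 2)) := by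
  let x : T3 := 1
  have := hasKer_bdry.glue (bdry.comp (φ : C(T3, T3))) (x₀ := φ x) (x₁ := x) (.refl _)
    ((Path.Homotopic.Quotient.mk (loopγ x)).map (φ : C(T3, T3))) (by
      rw [Path.Homotopic.Quotient.trans_refl]
      exact (Path.Homotopic.Quotient.refl_trans _).symm)
  rw [degVec_map h, show degVec (Path.Homotopic.Quotient.mk (loopγ x)) = Pi.single 2 1 from
    degVec_basisClass x 2, Matrix.mulVec_single_one] at this
  exact this

/-! ### The exterior of the two fibres -/

/-- If one coordinate vanished, the inequalities of the exterior would force the other to vanish,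
against the sphere equation. -/
theorem HopfExterior.pos (x : HopfExterior) : 0 < ‖x.1.2.1.1‖ ∧ 0 < ‖x.1.2.1.2‖ := by
  obtain ⟨⟨u, ⟨⟨z, w⟩, h⟩⟩, h1, h2⟩ := x
  simp only at h h1 h2 ⊢
  constructor
  · by_contra h0
    have : ‖z‖ = 0 := le_antisymm (not_lt.1 h0) (norm_nonneg z)
    nlinarith [norm_nonneg w]
  · by_contra h0
    have : ‖w‖ = 0 := le_antisymm (not_lt.1 h0) (norm_nonneg w)
    nlinarith [norm_nonneg z]

theorem continuous_nrm_comp {X : Type*} [TopologicalSpace X] {g : X → ℂ} (hg : Continuous g)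
    (h : ∀ x, 0 < ‖g x‖) : Continuous fun x => nrm (g x) :=
  continuousOn_nrm.comp_continuous hg fun x => norm_pos_iff.1 (h x)

theorem HopfExterior.continuous_nrm_fst : Continuous fun x : HopfExterior => nrm x.1.2.1.1 :=
  continuous_nrm_comp (by fun_prop) fun x => x.pos.1

theorem HopfExterior.continuous_nrm_snd : Continuous fun x : HopfExterior => nrm x.1.2.1.2 :=
  continuous_nrm_comp (by fun_prop) fun x => x.pos.2

/-- The retraction of the exterior to its boundary torus around `F₋`. -/
def extRet : C(HopfExterior, T3) where
  toFun x := ((nrm x.1.2.1.2, x.1.1), nrm x.1.2.1.1 * (nrm x.1.2.1.2)⁻¹)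
  continuous_toFun := by
    have := HopfExterior.continuous_nrm_fst
    have := HopfExterior.continuous_nrm_snd
    fun_prop

theorem rad_pos : 0 < rad := Real.sqrt_pos.2 (by norm_num)

theorem nrm_big (v : Circle) : nrm ((rad : ℂ) * (v : ℂ)) = v := by
  rw [nrm_ofReal_mul rad_pos, nrm_coe]

theorem nrm_small (v ξ : Circle) : nrm ((ξ : ℂ) / 2 * ((rad : ℂ) * (v : ℂ))) = ξ * v := by
  have : (ξ : ℂ) / 2 * ((rad : ℂ) * (v : ℂ)) = ((rad / 2 : ℝ) : ℂ) * ((ξ * v : Circle) : ℂ) := by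
    push_cast
    ring
  rw [this, nrm_ofReal_mul (half_pos rad_pos), nrm_coe]

theorem extRet_jMinus (x : T3) : extRet (jMinus x) = x := by
  simp [extRet, jMinus, nrm_big, nrm_small]

/-- Near `F₊` the direction of `z` is `v` and that of `w` is `ξv`, so `z / w` has direction `ξ⁻¹`.
Hence `γ` around `F₊` becomes `αγ⁻¹` in the coordinates of `F₋`. -/
theorem extRet_jPlus (x : T3) : extRet (jPlus x) = ((x.2 * x.1.1, x.1.2), x.2⁻¹) := by
  simp [extRet, jPlus, nrm_big, nrm_small]

/-- The interpolated radius. -/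
def radLine (t : I) (a b : ℝ) : ℝ := Real.sqrt ((1 - (t : ℝ)) * a ^ 2 + (t : ℝ) * b ^ 2)

theorem radLine_sq (t : I) (a b : ℝ) :
    radLine t a b ^ 2 = (1 - (t : ℝ)) * a ^ 2 + (t : ℝ) * b ^ 2 :=
  Real.sq_sqrt (add_nonneg (mul_nonneg (by linarith [t.2.2]) (sq_nonneg a))
    (mul_nonneg t.2.1 (sq_nonneg b)))

theorem radLine_nonneg (t : I) (a b : ℝ) : 0 ≤ radLine t a b := Real.sqrt_nonneg _

theorem radLine_le (t : I) {a b a' b' : ℝ} (ha : 0 ≤ a) (hb : 0 ≤ b) (ha' : a ≤ 2 * a')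
    (hb' : b ≤ 2 * b') : radLine t a b ≤ 2 * radLine t a' b' := by
  refine abs_le_of_sq_le_sq' ?_ (by linarith [radLine_nonneg t a' b']) |>.2
  rw [mul_pow, radLine_sq, radLine_sq]
  have h1 : a ^ 2 ≤ 4 * a' ^ 2 := by nlinarith
  have h2 : b ^ 2 ≤ 4 * b' ^ 2 := by nlinarith
  nlinarith [mul_le_mul_of_nonneg_left h1 (by linarith [t.2.2] : (0:ℝ) ≤ 1 - t),
    mul_le_mul_of_nonneg_left h2 t.2.1]

theorem radLine_zero {a : ℝ} (ha : 0 ≤ a) (b : ℝ) : radLine 0 a b = a := by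
  simp [radLine, Real.sqrt_sq ha]

theorem radLine_one (a : ℝ) {b : ℝ} (hb : 0 ≤ b) : radLine 1 a b = b := by
  simp [radLine, Real.sqrt_sq hb]

theorem radLine_self (t : I) {a : ℝ} (ha : 0 ≤ a) : radLine t a a = a := by
  have : (1 - (t : ℝ)) * a ^ 2 + (t : ℝ) * a ^ 2 = a ^ 2 := by ring
  rw [radLine, this, Real.sqrt_sq ha]

theorem norm_ofReal_mul_circle {r : ℝ} (hr : 0 ≤ r) (v : Circle) : ‖(r : ℂ) * (v : ℂ)‖ = r := by
  rw [norm_mul, Circle.norm_coe, mul_one, Complex.norm_real, Real.norm_of_nonneg hr]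

/-- The deformation of the exterior to its boundary torus around `F₋`. -/
def extHomotopy : (jMinus.comp extRet).Homotopy (.id HopfExterior) where
  toFun x := ⟨(x.2.1.1, ⟨((radLine x.1 (rad / 2) ‖x.2.1.2.1.1‖ : ℝ) * (nrm x.2.1.2.1.1 : ℂ),
      (radLine x.1 rad ‖x.2.1.2.1.2‖ : ℝ) * (nrm x.2.1.2.1.2 : ℂ)), by
        simp only [norm_ofReal_mul_circle (radLine_nonneg _ _ _), radLine_sq]
        have h := x.2.1.2.2
        -- Squares of radii are interpolated linearly, so the sphere equation is a convex
        -- combination of its instances at the two ends.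
        have : (rad / 2) ^ 2 + rad ^ 2 = 2 := by nlinarith [rad_sq]
        linear_combination (1 - (x.1 : ℝ)) * this + (x.1 : ℝ) * h⟩), by
        simp only [norm_ofReal_mul_circle (radLine_nonneg _ _ _)]
        have := rad_pos
        exact ⟨radLine_le _ (by linarith) (norm_nonneg _) (by linarith) x.2.2.1,
          radLine_le _ (by linarith) (norm_nonneg _) (by linarith) x.2.2.2⟩⟩
  continuous_toFun := by
    have h1 : Continuous fun x : I × HopfExterior => nrm x.2.1.2.1.1 :=
      HopfExterior.continuous_nrm_fst.comp continuous_snd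
    have h2 : Continuous fun x : I × HopfExterior => nrm x.2.1.2.1.2 :=
      HopfExterior.continuous_nrm_snd.comp continuous_snd
    have c1 := (by fun_prop : Continuous ((↑) : Circle → ℂ)).comp h1
    have c2 := (by fun_prop : Continuous ((↑) : Circle → ℂ)).comp h2
    have r1 : Continuous fun x : I × HopfExterior =>
        ((radLine x.1 (rad / 2) ‖x.2.1.2.1.1‖ : ℝ) : ℂ) := by unfold radLine; fun_prop
    have r2 : Continuous fun x : I × HopfExterior =>
        ((radLine x.1 rad ‖x.2.1.2.1.2‖ : ℝ) : ℂ) := by unfold radLine; fun_prop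
    exact .subtype_mk (.prodMk (by fun_prop) (.subtype_mk (.prodMk (r1.mul c1) (r2.mul c2)) _)) _
  map_zero_left x := by
    refine Subtype.ext (Prod.ext rfl (Subtype.ext (Prod.ext ?_ ?_)))
    · simp only [radLine_zero (half_pos rad_pos).le]
      have := (nrm x.1.2.1.2).coe_ne_zero
      simp only [jMinus, extRet, ContinuousMap.comp_apply, ContinuousMap.coe_mk, Circle.coe_mul,
        Circle.coe_inv]
      push_cast
      field_simp
    · simp only [radLine_zero rad_pos.le]
      simp [jMinus, extRet]
  map_one_left x := by
    refine Subtype.ext (Prod.ext rfl (Subtype.ext (Prod.ext ?_ ?_)))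
    · simp only [radLine_one _ (norm_nonneg _)]
      exact norm_mul_nrm _
    · simp only [radLine_one _ (norm_nonneg _)]
      exact norm_mul_nrm _

theorem extHomotopy_jMinus (t : I) (x : T3) : extHomotopy (t, jMinus x) = jMinus x := by
  have hb : ‖(jMinus x).1.2.1.2‖ = rad := norm_big _
  have hs : ‖(jMinus x).1.2.1.1‖ = rad / 2 := norm_small _ _
  refine Subtype.ext (Prod.ext rfl (Subtype.ext (Prod.ext ?_ ?_)))
  · change ((radLine t (rad / 2) ‖(jMinus x).1.2.1.1‖ : ℝ) : ℂ) * _ = _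
    rw [hs, radLine_self t (half_pos rad_pos).le, ← hs]
    exact norm_mul_nrm _
  · change ((radLine t rad ‖(jMinus x).1.2.1.2‖ : ℝ) : ℂ) * _ = _
    rw [hb, radLine_self t rad_pos.le, ← hb]
    exact norm_mul_nrm _

instance : PathConnectedSpace HopfExterior where
  nonempty := ⟨jMinus 1⟩
  joined x y := by
    have h : ∀ z, Joined (jMinus (extRet z)) z := fun z => ⟨extHomotopy.evalAt z⟩
    have h' : Joined (jMinus (extRet x)) (jMinus (extRet y)) :=
      ⟨(PathConnectedSpace.somePath (extRet x) (extRet y)).map jMinus.continuous⟩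
    exact (h x).symm.trans (h'.trans (h y))

/-- The deformation keeps the boundary torus fixed, which yields surjectivity without moving the
base point. Injectivity holds because `extRet` is a left inverse. -/
theorem hasKer_jMinus : HasKer jMinus ⊥ where
  surj x r := by
    induction r using Path.Homotopic.Quotient.ind with | mk r
    let q : Path x x := (r.map extRet.continuous).cast (extRet_jMinus x).symm (extRet_jMinus x).symm
    refine ⟨.mk q, ?_⟩
    have := square_class (extHomotopy.toContinuousMap.comp (.prodMap (.id _) r))
      (p := q.map jMinus.continuous) (q := Path.refl _) (p' := Path.refl _) (q' := r)
      (fun u => (extHomotopy.apply_zero _).symm)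
      (fun u => by
        refine Eq.symm ((congrArg (fun y => extHomotopy (u, y)) r.target).trans ?_)
        exact extHomotopy_jMinus u x)
      (fun u => by
        refine Eq.symm ((congrArg (fun y => extHomotopy (u, y)) r.source).trans ?_)
        exact extHomotopy_jMinus u x)
      (fun u => (extHomotopy.apply_one _).symm)
    rw [Path.Homotopic.Quotient.mk_refl, Path.Homotopic.Quotient.trans_refl,
      Path.Homotopic.Quotient.refl_trans] at this
    exact this
  ker x q := by
    rw [AddSubgroup.mem_bot]
    constructor
    · intro h
      ext i
      rw [← Int.cast_inj (α := ℝ), degVec_cast]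
      have h1 := congrArg ((degT i).comap extRet).onQuot h
      rw [PathCocycle.onQuot_refl, ← PathCocycle.comap_onQuot] at h1
      have e : ((degT i).comap extRet).comap jMinus = degT i := by
        simp only [PathCocycle.comap, degT]
        congr 1
        ext p
        congr 1
        ext u
        simp [extRet_jMinus]
      rw [e] at h1
      simpa using h1
    · intro h
      rw [degVec_injective (h.trans (degVec_refl x).symm)]
      rfl

theorem degVec_extRet_jPlus {x : T3} (q : Path.Homotopic.Quotient x x) :
    degVec (q.map (extRet.comp jPlus)) =
      ![degVec q 0 + degVec q 2, degVec q 1, - degVec q 2] := by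
  ext i
  rw [← Int.cast_inj (α := ℝ), degVec_cast]
  induction q using Path.Homotopic.Quotient.ind with | mk q
  have hq : ∀ k, (degVec (.mk q) k : ℝ) = deg ((proj k).comp (q : C(I, T3))) :=
    fun k => degVec_cast _ _
  have hm : (degT i).onQuot ((Path.Homotopic.Quotient.mk q).map (extRet.comp jPlus)) =
    deg ((proj i).comp ((extRet.comp jPlus).comp (q : C(I, T3)))) := rfl
  rw [hm]
  fin_cases i
  · have : (proj 0).comp ((extRet.comp jPlus).comp (q : C(I, T3))) =
        (proj 2).comp (q : C(I, T3)) * (proj 0).comp (q : C(I, T3)) := by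
      ext1 u
      simp [extRet_jPlus, proj]
    simp only [Fin.zero_eta, this, deg_mul]
    simp [hq, add_comm]
  · have : (proj 1).comp ((extRet.comp jPlus).comp (q : C(I, T3))) =
        (proj 1).comp (q : C(I, T3)) := by
      ext1 u
      simp [extRet_jPlus, proj]
    simp only [Fin.mk_one, this]
    simp [hq]
  · have : (proj 2).comp ((extRet.comp jPlus).comp (q : C(I, T3))) =
        ((proj 2).comp (q : C(I, T3))) ^ (-1 : ℤ) := by
      ext1 u
      simp [extRet_jPlus, proj]
    simp only [Fin.reduceFinMk, this, deg_zpow]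
    simp [hq]

theorem hasKer_XLog {φp φm : T3 ≃ₜ T3} {Ap Am : Matrix (Fin 3) (Fin 3) ℤ}
    (hp : IsMatrixOf (φp : C(T3, T3)) Ap) (hm : IsMatrixOf (φm : C(T3, T3)) Am) :
    HasKer (XLog.torus φp φm)
      (AddSubgroup.zmultiples ![Ap 0 2 + Ap 2 2, Ap 1 2, - Ap 2 2] ⊔
        AddSubgroup.zmultiples (Am.col 2)) := by
  let x : T3 := 1
  have hγ : degVec (Path.Homotopic.Quotient.mk (loopγ x)) = Pi.single 2 1 := degVec_basisClass x 2
  let qp := (Path.Homotopic.Quotient.mk (loopγ x)).map (φp : C(T3, T3))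
  let K : (jMinus.comp (extRet.comp jPlus)).Homotopy jPlus :=
    extHomotopy.comp (.refl jPlus)
  -- The track of the base point under the deformation conjugates the meridian near `F₊` to its
  -- retraction in the torus around `F₋`.
  have h1 := hasKer_jMinus.glue (jPlus.comp (φp : C(T3, T3))) (x₀ := extRet (jPlus (φp x)))
    (x₁ := x) (.mk (K.evalAt (φp x))) (qp.map (extRet.comp jPlus)) (by
      have := Path.Homotopic.map_trans_evalAt K ((loopγ x).map φp.continuous)
      exact Path.Homotopic.Quotient.eq.2 this)
  rw [degVec_extRet_jPlus, degVec_map hp, hγ, Matrix.mulVec_single_one, bot_sup_eq] at h1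
  have h2 := h1.glue (attachMinus φp φm) (x₀ := φm x) (x₁ := x) (.refl _)
    ((Path.Homotopic.Quotient.mk (loopγ x)).map (φm : C(T3, T3))) (by
      exact (Path.Homotopic.Quotient.trans_refl _).trans
        (Path.Homotopic.Quotient.refl_trans _).symm)
  rw [degVec_map hm, hγ, Matrix.mulVec_single_one] at h2
  exact h2

/-! ### Quotients of `ℤ³` by two vectors -/

theorem mem_meridian_sup {w n : Fin 3 → ℤ} :
    n ∈ meridian ⊔ AddSubgroup.zmultiples w ↔ ∃ t : ℤ, n 0 = t * w 0 ∧ n 1 = t * w 1 := by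
  rw [meridian, AddSubgroup.mem_sup]
  constructor
  · rintro ⟨_, ⟨s, rfl⟩, _, ⟨t, rfl⟩, rfl⟩
    exact ⟨t, by simp, by simp⟩
  · rintro ⟨t, h0, h1⟩
    refine ⟨_, ⟨n 2 - t * w 2, rfl⟩, _, ⟨t, rfl⟩, ?_⟩
    ext i
    fin_cases i <;> simp [h0, h1]

theorem exists_bezout (g h : ℤ) : ∃ g' h' u v : ℤ, g = Int.gcd g h * g' ∧ h = Int.gcd g h * h' ∧
    u * g' + v * h' = 1 := by
  by_cases hm : Int.gcd g h = 0
  · obtain ⟨rfl, rfl⟩ := Int.gcd_eq_zero_iff.1 hm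
    -- For gcd zero any primitive vector will do, since it is multiplied by `0`.
    exact ⟨1, 0, 1, 0, by simp⟩
  · obtain ⟨g', hg⟩ := Int.gcd_dvd_left g h
    obtain ⟨h', hh⟩ := Int.gcd_dvd_right g h
    refine ⟨g', h', Int.gcdA g h, Int.gcdB g h, hg, hh, ?_⟩
    have hm' : (Int.gcd g h : ℤ) ≠ 0 := by exact_mod_cast hm
    apply mul_left_cancel₀ hm'
    have := Int.gcd_eq_gcd_ab g h
    linear_combination -this - Int.gcdA g h * hg - Int.gcdB g h * hh

/-- Write the first two entries of `w` as `m (g', h')` with `u g' + v h' = 1`. The determinant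
against `(g', h')` and the Bézout functional `u n₀ + v n₁` are unimodular coordinates on `ℤ²`, in
which `w` becomes `(0, m)`. -/
theorem exists_hom_meridian (w : Fin 3 → ℤ) :
    ∃ θ : (Fin 3 → ℤ) →+ ℤ × ZMod (Int.gcd (w 0) (w 1)), Function.Surjective θ ∧
      ∀ n, θ n = 0 ↔ n ∈ meridian ⊔ AddSubgroup.zmultiples w := by
  obtain ⟨g', h', u, v, hg, hh, huv⟩ := exists_bezout (w 0) (w 1)
  refine ⟨⟨⟨fun n => (h' * n 0 - g' * n 1, ((u * n 0 + v * n 1 : ℤ) : ZMod _)), ?_⟩, ?_⟩, ?_, ?_⟩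
  · simp
  · intro n n'
    ext
    · simp; ring
    · simp; ring
  · rintro ⟨x, y⟩
    obtain ⟨y, rfl⟩ := ZMod.intCast_surjective y
    refine ⟨![g' * y + v * x, h' * y - u * x, 0], Prod.ext ?_ ?_⟩
    · simp only [AddMonoidHom.coe_mk, ZeroHom.coe_mk, Matrix.cons_val_zero, Matrix.cons_val_one]
      linear_combination x * huv
    · simp only [AddMonoidHom.coe_mk, ZeroHom.coe_mk, Matrix.cons_val_zero, Matrix.cons_val_one]
      congr 1
      linear_combination y * huv
  · intro n
    rw [mem_meridian_sup]
    simp only [AddMonoidHom.coe_mk, ZeroHom.coe_mk, Prod.mk_eq_zero,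
      ZMod.intCast_zmod_eq_zero_iff_dvd]
    constructor
    · rintro ⟨h1, t, ht⟩
      refine ⟨t, ?_, ?_⟩
      · linear_combination v * h1 + g' * ht - n 0 * huv - t * hg
      · linear_combination -u * h1 + h' * ht - n 1 * huv - t * hh
    · rintro ⟨t, h0, h1⟩
      refine ⟨?_, t, ?_⟩
      · linear_combination h' * h0 - g' * h1 + t * h' * hg - t * g' * hh
      · linear_combination u * h0 + v * h1 + t * u * hg + t * v * hh +
          t * (Int.gcd (w 0) (w 1)) * huv

/-- The `2 × 2` minor with columns `i`, `j` of the matrix with rows `r`, `s`. -/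
def minor (r s : Fin 3 → ℤ) (i j : Fin 3) : ℤ := r i * s j - r j * s i

/-- Minors are bilinear in the two vectors, so the new ones are integral combinations of the old
ones. -/
theorem dvd_minor_mulVec {r s : Fin 3 → ℤ} {d : ℤ} (h : ∀ i j, d ∣ minor r s i j)
    (U : Matrix (Fin 3) (Fin 3) ℤ) (k l : Fin 3) : d ∣ minor (U.mulVec r) (U.mulVec s) k l := by
  have : minor (U.mulVec r) (U.mulVec s) k l =
      ∑ i, ∑ j, U k i * U l j * minor r s i j := by
    simp only [minor, Matrix.mulVec, dotProduct, Fin.sum_univ_three]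
    ring
  rw [this]
  exact Finset.dvd_sum fun i _ => Finset.dvd_sum fun j _ => (h i j).mul_left _

theorem dvd_minorsGcd_iff (r s : Fin 3 → ℤ) (d : ℕ) :
    d ∣ minorsGcd (Matrix.of ![r, s]) ↔ ∀ i j, (d : ℤ) ∣ minor r s i j := by
  rw [minorsGcd, Finset.dvd_gcd_iff]
  simp only [Finset.mem_univ, forall_const, Prod.forall]
  refine forall_congr' fun i => forall_congr' fun j => ?_
  rw [Int.natCast_dvd, Matrix.det_fin_two]
  simp [minor]

/-- The gcd of the minors is invariant under unimodular changes of basis. Once `r` is the third unit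
vector, the nonzero minors are, up to sign, among the first two entries of the other vector. -/
theorem minorsGcd_eq {r s : Fin 3 → ℤ} {U V : Matrix (Fin 3) (Fin 3) ℤ} (hVU : V * U = 1)
    (hr : U.mulVec r = Pi.single 2 1) :
    minorsGcd (Matrix.of ![r, s]) = Int.gcd (U.mulVec s 0) (U.mulVec s 1) := by
  refine Nat.dvd_antisymm ?_ ?_
  · have h := (dvd_minorsGcd_iff r s _).1 dvd_rfl
    have h' := dvd_minor_mulVec h U
    rw [hr] at h'
    refine Int.dvd_gcd ?_ ?_
    · simpa [minor] using h' 2 0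
    · simpa [minor] using h' 2 1
  · rw [dvd_minorsGcd_iff]
    have e : ∀ x : Fin 3 → ℤ, V.mulVec (U.mulVec x) = x := fun x => by
      rw [Matrix.mulVec_mulVec, hVU, Matrix.one_mulVec]
    rw [← e r, ← e s]
    refine dvd_minor_mulVec ?_ V
    rw [hr, e]
    have h0 := Int.gcd_dvd_left (U.mulVec s 0) (U.mulVec s 1)
    have h1 := Int.gcd_dvd_right (U.mulVec s 0) (U.mulVec s 1)
    intro i j
    fin_cases i <;> fin_cases j <;> simp [minor, h0, h1]

theorem exists_hom_pair {r s : Fin 3 → ℤ} {U V : Matrix (Fin 3) (Fin 3) ℤ} (hVU : V * U = 1)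
    (hUV : U * V = 1) (hr : U.mulVec r = Pi.single 2 1) :
    ∃ θ : (Fin 3 → ℤ) →+ ℤ × ZMod (minorsGcd (Matrix.of ![r, s])), Function.Surjective θ ∧
      ∀ n, θ n = 0 ↔ n ∈ AddSubgroup.zmultiples r ⊔ AddSubgroup.zmultiples s := by
  rw [minorsGcd_eq hVU hr]
  obtain ⟨θ, hs, hk⟩ := exists_hom_meridian (U.mulVec s)
  have eV : ∀ x : Fin 3 → ℤ, V.mulVec (U.mulVec x) = x := fun x => by
    rw [Matrix.mulVec_mulVec, hVU, Matrix.one_mulVec]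
  have eU : ∀ x : Fin 3 → ℤ, U.mulVec (V.mulVec x) = x := fun x => by
    rw [Matrix.mulVec_mulVec, hUV, Matrix.one_mulVec]
  refine ⟨θ.comp U.mulVecLin.toAddMonoidHom, fun y => ?_, fun n => ?_⟩
  · obtain ⟨n, rfl⟩ := hs y
    exact ⟨V.mulVec n, congrArg θ (eU n)⟩
  · refine (hk _).trans ?_
    rw [meridian, ← hr, AddSubgroup.mem_sup, AddSubgroup.mem_sup]
    constructor
    · rintro ⟨_, ⟨a, rfl⟩, _, ⟨b, rfl⟩, h⟩
      refine ⟨_, ⟨a, rfl⟩, _, ⟨b, rfl⟩, ?_⟩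
      have h' : a • U.mulVec r + b • U.mulVec s = U.mulVec n := h
      rw [← eV n, ← h']
      change _ = V.mulVecLin (a • U.mulVec r + b • U.mulVec s)
      rw [map_add, map_zsmul, map_zsmul]
      simp only [Matrix.mulVecLin_apply, eV]
    · rintro ⟨_, ⟨a, rfl⟩, _, ⟨b, rfl⟩, rfl⟩
      refine ⟨_, ⟨a, rfl⟩, _, ⟨b, rfl⟩, ?_⟩
      change _ = U.mulVecLin (a • r + b • s)
      rw [map_add, map_zsmul, map_zsmul]
      rfl

/-! ### Fundamental groups from kernels -/

theorem nonempty_mulEquiv_of_ker {G H H' : Type*} [Group G] [Group H] [Group H'] (f : G →* H)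
    (f' : G →* H') (hf : Function.Surjective f) (hf' : Function.Surjective f')
    (h : ∀ x, f x = 1 ↔ f' x = 1) : Nonempty (H ≃* H') := by
  have : f.ker = f'.ker := by ext x; exact h x
  exact ⟨(QuotientGroup.quotientKerEquivOfSurjective f hf).symm.trans
    ((QuotientGroup.quotientMulEquivOfEq this).trans
      (QuotientGroup.quotientKerEquivOfSurjective f' hf'))⟩

section

variable {X : Type} [TopologicalSpace X] {j : C(T3, X)} {K : AddSubgroup (Fin 3 → ℤ)}

/-- The homomorphism from `ℤ³` to the fundamental group of `X` induced by `j`. -/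
def latticeHom (j : C(T3, X)) (x : T3) :
    Multiplicative (Fin 3 → ℤ) →* FundamentalGroup X (j x) :=
  (FundamentalGroup.map j x).comp (degEquiv x).symm.toMonoidHom

theorem latticeHom_single (j : C(T3, X)) (x : T3) (i : Fin 3) :
    latticeHom j x (.ofAdd (Pi.single i 1)) = FundamentalGroup.map j x (basisClass x i) := by
  rw [← degHom_basisClass x i]
  exact congrArg (FundamentalGroup.map j x) ((degEquiv x).symm_apply_apply _)

theorem HasKer.latticeHom_surjective (h : HasKer j K) (x : T3) :
    Function.Surjective (latticeHom j x) := fun r => by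
  obtain ⟨q, hq⟩ := h.surj x r
  refine ⟨degEquiv x q, ?_⟩
  rw [← hq]
  exact congrArg (FundamentalGroup.map j x) ((degEquiv x).symm_apply_apply q)

theorem HasKer.latticeHom_eq_one (h : HasKer j K) (x : T3) (n : Fin 3 → ℤ) :
    latticeHom j x (.ofAdd n) = 1 ↔ n ∈ K := by
  obtain ⟨q, hq⟩ := (degEquiv x).surjective (.ofAdd n)
  have hn : n = degVec q := (congrArg Multiplicative.toAdd hq).symm
  rw [← hq, hn, ← h.ker]
  have : latticeHom j x (degEquiv x q) = FundamentalGroup.map j x q :=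
    congrArg (FundamentalGroup.map j x) ((degEquiv x).symm_apply_apply q)
  rw [this]
  rfl

theorem HasKer.nonempty_mulEquiv [PathConnectedSpace X] (h : HasKer j K) {B : Type*} [AddGroup B]
    (θ : (Fin 3 → ℤ) →+ B) (hθ : Function.Surjective θ) (hk : ∀ n, θ n = 0 ↔ n ∈ K) (x : X) :
    Nonempty (FundamentalGroup X x ≃* Multiplicative B) := by
  obtain ⟨e⟩ := nonempty_mulEquiv_of_ker (latticeHom j 1) θ.toMultiplicative
    (h.latticeHom_surjective 1) (fun y => by
      obtain ⟨n, hn⟩ := hθ y.toAdd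
      exact ⟨.ofAdd n, congrArg Multiplicative.ofAdd hn⟩)
    (fun n => (h.latticeHom_eq_one 1 n.toAdd).trans (hk n.toAdd).symm)
  exact ⟨(FundamentalGroup.fundamentalGroupMulEquivOfPathConnected x (j 1)).trans e⟩

/-- The homomorphism from `ℤ³` given by three commuting elements. -/
def tripleHom {G : Type*} [Group G] {a b c : G} (hab : Commute a b) (hac : Commute a c)
    (hbc : Commute b c) : Multiplicative (Fin 3 → ℤ) →* G where
  toFun n := a ^ n.toAdd 0 * b ^ n.toAdd 1 * c ^ n.toAdd 2
  map_one' := by simp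
  map_mul' m n := by
    simp only [toAdd_mul, Pi.add_apply, zpow_add]
    have h1 := (hab.zpow_zpow (n.toAdd 0) (m.toAdd 1)).eq
    have h2 := (hac.zpow_zpow (n.toAdd 0) (m.toAdd 2)).eq
    have h3 := (hbc.zpow_zpow (n.toAdd 1) (m.toAdd 2)).eq
    simp only [mul_assoc]
    congr 1
    rw [← mul_assoc (c ^ m.toAdd 2) (a ^ n.toAdd 0), ← h2, mul_assoc,
      ← mul_assoc (c ^ m.toAdd 2) (b ^ n.toAdd 1), ← h3, mul_assoc,
      ← mul_assoc (b ^ m.toAdd 1) (a ^ n.toAdd 0), ← h1, mul_assoc]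

theorem lattice_hom_ext {G : Type*} [Group G] {f f' : Multiplicative (Fin 3 → ℤ) →* G}
    (h : ∀ i, f (.ofAdd (Pi.single i 1)) = f' (.ofAdd (Pi.single i 1))) : f = f' := by
  refine MonoidHom.ext fun n => ?_
  rw [← ofAdd_toAdd n, ← degHom_classOf 1]
  simp only [classOf, map_mul, map_zpow, degHom_basisClass, h]

/-- The map `E` from the presented group to the fundamental group satisfies `E ∘ π = latticeHom j
x`. As `π` is onto and kills `K`, the kernel of `E` is trivial. The alternative in `hv` allows a
basis vector lying in `K` to be omitted from the generators, as happens to `γ` in `X_φ`. -/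
theorem HasKer.exists_presentation (h : HasKer j K) {k : ℕ} {rels : Set (FreeGroup (Fin k))}
    (π : Multiplicative (Fin 3 → ℤ) →* PresentedGroup rels) (v : Fin k → Fin 3 → ℤ)
    (hv : ∀ i : Fin 3, Pi.single i 1 ∈ K ∨ ∃ l, v l = Pi.single i 1)
    (hπ : ∀ i, π (.ofAdd (v i)) = PresentedGroup.of i) (hK : ∀ n ∈ K, π (.ofAdd n) = 1)
    (hrels : ∀ r ∈ rels, (FreeGroup.lift (fun i => Multiplicative.ofAdd (v i)) r).toAdd ∈ K)
    (x : T3) : ∃ e : PresentedGroup rels ≃* FundamentalGroup X (j x),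
      ∀ i, e (PresentedGroup.of i) = latticeHom j x (.ofAdd (v i)) := by
  have hr : ∀ r ∈ rels, FreeGroup.lift (fun i => latticeHom j x (.ofAdd (v i))) r = 1 := by
    intro r hr
    have e : FreeGroup.lift (fun i => latticeHom j x (.ofAdd (v i))) =
        (latticeHom j x).comp (FreeGroup.lift fun i => Multiplicative.ofAdd (v i)) := by
      ext i
      simp
    rw [e]
    exact (h.latticeHom_eq_one x _).2 (hrels r hr)
  have hs : Function.Surjective π := by
    rw [← MonoidHom.range_eq_top, eq_top_iff, ← PresentedGroup.closure_range_of,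
      Subgroup.closure_le]
    rintro _ ⟨i, rfl⟩
    exact ⟨_, hπ i⟩
  let E := PresentedGroup.toGroup hr
  have hE : ∀ n, E (π n) = latticeHom j x n := by
    refine DFunLike.congr_fun (lattice_hom_ext (f := E.comp π) fun i => ?_)
    obtain hi | ⟨l, hl⟩ := hv i
    · rw [(h.latticeHom_eq_one x _).2 hi, MonoidHom.comp_apply, hK _ hi, map_one]
    · rw [← hl, MonoidHom.comp_apply, hπ]
      exact PresentedGroup.toGroup.of hr
  refine ⟨MulEquiv.ofBijective E ⟨?_, ?_⟩, fun i => PresentedGroup.toGroup.of hr⟩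
  · rw [injective_iff_map_eq_one]
    intro p hp
    obtain ⟨n, rfl⟩ := hs p
    rw [hE] at hp
    exact hK _ ((h.latticeHom_eq_one x _).1 hp)
  · intro r
    obtain ⟨n, rfl⟩ := h.latticeHom_surjective x r
    exact ⟨π n, hE n⟩

end

/-! ### The fundamental groups of `X_φ` and `X'` -/

theorem commute_of_mem_rels {ι : Type*} {rels : Set (FreeGroup ι)} {i j : ι}
    (h : FreeGroup.of i * FreeGroup.of j * (FreeGroup.of i)⁻¹ * (FreeGroup.of j)⁻¹ ∈ rels) :
    Commute (PresentedGroup.of (rels := rels) i) (PresentedGroup.of j) := by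
  have := PresentedGroup.one_of_mem h
  simp only [map_mul, map_inv, mul_inv_eq_iff_eq_mul, one_mul] at this
  exact this

theorem XGlue.exists_presentation {φ : T3 ≃ₜ T3} {A : Matrix (Fin 3) (Fin 3) ℤ}
    (hA : IsMatrixOf (φ : C(T3, T3)) A) {g' h' : ℤ} {m : ℕ} (hg : A 0 2 = m * g')
    (hh : A 1 2 = m * h') (x : T3) :
    ∃ e : PresentedGroup (relsGlue g' h' m) ≃* FundamentalGroup (XGlue φ) (XGlue.torus φ x),
      e (PresentedGroup.of 0) = FundamentalGroup.map (XGlue.torus φ) x (basisClass x 0) ∧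
      e (PresentedGroup.of 1) = FundamentalGroup.map (XGlue.torus φ) x (basisClass x 1) := by
  have hab : Commute (PresentedGroup.of (rels := relsGlue g' h' m) 0) (PresentedGroup.of 1) :=
    commute_of_mem_rels (Or.inl rfl)
  have hr : (PresentedGroup.of (rels := relsGlue g' h' m) 0 ^ g' * PresentedGroup.of 1 ^ h') ^ m
      = 1 := by
    have := PresentedGroup.one_of_mem (rels := relsGlue g' h' m) (Or.inr rfl)
    rw [map_pow, map_mul, map_zpow, map_zpow] at this
    exact this
  have hr' : PresentedGroup.of (rels := relsGlue g' h' m) 0 ^ A 0 2 * PresentedGroup.of 1 ^ A 1 2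
      = 1 := by
    rw [(hab.zpow_zpow g' h').mul_pow] at hr
    rw [hg, hh, mul_comm (m : ℤ), mul_comm (m : ℤ), zpow_mul, zpow_mul, zpow_natCast, zpow_natCast,
      hr]
  obtain ⟨e, he⟩ := (hasKer_XGlue hA).exists_presentation (rels := relsGlue g' h' m)
    (tripleHom hab (Commute.one_right _) (Commute.one_right _)) ![Pi.single 0 1, Pi.single 1 1]
    (by
      intro i
      fin_cases i
      · exact Or.inr ⟨0, rfl⟩
      · exact Or.inr ⟨1, rfl⟩
      · exact Or.inl (mem_meridian_sup.2 ⟨0, by simp⟩))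
    (by intro i; fin_cases i <;> simp [tripleHom])
    (by
      intro n hn
      obtain ⟨t, h0, h1⟩ := mem_meridian_sup.1 hn
      simp only [tripleHom, MonoidHom.coe_mk, OneHom.coe_mk, toAdd_ofAdd, h0, h1, one_zpow, mul_one]
      rw [mul_comm t, mul_comm t, zpow_mul, zpow_mul, ← (hab.zpow_zpow _ _).mul_zpow]
      exact (congrArg (· ^ t) hr').trans (one_zpow t))
    (by
      rintro r (rfl | rfl)
      · simp
      · refine mem_meridian_sup.2 ⟨1, ?_⟩
        simp [hg, hh])
    x
  exact ⟨e, (he 0).trans (latticeHom_single _ x 0), (he 1).trans (latticeHom_single _ x 1)⟩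

theorem XLog.exists_presentation {φp φm : T3 ≃ₜ T3} {Ap Am : Matrix (Fin 3) (Fin 3) ℤ}
    (hp : IsMatrixOf (φp : C(T3, T3)) Ap) (hm : IsMatrixOf (φm : C(T3, T3)) Am) (x : T3) :
    ∃ e : PresentedGroup (relsLog (Ap 0 2) (Ap 1 2) (Ap 2 2) (Am 0 2) (Am 1 2) (Am 2 2)) ≃*
        FundamentalGroup (XLog φp φm) (XLog.torus φp φm x),
      ∀ i, e (PresentedGroup.of i) = FundamentalGroup.map (XLog.torus φp φm) x (basisClass x i) := by
  set R := relsLog (Ap 0 2) (Ap 1 2) (Ap 2 2) (Am 0 2) (Am 1 2) (Am 2 2)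
  have hab : Commute (PresentedGroup.of (rels := R) 0) (PresentedGroup.of 1) :=
    commute_of_mem_rels (Or.inl rfl)
  have hac : Commute (PresentedGroup.of (rels := R) 0) (PresentedGroup.of 2) :=
    commute_of_mem_rels (Or.inr (Or.inl rfl))
  have hbc : Commute (PresentedGroup.of (rels := R) 1) (PresentedGroup.of 2) :=
    commute_of_mem_rels (Or.inr (Or.inr (Or.inl rfl)))
  have h1 := PresentedGroup.one_of_mem (rels := R) (Or.inr (Or.inr (Or.inr (Or.inl rfl))))
  have h2 := PresentedGroup.one_of_mem (rels := R) (Or.inr (Or.inr (Or.inr (Or.inr rfl))))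
  let π := tripleHom hab hac hbc
  have hπ : ∀ i, π (.ofAdd (Pi.single i 1)) = PresentedGroup.of i := by
    intro i; fin_cases i <;> simp [π, tripleHom]
  have hlift : ∀ w, π (FreeGroup.lift (fun i => Multiplicative.ofAdd (Pi.single i 1)) w) =
      PresentedGroup.mk R w := by
    refine DFunLike.congr_fun (f := π.comp (FreeGroup.lift _)) (FreeGroup.ext_hom _ _ fun i => ?_)
    simp only [MonoidHom.comp_apply, FreeGroup.lift_apply_of, hπ]
    rfl
  have e1 : FreeGroup.lift (fun i : Fin 3 => Multiplicative.ofAdd (Pi.single i (1 : ℤ)))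
      (FreeGroup.of 0 ^ Ap 0 2 * FreeGroup.of 1 ^ Ap 1 2 *
        (FreeGroup.of 0 * (FreeGroup.of 2)⁻¹) ^ Ap 2 2) =
      .ofAdd ![Ap 0 2 + Ap 2 2, Ap 1 2, - Ap 2 2] := by
    apply Multiplicative.toAdd.injective
    ext i
    fin_cases i <;> simp
  have e2 : FreeGroup.lift (fun i : Fin 3 => Multiplicative.ofAdd (Pi.single i (1 : ℤ)))
      (FreeGroup.of 0 ^ Am 0 2 * FreeGroup.of 1 ^ Am 1 2 * FreeGroup.of 2 ^ Am 2 2) =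
      .ofAdd (Am.col 2) := by
    apply Multiplicative.toAdd.injective
    ext i
    fin_cases i <;> simp
  obtain ⟨e, he⟩ := (hasKer_XLog hp hm).exists_presentation (rels := R) π
    (fun i => Pi.single i 1) (fun i => Or.inr ⟨i, rfl⟩) hπ
    (by
      intro n hn
      obtain ⟨_, ⟨s, rfl⟩, _, ⟨t, rfl⟩, rfl⟩ := AddSubgroup.mem_sup.1 hn
      rw [← hlift, e1] at h1
      rw [← hlift, e2] at h2
      simp only [ofAdd_add, ofAdd_zsmul, map_mul, map_zpow]
      exact (congrArg₂ (fun a b => a ^ s * b ^ t) h1 h2).trans (by simp))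
    (by
      rintro r (rfl | rfl | rfl | rfl | rfl)
      · simp
      · simp
      · simp
      · rw [e1]
        exact AddSubgroup.mem_sup_left (AddSubgroup.mem_zmultiples _)
      · rw [e2]
        exact AddSubgroup.mem_sup_right (AddSubgroup.mem_zmultiples _))
    x
  exact ⟨e, fun i => (he i).trans (latticeHom_single _ x i)⟩

theorem XGlue.nonempty_mulEquiv {φ : T3 ≃ₜ T3} {A : Matrix (Fin 3) (Fin 3) ℤ}
    (hA : IsMatrixOf (φ : C(T3, T3)) A) (x : XGlue φ) :
    Nonempty (FundamentalGroup (XGlue φ) x ≃*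
      Multiplicative (ℤ × ZMod (Int.gcd (A 0 2) (A 1 2)))) := by
  obtain ⟨θ, hs, hk⟩ := exists_hom_meridian (A.col 2)
  exact (hasKer_XGlue hA).nonempty_mulEquiv θ hs hk x

theorem XLog.nonempty_mulEquiv {φp φm : T3 ≃ₜ T3} {Ap Am : Matrix (Fin 3) (Fin 3) ℤ}
    (hp : IsMatrixOf (φp : C(T3, T3)) Ap) (hm : IsMatrixOf (φm : C(T3, T3)) Am)
    (x : XLog φp φm) :
    Nonempty (FundamentalGroup (XLog φp φm) x ≃* Multiplicative (ℤ × ZMod (minorsGcd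
      (presMatrix (Ap 0 2) (Ap 1 2) (Ap 2 2) (Am 0 2) (Am 1 2) (Am 2 2))))) := by
  obtain ⟨B, hAB, hBA⟩ := hp.exists_inverse
  -- `T` is the matrix of the change of coordinates from the torus around `F₊` to that around `F₋`,
  -- an involution. The first relation is the third column of `T * Ap`, so `B * T` sends it to the
  -- third unit vector.
  let T : Matrix (Fin 3) (Fin 3) ℤ := !![1, 0, 1; 0, 1, 0; 0, 0, -1]
  have hT : T * T = 1 := by decide
  have hr : (B * T).mulVec ![Ap 0 2 + Ap 2 2, Ap 1 2, - Ap 2 2] = Pi.single 2 1 := by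
    have : ![Ap 0 2 + Ap 2 2, Ap 1 2, - Ap 2 2] = (T * Ap).mulVec (Pi.single 2 1) := by
      ext i
      rw [Matrix.mulVec_single_one, Matrix.col_apply, Matrix.mul_apply, Fin.sum_univ_three]
      fin_cases i <;> simp [T]
    rw [this, Matrix.mulVec_mulVec, mul_assoc, ← mul_assoc T, hT, one_mul, hBA, Matrix.one_mulVec]
  obtain ⟨θ, hs, hk⟩ := exists_hom_pair (s := Am.col 2) (U := B * T) (V := T * Ap)
    (by rw [mul_assoc, ← mul_assoc Ap, hAB, one_mul, hT])
    (by rw [mul_assoc, ← mul_assoc T, hT, one_mul, hBA]) hr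
  have e : presMatrix (Ap 0 2) (Ap 1 2) (Ap 2 2) (Am 0 2) (Am 1 2) (Am 2 2) =
      Matrix.of ![![Ap 0 2 + Ap 2 2, Ap 1 2, - Ap 2 2], Am.col 2] := by
    ext i j
    fin_cases i <;> fin_cases j <;> rfl
  rw [e]
  exact (hasKer_XLog hp hm).nonempty_mulEquiv θ hs hk x

/-! ### First homology and path cocycles -/

section Homology

open Simplicial

variable {X : Type} [TopologicalSpace X]

/-- The continuous map from the standard 1-simplex to the unit interval. -/
def toI : C(stdSimplex ℝ (Fin 2), I) := stdSimplexHomeomorphUnitInterval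

variable (X) in
/-- The singular simplicial set. -/
abbrev sing : SSet.{0} := TopCat.toSSet.obj (TopCat.of X)

/-- The singular simplex given by a continuous map. -/
def spx {n : ℕ} (f : C(stdSimplex ℝ (Fin (n + 1)), X)) : (sing X) _⦋n⦌ :=
  (TopCat.toSSetObjEquiv (TopCat.of X) (.op ⦋n⦌)).symm f

theorem δ_spx {n : ℕ} (f : C(stdSimplex ℝ (Fin (n + 2)), X)) (i : Fin (n + 2)) :
    (sing X).δ i (spx f) =
      spx (f.comp ⟨stdSimplex.map (Fin.succAbove i), stdSimplex.continuous_map _⟩) := rfl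

theorem spx_surjective {n : ℕ} : Function.Surjective (spx (X := X) (n := n)) :=
  (TopCat.toSSetObjEquiv (TopCat.of X) (.op ⦋n⦌)).symm.surjective

variable (X) in
/-- The singular chain complex. -/
abbrev chains : ChainComplex (ModuleCat.{0} ℤ) ℕ := (sing X).chainComplex (ModuleCat.of ℤ ℤ)

/-- The singular 1-simplex given by a path. -/
def pathSpx (p : C(I, X)) : (sing X) _⦋1⦌ := spx (p.comp toI)

theorem pathSpx_surjective : Function.Surjective (pathSpx (X := X)) := fun s => by
  obtain ⟨f, rfl⟩ := spx_surjective s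
  refine ⟨f.comp (stdSimplexHomeomorphUnitInterval.symm : C(I, stdSimplex ℝ (Fin 2))), ?_⟩
  refine congrArg spx (ContinuousMap.ext fun x => ?_)
  exact congrArg f (stdSimplexHomeomorphUnitInterval.symm_apply_apply x)

/-- The singular 0-simplex at a point. -/
def pointSpx (x : X) : (sing X) _⦋0⦌ := spx (.const _ x)

theorem δ_zero_pathSpx (p : C(I, X)) : (sing X).δ 0 (pathSpx p) = pointSpx (p 1) := by
  rw [pathSpx, δ_spx]
  refine congrArg spx (ContinuousMap.ext fun x => congrArg p ?_)
  obtain rfl : x = stdSimplex.vertex 0 := Subsingleton.elim _ _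
  change stdSimplexHomeomorphUnitInterval (stdSimplex.map _ _) = 1
  rw [stdSimplex.map_vertex]
  exact stdSimplexHomeomorphUnitInterval_one

theorem δ_one_pathSpx (p : C(I, X)) : (sing X).δ 1 (pathSpx p) = pointSpx (p 0) := by
  rw [pathSpx, δ_spx]
  refine congrArg spx (ContinuousMap.ext fun x => congrArg p ?_)
  obtain rfl : x = stdSimplex.vertex 0 := Subsingleton.elim _ _
  change stdSimplexHomeomorphUnitInterval (stdSimplex.map _ _) = 0
  rw [stdSimplex.map_vertex]
  exact stdSimplexHomeomorphUnitInterval_zero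

/-- The edge of the standard 2-simplex opposite to the vertex `i`. -/
def edge (i : Fin 3) : C(I, stdSimplex ℝ (Fin 3)) :=
  (⟨stdSimplex.map (Fin.succAbove i), stdSimplex.continuous_map _⟩ :
    C(stdSimplex ℝ (Fin 2), stdSimplex ℝ (Fin 3))).comp
      (stdSimplexHomeomorphUnitInterval.symm : C(I, stdSimplex ℝ (Fin 2)))

theorem edge_apply (i : Fin 3) (t : I) :
    (edge i t : Fin 3 → ℝ) = ![![0, 1 - (t : ℝ), t], ![1 - (t : ℝ), 0, t],
      ![1 - (t : ℝ), t, 0]] i := by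
  have h : ((stdSimplexHomeomorphUnitInterval.symm t : stdSimplex ℝ (Fin 2)) : Fin 2 → ℝ) =
    ![1 - (t : ℝ), t] := rfl
  change (stdSimplex.map _ (stdSimplexHomeomorphUnitInterval.symm t) : Fin 3 → ℝ) = _
  rw [stdSimplex.map_coe, h]
  ext k
  rw [FunOnFinite.linearMap_apply_apply, Finset.sum_filter, Fin.sum_univ_two]
  fin_cases i <;> fin_cases k <;> simp [Fin.succAbove]

theorem edge_val (i : Fin 3) (t : I) :
    (edge i t).1 = ![![0, 1 - (t : ℝ), t], ![1 - (t : ℝ), 0, t], ![1 - (t : ℝ), t, 0]] i :=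
  edge_apply i t

theorem δ_spx_two (F : C(stdSimplex ℝ (Fin 3), X)) (i : Fin 3) :
    (sing X).δ i (spx F) = pathSpx (F.comp (edge i)) := by
  rw [pathSpx, δ_spx]
  refine congrArg spx (ContinuousMap.ext fun x => congrArg F ?_)
  change _ = stdSimplex.map _ (stdSimplexHomeomorphUnitInterval.symm
    (stdSimplexHomeomorphUnitInterval x))
  rw [Homeomorph.symm_apply_apply]
  rfl

/-! ### A cocycle induces a homomorphism on first homology -/

variable {A : Type} [AddCommGroup A]

/-- The homomorphism on 1-chains given by a path cocycle. -/
def PathCocycle.onChains (c : PathCocycle X A) : (chains X).X 1 ⟶ ModuleCat.of ℤ A :=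
  Limits.Cofan.IsColimit.desc ((sing X).isColimitChainComplexXCofan (ModuleCat.of ℤ ℤ) 1)
    fun s => ModuleCat.ofHom
      (LinearMap.toSpanSingleton ℤ A (c (Function.surjInv pathSpx_surjective s)))

theorem pathSpx_injective : Function.Injective (pathSpx (X := X)) := fun p q h => by
  have h' := (TopCat.toSSetObjEquiv (TopCat.of X) (.op ⦋1⦌)).symm.injective h
  ext t
  have := DFunLike.congr_fun h' (stdSimplexHomeomorphUnitInterval.symm t)
  simpa [toI] using this

theorem PathCocycle.ι_onChains (c : PathCocycle X A) (p : C(I, X)) :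
    (sing X).ιChainComplex (pathSpx p) ≫ c.onChains =
      ModuleCat.ofHom (LinearMap.toSpanSingleton ℤ A (c p)) := by
  refine (Limits.Cofan.IsColimit.fac _ _ _).trans ?_
  rw [pathSpx_injective (Function.surjInv_eq pathSpx_surjective (pathSpx p))]

/-- The point with parameters `(a, b)` of the 2-simplex, as a cone with apex the last vertex. -/
def conePoint : C(I × I, stdSimplex ℝ (Fin 3)) where
  toFun u := ⟨![(1 - (u.1 : ℝ)) * (1 - u.2), (1 - u.1) * u.2, u.1], by
    have h1 : (0 : ℝ) ≤ 1 - u.1 := by linarith [u.1.2.2]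
    have h2 : (0 : ℝ) ≤ 1 - u.2 := by linarith [u.2.2.2]
    constructor
    · intro i
      fin_cases i
      · exact mul_nonneg h1 h2
      · exact mul_nonneg h1 u.2.2.1
      · exact u.1.2.1
    · rw [Fin.sum_univ_three]
      simp
      ring⟩
  continuous_toFun := by
    refine Continuous.subtype_mk (continuous_pi fun i => ?_) _
    fin_cases i
    · simp only [Fin.zero_eta, Matrix.cons_val_zero]; fun_prop
    · simp only [Fin.mk_one, Matrix.cons_val_one]; fun_prop
    · change Continuous fun u : I × I => (u.1 : ℝ); fun_prop

/-- The triangle is a square with one side collapsed to the last vertex; the cocycle vanishes on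
that constant side. -/
theorem PathCocycle.triangle (c : PathCocycle X A) (F : C(stdSimplex ℝ (Fin 3), X)) :
    c (F.comp (edge 0)) - c (F.comp (edge 1)) + c (F.comp (edge 2)) = 0 := by
  have h := c.square (F.comp conePoint)
  have e0 : col (F.comp conePoint) 1 = F.comp (edge 0) := by
    ext u
    refine congrArg F (Subtype.ext ?_)
    change _ = (edge 0 u : Fin 3 → ℝ)
    rw [edge_apply]
    ext i
    fin_cases i <;> simp [conePoint]
  have e1 : col (F.comp conePoint) 0 = F.comp (edge 1) := by
    ext u
    refine congrArg F (Subtype.ext ?_)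
    change _ = (edge 1 u : Fin 3 → ℝ)
    rw [edge_apply]
    ext i
    fin_cases i <;> simp [conePoint]
  have e2 : row (F.comp conePoint) 0 = F.comp (edge 2) := by
    ext u
    refine congrArg F (Subtype.ext ?_)
    change _ = (edge 2 u : Fin 3 → ℝ)
    rw [edge_apply]
    ext i
    fin_cases i <;> simp [conePoint]
  have e3 : row (F.comp conePoint) 1 = .const I (F (stdSimplex.vertex 2)) := by
    ext u
    refine congrArg F (Subtype.ext ?_)
    ext i
    fin_cases i <;> simp [conePoint]
  rw [e0, e1, e2, e3, c.const, add_zero] at h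
  rw [← h]
  abel

theorem PathCocycle.d_onChains (c : PathCocycle X A) : (chains X).d 2 1 ≫ c.onChains = 0 := by
  refine SSet.chainComplex_hom_ext fun s => ?_
  obtain ⟨F, rfl⟩ := spx_surjective s
  rw [SSet.ιChainComplex_d_assoc, Preadditive.sum_comp, Limits.comp_zero]
  refine (Fin.sum_univ_three _).trans ?_
  ext
  simp only [Preadditive.zsmul_comp, δ_spx_two, c.ι_onChains]
  have := c.triangle F
  simpa [sub_eq_add_neg] using this

/-- The homomorphism on the first homology given by a path cocycle. -/
def PathCocycle.onHlgy (c : PathCocycle X A) : (chains X).homology 1 ⟶ ModuleCat.of ℤ A :=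
  (chains X).homologyι 1 ≫ (chains X).descOpcycles c.onChains 2 (by simp) c.d_onChains

theorem d_loop {x : X} (p : Path x x) :
    (sing X).ιChainComplex (R := ModuleCat.of ℤ ℤ) (pathSpx (p : C(I, X))) ≫ (chains X).d 1 0
      = 0 := by
  rw [SSet.ιChainComplex_d, Fin.sum_univ_two, δ_zero_pathSpx, δ_one_pathSpx]
  simp

/-- The homology class of a loop. -/
def loopHlgy {x : X} (p : Path x x) : (chains X).homology 1 :=
  ((chains X).liftCycles _ 0 (by simp) (d_loop p) ≫ (chains X).homologyπ 1).hom (1 : ℤ)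

theorem homologyι_loopHlgy {x : X} (p : Path x x) :
    ((chains X).homologyι 1).hom (loopHlgy p) =
      ((sing X).ιChainComplex (pathSpx (p : C(I, X))) ≫ (chains X).pOpcycles 1).hom (1 : ℤ) := by
  rw [loopHlgy, ← ModuleCat.comp_apply]
  simp

theorem PathCocycle.onHlgy_loopHlgy (c : PathCocycle X A) {x : X} (p : Path x x) :
    c.onHlgy.hom (loopHlgy p) = c (p : C(I, X)) := by
  rw [PathCocycle.onHlgy, ModuleCat.comp_apply, homologyι_loopHlgy, ← ModuleCat.comp_apply]
  simp [c.ι_onChains]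

/-! ### Every class of degree one is the class of a loop -/

/-- The class of a path in the quotient of the 1-chains by the boundaries. -/
def pathOpcycles (p : C(I, X)) : (chains X).opcycles 1 :=
  ((sing X).ιChainComplex (pathSpx p) ≫ (chains X).pOpcycles 1).hom (1 : ℤ)

theorem pathOpcycles_triangle (F : C(stdSimplex ℝ (Fin 3), X)) :
    pathOpcycles (F.comp (edge 1)) =
      pathOpcycles (F.comp (edge 2)) + pathOpcycles (F.comp (edge 0)) := by
  have h : (sing X).ιChainComplex (R := ModuleCat.of ℤ ℤ) (spx F) ≫ (chains X).d 2 1 ≫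
    (chains X).pOpcycles 1 = 0 := by simp
  rw [SSet.ιChainComplex_d_assoc, Preadditive.sum_comp] at h
  have h' := (Fin.sum_univ_three _).symm.trans h
  simp only [Preadditive.zsmul_comp, δ_spx_two] at h'
  change ((-1 : ℤ) ^ 0) • _ + ((-1 : ℤ) ^ 1) • _ + ((-1 : ℤ) ^ 2) • _ = 0 at h'
  simp only [pow_zero, pow_one, one_smul, neg_smul, even_two.neg_pow, one_pow] at h'
  have h2 : pathOpcycles (F.comp (edge 0)) + - pathOpcycles (F.comp (edge 1)) +
    pathOpcycles (F.comp (edge 2)) = 0 := congrArg (fun f => f.hom (1 : ℤ)) h'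
  rw [add_right_comm, add_neg_eq_zero] at h2
  rw [← h2, add_comm]

/-- The triangle with vertices `p s`, `p t`, `p u` in the path `p`. -/
def segTriangle (p : C(I, X)) (s t u : I) : C(stdSimplex ℝ (Fin 3), X) :=
  p.comp ⟨fun x => ⟨x.1 0 * s + x.1 1 * t + x.1 2 * u, by
    have h0 := x.2.1 0
    have h1 := x.2.1 1
    have h2 := x.2.1 2
    have h := x.2.2
    rw [Fin.sum_univ_three] at h
    have a0 := mul_nonneg h0 s.2.1
    have a1 := mul_nonneg h1 t.2.1
    have a2 := mul_nonneg h2 u.2.1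
    have b0 := mul_le_mul_of_nonneg_left s.2.2 h0
    have b1 := mul_le_mul_of_nonneg_left t.2.2 h1
    have b2 := mul_le_mul_of_nonneg_left u.2.2 h2
    exact ⟨by linarith, by linarith⟩⟩, by
    have h : ∀ i, Continuous fun x : stdSimplex ℝ (Fin 3) => x.1 i := fun i =>
      (continuous_apply i).comp continuous_subtype_val
    exact .subtype_mk ((((h 0).mul continuous_const).add ((h 1).mul continuous_const)).add
      ((h 2).mul continuous_const)) _⟩

/-- The triangle with vertices `(0, 0)`, `(1, 0)`, `(1, 1)` in a square. -/
def lowerTriangle : C(stdSimplex ℝ (Fin 3), I × I) where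
  toFun x := (⟨x.1 1 + x.1 2, by
    have h0 := x.2.1 0
    have h1 := x.2.1 1
    have h2 := x.2.1 2
    have h := x.2.2
    rw [Fin.sum_univ_three] at h
    exact ⟨by linarith, by linarith⟩⟩, ⟨x.1 2, x.2.1 2, stdSimplex.le_one x 2⟩)
  continuous_toFun := by
    have h : ∀ i, Continuous fun x : stdSimplex ℝ (Fin 3) => x.1 i := fun i =>
      (continuous_apply i).comp continuous_subtype_val
    exact .prodMk (.subtype_mk ((h 1).add (h 2)) _) (.subtype_mk (h 2) _)

variable (X) in
/-- The class of a path modulo boundaries, as a path cocycle. -/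
def opcyclesCocycle : PathCocycle X ((chains X).opcycles 1) where
  toFun := pathOpcycles
  seg_add' p s t u := by
    have e0 : (segTriangle p s t u).comp (edge 0) = seg p t u := by
      ext v
      refine congrArg p (Subtype.ext ?_)
      simp [edge_val]
    have e1 : (segTriangle p s t u).comp (edge 1) = seg p s u := by
      ext v
      refine congrArg p (Subtype.ext ?_)
      simp [edge_val]
    have e2 : (segTriangle p s t u).comp (edge 2) = seg p s t := by
      ext v
      refine congrArg p (Subtype.ext ?_)
      simp [edge_val]
    rw [← e0, ← e1, ← e2, pathOpcycles_triangle]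
  square' H := by
    -- The diagonal cuts the square into two triangles; it is their common edge with index `1`.
    have h1 := pathOpcycles_triangle (H.comp lowerTriangle)
    have h2 := pathOpcycles_triangle (H.comp (ContinuousMap.prodSwap.comp lowerTriangle))
    have e0 : (H.comp lowerTriangle).comp (edge 0) = row H 1 := by
      ext v
      refine congrArg H (Prod.ext (Subtype.ext ?_) (Subtype.ext ?_)) <;>
        simp [lowerTriangle, edge_val]
    have e2 : (H.comp lowerTriangle).comp (edge 2) = col H 0 := by
      ext v
      refine congrArg H (Prod.ext (Subtype.ext ?_) (Subtype.ext ?_)) <;>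
        simp [lowerTriangle, edge_val]
    have e0' : (H.comp (ContinuousMap.prodSwap.comp lowerTriangle)).comp (edge 0) = col H 1 := by
      ext v
      refine congrArg H (Prod.ext (Subtype.ext ?_) (Subtype.ext ?_)) <;>
        simp [lowerTriangle, edge_val]
    have e2' : (H.comp (ContinuousMap.prodSwap.comp lowerTriangle)).comp (edge 2) = row H 0 := by
      ext v
      refine congrArg H (Prod.ext (Subtype.ext ?_) (Subtype.ext ?_)) <;>
        simp [lowerTriangle, edge_val]
    have e1 : (H.comp lowerTriangle).comp (edge 1) =
        (H.comp (ContinuousMap.prodSwap.comp lowerTriangle)).comp (edge 1) := by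
      ext v
      refine congrArg H (Prod.ext (Subtype.ext ?_) (Subtype.ext ?_)) <;>
        simp [lowerTriangle, edge_val]
    rw [e0, e2] at h1
    rw [e0', e2'] at h2
    rw [← h1, ← h2, e1]

/-- The classes of loops at `x`, modulo boundaries. -/
def loopOpcycles (x : X) : AddSubgroup ((chains X).opcycles 1) where
  carrier := {o | ∃ p : Path x x, pathOpcycles (p : C(I, X)) = o}
  zero_mem' := ⟨.refl x, (opcyclesCocycle X).const x⟩
  add_mem' := by
    rintro _ _ ⟨p, rfl⟩ ⟨q, rfl⟩
    exact ⟨p.trans q, (opcyclesCocycle X).trans p q⟩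
  neg_mem' := by
    rintro _ ⟨p, rfl⟩
    exact ⟨p.symm, (opcyclesCocycle X).onQuot_symm (.mk p)⟩

/-- The classes of loops at `x`, modulo boundaries, as a submodule. -/
def loopSubmodule (x : X) : Submodule ℤ ((chains X).opcycles 1) where
  __ := (loopOpcycles x).toAddSubmonoid
  smul_mem' n o ho := by
    have h := (loopOpcycles x).zsmul_mem ho n
    rwa [← int_smul_eq_zsmul inferInstance n o] at h

/-- The morphism from `ℤ` given by an element. -/
def intHom {M : ModuleCat.{0} ℤ} (m : M) : ModuleCat.of ℤ ℤ ⟶ M :=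
  ModuleCat.ofHom (LinearMap.toSpanSingleton ℤ M m)

theorem intHom_one {M : ModuleCat.{0} ℤ} (m : M) : (intHom m).hom (1 : ℤ) = m := by
  simp only [intHom, ModuleCat.hom_ofHom, LinearMap.toSpanSingleton_apply]
  exact (int_smul_eq_zsmul M.isModule 1 m).trans (one_zsmul m)

theorem intHom_ext {M : ModuleCat.{0} ℤ} {f g : ModuleCat.of ℤ ℤ ⟶ M}
    (h : f.hom (1 : ℤ) = g.hom (1 : ℤ)) : f = g :=
  ModuleCat.hom_ext (LinearMap.ext_ring h)

/-- Joining both ends of each edge to `x` by chosen paths turns it into a loop. On chains this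
correction is `S` applied to the boundary, so it vanishes on cycles, and sums of loops are again
loops by concatenation. -/
theorem exists_loopHlgy_eq [PathConnectedSpace X] (x : X) (h : (chains X).homology 1) :
    ∃ p : Path x x, loopHlgy p = h := by
  let s : ∀ y, Path x y := fun y => PathConnectedSpace.somePath x y
  let S : (chains X).X 0 ⟶ (chains X).opcycles 1 :=
    Limits.Cofan.IsColimit.desc ((sing X).isColimitChainComplexXCofan (ModuleCat.of ℤ ℤ) 0)
      fun y => intHom
        (pathOpcycles (s (TopCat.toSSetObjEquiv (TopCat.of X) _ y (stdSimplex.vertex 0)) : C(I, X)))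
  have hS : ∀ y, (sing X).ιChainComplex (pointSpx y) ≫ S =
      intHom (pathOpcycles (s y : C(I, X))) :=
    fun y => Limits.Cofan.IsColimit.fac _ _ _
  let L := loopSubmodule x
  let π := @ModuleCat.ofHom ℤ _ _ _ _ _ _ (Submodule.Quotient.module L) L.mkQ
  have key : ((chains X).pOpcycles 1 - (chains X).d 1 0 ≫ S) ≫ π = 0 := by
    refine SSet.chainComplex_hom_ext fun t => ?_
    obtain ⟨p, rfl⟩ := pathSpx_surjective t
    have e : ((sing X).ιChainComplex (pathSpx p) ≫
        ((chains X).pOpcycles 1 - (chains X).d 1 0 ≫ S)).hom (1 : ℤ) =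
        pathOpcycles (((s (p 0)).trans (asPath p)).trans (s (p 1)).symm : C(I, X)) := by
      have hd : (sing X).ιChainComplex (pathSpx p) ≫ (chains X).d 1 0 ≫ S =
          intHom (pathOpcycles (s (p 1) : C(I, X))) -
            intHom (pathOpcycles (s (p 0) : C(I, X))) := by
        rw [SSet.ιChainComplex_d_assoc, Fin.sum_univ_two]
        simp only [Preadditive.add_comp, Preadditive.zsmul_comp, δ_zero_pathSpx, δ_one_pathSpx, hS]
        change ((-1 : ℤ) ^ 0) • _ + ((-1 : ℤ) ^ 1) • _ = _
        simp only [pow_zero, pow_one, one_smul, neg_smul, sub_eq_add_neg]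
      rw [Preadditive.comp_sub, hd]
      simp only [ModuleCat.hom_sub, LinearMap.sub_apply]
      have h0 := (opcyclesCocycle X).trans (s (p 0)) (asPath p)
      have h1 := (opcyclesCocycle X).trans ((s (p 0)).trans (asPath p)) (s (p 1)).symm
      have h2 : (opcyclesCocycle X) ((s (p 1)).symm : C(I, X)) = _ :=
        (opcyclesCocycle X).onQuot_symm (.mk (s (p 1)))
      rw [h0, h2] at h1
      refine Eq.trans ?_ h1.symm
      refine (congrArg₂ (fun a b => pathOpcycles p - (a - b)) (intHom_one _) (intHom_one _)).trans ?_
      change pathOpcycles p - (pathOpcycles _ - pathOpcycles _) =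
        pathOpcycles _ + pathOpcycles p + - pathOpcycles _
      abel
    rw [← Category.assoc, Limits.comp_zero]
    refine intHom_ext ?_
    exact (congrArg L.mkQ e).trans ((Submodule.Quotient.mk_eq_zero L).2 ⟨_, rfl⟩)
  have hmem : ((chains X).homologyι 1).hom h ∈ L := by
    obtain ⟨c, hc⟩ := (ModuleCat.epi_iff_surjective ((chains X).pOpcycles 1)).1 inferInstance
      (((chains X).homologyι 1).hom h)
    have hd : ((chains X).d 1 0).hom c = 0 := by
      have h1 := congrArg (fun f => f.hom h) ((chains X).homologyι_comp_fromOpcycles 1 0)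
      have h2 := congrArg (fun f => f.hom c) ((chains X).p_fromOpcycles 1 0)
      exact h2.symm.trans ((congrArg ((chains X).fromOpcycles 1 0).hom hc).trans h1)
    have h3 := congrArg (fun f => f.hom c) key
    rw [← hc]
    refine (Submodule.Quotient.mk_eq_zero L).1 ?_
    have h4 : L.mkQ (((chains X).pOpcycles 1).hom c - S.hom (((chains X).d 1 0).hom c)) = 0 := h3
    rw [hd, map_zero, sub_zero] at h4
    exact h4
  obtain ⟨p, hp⟩ := hmem
  refine ⟨p, ?_⟩
  have hinj : Function.Injective ((chains X).homologyι 1).hom :=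
    (ModuleCat.mono_iff_injective _).1 inferInstance
  exact hinj ((homologyι_loopHlgy p).trans hp)

theorem isAddCyclic_hlgy [PathConnectedSpace X] (x : X) [IsCyclic (FundamentalGroup X x)] :
    IsAddCyclic ((chains X).homology 1) := by
  obtain ⟨g, hg⟩ := IsCyclic.exists_generator (α := FundamentalGroup X x)
  obtain ⟨p, hp⟩ := Path.Homotopic.Quotient.mk_surjective (FundamentalGroup.toPath g)
  refine ⟨⟨loopHlgy p, fun h => ?_⟩⟩
  obtain ⟨r, rfl⟩ := exists_loopHlgy_eq x h
  obtain ⟨n, hn⟩ := hg (FundamentalGroup.fromPath (.mk r))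
  refine ⟨n, ?_⟩
  have hinj : Function.Injective ((chains X).homologyι 1).hom :=
    (ModuleCat.mono_iff_injective _).1 inferInstance
  apply hinj
  have h1 := congrArg ((opcyclesCocycle X).hom x) hn
  simp only [map_zpow] at h1
  have h2 : ((opcyclesCocycle X).hom x) g = .ofAdd (pathOpcycles (p : C(I, X))) :=
    congrArg (fun q => Multiplicative.ofAdd ((opcyclesCocycle X).onQuot q)) hp.symm
  rw [h2, ← ofAdd_zsmul] at h1
  have h3 : n • pathOpcycles (p : C(I, X)) = pathOpcycles (r : C(I, X)) :=
    Multiplicative.ofAdd.injective h1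
  refine (map_zsmul _ n (loopHlgy p)).trans ?_
  rw [homologyι_loopHlgy]
  exact h3.trans (homologyι_loopHlgy r).symm

/-- The degree cocycle modulo `K` induces a map from `H₁(X)` onto `ℤ³ / K`, since classes of loops
from the torus already hit everything. A cyclic fundamental group of `Y` makes `H₁(Y)`, and with it
the quotient, cyclic. -/
theorem HasKer.isAddCyclic_quotient [PathConnectedSpace X] {j : C(T3, X)}
    {K : AddSubgroup (Fin 3 → ℤ)} (h : HasKer j K) {Y : Type} [TopologicalSpace Y]
    [PathConnectedSpace Y] (y : Y) [IsCyclic (FundamentalGroup Y y)]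
    (e : Hlgy 1 Y ≅ Hlgy 1 X) : IsAddCyclic ((Fin 3 → ℤ) ⧸ K) := by
  obtain ⟨c, hc⟩ := h.exists_cocycle le_rfl
  have := isAddCyclic_hlgy y
  let e' : (chains Y).homology 1 ≃ₗ[ℤ] (chains X).homology 1 := e.toLinearEquiv
  let f : (chains Y).homology 1 →+ (Fin 3 → ℤ) ⧸ K :=
    c.onHlgy.hom.toAddMonoidHom.comp e'.toAddEquiv.toAddMonoidHom
  refine isAddCyclic_of_surjective f fun a => ?_
  obtain ⟨n, rfl⟩ := QuotientAddGroup.mk_surjective a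
  obtain ⟨p, hp⟩ := Path.Homotopic.Quotient.mk_surjective (FundamentalGroup.toPath (classOf 1 n))
  obtain ⟨b, hb⟩ := e'.surjective (loopHlgy (p.map j.continuous))
  refine ⟨b, (congrArg c.onHlgy.hom hb).trans ((c.onHlgy_loopHlgy _).trans ?_)⟩
  have := hc 1 (.mk p)
  rw [hp, degVec_classOf] at this
  rw [← this, ← hp]
  rfl

theorem XGlue.gcd_eq_one {φ : T3 ≃ₜ T3} {A : Matrix (Fin 3) (Fin 3) ℤ}
    (hA : IsMatrixOf (φ : C(T3, T3)) A) {Y : Type} [TopologicalSpace Y]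
    [PathConnectedSpace Y] (y : Y) [IsCyclic (FundamentalGroup Y y)]
    (e : Hlgy 1 Y ≅ Hlgy 1 (XGlue φ)) : Int.gcd (A 0 2) (A 1 2) = 1 := by
  obtain ⟨θ, hs, hk⟩ := exists_hom_meridian (A.col 2)
  have := (hasKer_XGlue hA).isAddCyclic_quotient y e
  have hc : IsAddCyclic (ℤ × ZMod (Int.gcd (A 0 2) (A 1 2))) :=
    isAddCyclic_of_surjective (QuotientAddGroup.lift _ θ fun n hn => (hk n).2 hn) fun b => by
      obtain ⟨n, rfl⟩ := hs b
      exact ⟨n, rfl⟩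
  by_contra hm
  have : Nontrivial (ZMod (Int.gcd (A 0 2) (A 1 2))) := ZMod.nontrivial_iff.2 hm
  exact not_isAddCyclic_prod_of_infinite_nontrivial _ _ hc

end Homology

/-! ### Homotopy classes of maps from the 3-torus to the circle -/

theorem deg_comp_eq_of_loops {q : C(T3, Circle)}
    (h : ∀ (x : T3) (p : Path x x), deg (q.comp (p : C(I, T3))) = 0) {x y : T3} (p p' : Path x y) :
    deg (q.comp (p : C(I, T3))) = deg (q.comp (p' : C(I, T3))) := by
  have h1 := (deg.comap q).onQuot_trans (.mk p) (Path.Homotopic.Quotient.mk p').symm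
  rw [PathCocycle.onQuot_symm] at h1
  have h2 : (deg.comap q).onQuot ((Path.Homotopic.Quotient.mk p).trans
    (Path.Homotopic.Quotient.mk p').symm) = 0 := h x (p.trans p'.symm)
  rw [h2] at h1
  have h3 : deg (q.comp (p : C(I, T3))) + - deg (q.comp (p' : C(I, T3))) = 0 := h1.symm
  linarith

instance : LocallyPathConnectedSpace T3 := by
  let H := EuclideanSpace ℝ (Fin 1)
  have : LocallyPathConnectedSpace (ModelProd (ModelProd H H) H) :=
    inferInstanceAs (LocallyPathConnectedSpace ((H × H) × H))
  exact ChartedSpace.locallyPathConnectedSpace (ModelProd (ModelProd H H) H) T3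

/-- This is the lifting criterion for `ℝ → S¹`: vanishing degrees on loops make the end point of a
lifted path independent of the path. -/
theorem exists_lift_of_loops {q : C(T3, Circle)}
    (h : ∀ (x : T3) (p : Path x x), deg (q.comp (p : C(I, T3))) = 0) :
    ∃ L : C(T3, ℝ), ∀ x, Circle.exp (L x) = q x := by
  obtain ⟨L, ⟨-, hL⟩, -⟩ := Circle.isCoveringMap_exp.isLocalHomeomorph.existsUnique_continuousMap_lifts
    q 1 (Complex.arg (q 1)) (Circle.exp_arg _) (fun γ hγ => by
      obtain ⟨Γ, hΓ0, hΓ⟩ := Circle.isCoveringMap_exp.exists_path_lifts (q.comp γ)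
        (Complex.arg (q 1)) (by simp [hγ])
      exact ⟨Γ, hΓ, hΓ0⟩)
    (fun γ γ' Γ Γ' h0 h0' e0 e0' hΓ hΓ' h1 => by
      have d := deg_eq (fun u => congrFun hΓ u)
      have d' := deg_eq (fun u => congrFun hΓ' u)
      let p : Path (1 : T3) (γ 1) := ⟨γ, h0, rfl⟩
      let p' : Path (1 : T3) (γ 1) := ⟨γ', h0', h1.symm⟩
      have e : deg (q.comp γ) = deg (q.comp γ') := deg_comp_eq_of_loops h p p'
      rw [d, d', e0, e0'] at e
      have := Real.pi_pos
      field_simp at e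
      linarith)
  exact ⟨L, fun x => congrFun hL x⟩

/-- The quotient `b / a` has degree zero on loops, so it is `exp L` for a real function `L`; the
homotopy is `exp (tL) a`. -/
theorem circle_homotopic {a b : C(T3, Circle)}
    (h : ∀ (x : T3) (p : Path x x), deg (a.comp (p : C(I, T3))) = deg (b.comp (p : C(I, T3)))) :
    a.Homotopic b := by
  obtain ⟨L, hL⟩ := exists_lift_of_loops (q := b * a ^ (-1 : ℤ)) fun x p => by
    have := deg_mul (b.comp (p : C(I, T3))) ((a.comp (p : C(I, T3))) ^ (-1 : ℤ))
    rw [deg_zpow, h x p] at this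
    refine Eq.trans (congrArg deg ?_) (this.trans (by push_cast; ring))
    ext1 u
    simp
  refine ⟨⟨⟨fun x => Circle.exp (x.1 * L x.2) * a x.2, by fun_prop⟩, fun x => by simp, fun x => ?_⟩⟩
  simp [hL]

/-! ### Homotopic attaching maps give homotopy equivalent spaces -/

/-- The radial retraction of the plane to the disc. -/
def clampDisc (z : ℂ) : Disc := ⟨z / (max 1 ‖z‖ : ℝ), by
  rw [norm_div, Complex.norm_real, Real.norm_of_nonneg (by positivity)]
  exact div_le_one_of_le₀ (le_max_right _ _) (by positivity)⟩

@[fun_prop]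
theorem continuous_clampDisc : Continuous clampDisc := by
  refine Continuous.subtype_mk (Continuous.div (by fun_prop) (by fun_prop) fun z => ?_) _
  exact Complex.ofReal_ne_zero.2 (by positivity)

theorem clampDisc_of_le {z : ℂ} (h : ‖z‖ ≤ 1) : clampDisc z = ⟨z, h⟩ := by
  ext
  simp [clampDisc, max_eq_left h]

namespace Glue

variable {Y : Type} [TopologicalSpace Y] {f f' : C(T3, Y)}

variable (f) in
/-- The point of `T² × D²` with coordinates `v` and `z` if `‖z‖ ≤ 1`, and a point of `Y`
otherwise. -/
def pinch (v : T2) (z : ℂ) (y : Y) : Glue f :=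
  if ‖z‖ ≤ 1 then inr f (v, clampDisc z) else inl f y

theorem pinch_of_le {v : T2} {z : ℂ} (h : ‖z‖ ≤ 1) (y : Y) :
    pinch f v z y = inr f (v, ⟨z, h⟩) := by rw [pinch, if_pos h, clampDisc_of_le h]

theorem inr_eq_of_norm_eq_one {v : T2} {z : ℂ} (h : ‖z‖ = 1) :
    inr f (v, clampDisc z) = inl f (f (v, nrm z)) := by
  have hz : bdry (v, nrm z) = (v, clampDisc z) := by
    rw [clampDisc_of_le h.le]
    refine Prod.ext rfl (Subtype.ext ?_)
    have := norm_mul_nrm z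
    rw [h] at this
    simpa [bdry] using this
  rw [← hz, inr_bdry]

theorem pinch_of_ge {v : T2} {z : ℂ} {y : Y} (h : 1 ≤ ‖z‖) (hy : ‖z‖ = 1 → y = f (v, nrm z)) :
    pinch f v z y = inl f y := by
  rw [pinch]
  split_ifs with h'
  · have h1 := le_antisymm h' h
    rw [hy h1, inr_eq_of_norm_eq_one h1]
  · rfl

theorem continuous_pinch {Z : Type*} [TopologicalSpace Z] {v : Z → T2} {z : Z → ℂ} {y : Z → Y}
    (hv : Continuous v) (hz : Continuous z) (hy : ContinuousOn y {x | 1 ≤ ‖z x‖})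
    (h : ∀ x, ‖z x‖ = 1 → y x = f (v x, nrm (z x))) :
    Continuous fun x => pinch f (v x) (z x) (y x) := by
  refine continuous_if_le (by fun_prop) continuous_const (by fun_prop)
    ((inl f).continuous.comp_continuousOn hy) fun x hx => ?_
  rw [inr_eq_of_norm_eq_one hx, h x hx]

/-- The point at parameter `s` and direction `z` of a homotopy. -/
def ray (H : f.Homotopy f') (s : ℝ) (v : T2) (z : ℂ) : Y := H (projIcc 0 1 zero_le_one s, (v, nrm z))

theorem continuousOn_ray (H : f.Homotopy f') {Z : Type*} [TopologicalSpace Z] {v : Z → T2}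
    {z : Z → ℂ} {s : Z → ℝ} (hv : Continuous v) (hz : Continuous z) (hs : Continuous s)
    {S : Set Z} (hS : ∀ x ∈ S, z x ≠ 0) : ContinuousOn (fun x => ray H (s x) (v x) (z x)) S := by
  refine H.continuous.comp_continuousOn (ContinuousOn.prodMk ?_ (hv.continuousOn.prodMk
    (continuousOn_nrm.comp hz.continuousOn hS)))
  exact (continuous_projIcc.comp hs).continuousOn

theorem ray_of_nonpos (H : f.Homotopy f') {s : ℝ} (hs : s ≤ 0) (v : T2) (z : ℂ) :
    ray H s v z = f (v, nrm z) := by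
  rw [ray, projIcc_of_le_left _ hs]
  exact H.apply_zero _

theorem ray_of_one_le (H : f.Homotopy f') {s : ℝ} (hs : 1 ≤ s) (v : T2) (z : ℂ) :
    ray H s v z = f' (v, nrm z) := by
  rw [ray, projIcc_of_right_le _ hs]
  exact H.apply_one _

theorem ray_mul (H : f.Homotopy f') {r : ℝ} (hr : 0 < r) (s : ℝ) (v : T2) (z : ℂ) :
    ray H s v (r * z) = ray H s v z := by rw [ray, ray, nrm_ofReal_mul hr]

theorem ray_symm (H : f.Homotopy f') (s : ℝ) (v : T2) (z : ℂ) :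
    ray H.symm s v z = ray H (1 - s) v z := by
  rw [ray, ray, ContinuousMap.Homotopy.symm_apply]
  congr 2
  ext
  simp only [coe_symm_eq, coe_projIcc]
  rcases le_total s 0 with h | h
  · rw [min_eq_right (by linarith), min_eq_left (by linarith), max_eq_left h, max_eq_right] <;>
      linarith
  · rcases le_total s 1 with h' | h'
    · rw [min_eq_right h', min_eq_right (by linarith), max_eq_right h, max_eq_right (by linarith)]
    · rw [min_eq_left h', min_eq_right (by linarith), max_eq_right (by linarith), max_eq_left]
        <;> linarith

theorem norm_two_mul_of_bdry (x : T3) : ‖(2 : ℂ) * ((bdry x).2 : ℂ)‖ = 2 := by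
  have : ‖((bdry x).2 : ℂ)‖ = 1 := Circle.norm_coe x.2
  rw [norm_mul, this, Complex.norm_ofNat, mul_one]

/-- The map between the glued spaces given by a homotopy of the attaching maps: the disc is
enlarged by a collar. -/
def collarMap (H : f.Homotopy f') : C(Glue f, Glue f') where
  toFun := desc f (inl f')
    -- The disc of radius `1/2` is stretched over the whole disc. On the collar the homotopy runs
    -- from `f'` at radius `1/2` to `f` at radius `1`.
    (fun s => pinch f' s.1 (2 * s.2) (ray H (2 - 2 * ‖(s.2 : ℂ)‖) s.1 (2 * s.2)))
    fun x => by
      have hn : ‖((bdry x).2 : ℂ)‖ = 1 := Circle.norm_coe x.2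
      have h2 := norm_two_mul_of_bdry x
      rw [pinch_of_ge (by rw [h2]; norm_num) fun h => by rw [h2] at h; norm_num at h,
        ray_of_nonpos H (by rw [hn]; norm_num)]
      have := nrm_ofReal_mul (r := 2) two_pos ((bdry x).2 : ℂ)
      push_cast at this
      rw [this]
      exact congrArg (fun y => inl f' (f y)) (toBdry_bdry x)
  continuous_toFun := by
    refine continuous_desc f _ (inl f').continuous (continuous_pinch (by fun_prop) (by fun_prop)
      (continuousOn_ray H (by fun_prop) (by fun_prop) (by fun_prop) fun s hs h0 => ?_)
      fun s hs => ray_of_one_le H ?_ _ _)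
    · rw [mem_ofPred_eq, h0, norm_zero] at hs
      linarith
    · rw [norm_mul, Complex.norm_ofNat] at hs
      linarith

theorem collarMap_inl (H : f.Homotopy f') (y : Y) : collarMap H (inl f y) = inl f' y := rfl

theorem collarMap_inr (H : f.Homotopy f') (s : Solid) : collarMap H (inr f s) =
    pinch f' s.1 (2 * s.2) (ray H (2 - 2 * ‖(s.2 : ℂ)‖) s.1 (2 * s.2)) := rfl

/-- The time of the homotopy at radius `r` and stage `t`. -/
def collarTime (t : I) (r : ℝ) : ℝ := min ((1 + (t : ℝ)) ^ 2 * r - 1) ((1 + (t : ℝ)) * (1 - r))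

/-- The homotopy on `T² × D²` from the inclusion to the composition of two collar maps. -/
def collarStage (H : f.Homotopy f') (x : I × Solid) : Glue f :=
  pinch f x.2.1 (((1 + (x.1 : ℝ)) ^ 2 : ℝ) * x.2.2)
    (ray H (collarTime x.1 ‖(x.2.2 : ℂ)‖) x.2.1 x.2.2)

theorem norm_ofReal_mul_of_nonneg {r : ℝ} (hr : 0 ≤ r) (z : ℂ) : ‖(r : ℂ) * z‖ = r * ‖z‖ := by
  rw [norm_mul, Complex.norm_real, Real.norm_of_nonneg hr]

theorem continuous_collarStage (H : f.Homotopy f') : Continuous (collarStage H) := by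
  have hp : ∀ x : I × Solid, 0 < 1 + (x.1 : ℝ) := fun x => by linarith [x.1.2.1]
  refine continuous_pinch (by fun_prop) (by fun_prop)
    (continuousOn_ray H (by fun_prop) (by fun_prop) (by unfold collarTime; fun_prop)
    fun x hx h0 => ?_) fun x hx => ?_
  · rw [mem_ofPred_eq, h0, mul_zero, norm_zero] at hx
    linarith
  · rw [nrm_ofReal_mul (by have := hp x; positivity)]
    refine ray_of_nonpos H ((min_le_left _ _).trans ?_) _ _
    rw [norm_ofReal_mul_of_nonneg (by have := hp x; positivity)] at hx
    linarith

/-- At radius `1` the second term in `collarTime` vanishes, so the homotopy time is not positive and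
the stages are compatible with the gluing. -/
theorem collarStage_bdry (H : f.Homotopy f') (t : I) (x : T3) :
    collarStage H (t, bdry x) = inl f (f x) := by
  have hn : ‖((bdry x).2 : ℂ)‖ = 1 := Circle.norm_coe x.2
  have h0 : ray H (collarTime t ‖((bdry x).2 : ℂ)‖) (bdry x).1 (bdry x).2 = f x := by
    have ht : collarTime t ‖((bdry x).2 : ℂ)‖ ≤ 0 :=
      (min_le_right _ _).trans (by rw [hn, sub_self, mul_zero])
    rw [ray_of_nonpos H ht]
    exact congrArg f (toBdry_bdry x)
  have h1 : (0 : ℝ) < (1 + (t : ℝ)) ^ 2 := by have := t.2.1; positivity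
  rw [collarStage]
  refine (pinch_of_ge ?_ fun _ => ?_).trans (congrArg (inl f) h0)
  · rw [norm_ofReal_mul_of_nonneg h1.le, hn]
    nlinarith [t.2.1]
  · refine h0.trans ?_
    simp only
    rw [nrm_ofReal_mul h1]
    exact congrArg f (toBdry_bdry x).symm

theorem collarStage_zero (H : f.Homotopy f') (s : Solid) : collarStage H (0, s) = inr f s := by
  have h : ‖((((1 + ((0 : I) : ℝ)) ^ 2 : ℝ) : ℂ) * (s.2 : ℂ))‖ ≤ 1 := by simpa using s.2.2
  rw [collarStage]
  refine (pinch_of_le h _).trans (congrArg (inr f) (Prod.ext rfl (Subtype.ext ?_)))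
  simp

/-- At `t = 1` the two terms of `collarTime` are `4r - 1` and `2 - 2r`, the times of the inner
collar (with `H` reversed) and of the outer collar. They cross at `r = 1/2`, where the collars meet.
-/
theorem collarStage_one (H : f.Homotopy f') (s : Solid) :
    collarStage H (1, s) = collarMap H.symm (collarMap H (inr f s)) := by
  obtain ⟨v, z, hz⟩ := s
  have e1 : ((1 : I) : ℝ) = 1 := rfl
  have n2 : ‖(2 : ℂ) * z‖ = 2 * ‖z‖ := by rw [norm_mul, Complex.norm_ofNat]
  have r2 : ∀ s (w : ℂ), ray H s v (2 * w) = ray H s v w := fun s w => by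
    have := ray_mul H two_pos s v w
    push_cast at this
    exact this
  rw [collarMap_inr, collarStage]
  simp only [collarTime, e1]
  rcases le_or_gt (2 * ‖z‖) 1 with h | h
  · rw [pinch_of_le (n2.trans_le h), collarMap_inr]
    simp only [n2, ray_symm, r2]
    rw [min_eq_left (by linarith),
      show ((1 + 1 : ℝ) ^ 2) * ‖z‖ - 1 = 1 - (2 - 2 * (2 * ‖z‖)) by ring,
      show ((((1 + 1 : ℝ) ^ 2) : ℝ) : ℂ) * z = 2 * (2 * z) by push_cast; ring]
  · have n4 : ‖(((1 + 1 : ℝ) ^ 2 : ℝ) : ℂ) * z‖ = 4 * ‖z‖ := by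
      rw [norm_ofReal_mul_of_nonneg (by norm_num)]
      norm_num
    rw [pinch_of_ge (f := f') (by linarith) (fun h' => by linarith), collarMap_inl, r2,
      min_eq_right (by linarith), show (1 + 1) * (1 - ‖z‖) = 2 - 2 * ‖z‖ by ring]
    exact pinch_of_ge (by linarith) (fun h' => by linarith)

theorem collarMap_symm_comp (H : f.Homotopy f') :
    ((collarMap H.symm).comp (collarMap H)).Homotopic (.id (Glue f)) := by
  let F : C(I × Solid, Glue f) := ⟨collarStage H, continuous_collarStage H⟩
  -- Mapping into the space of paths gives continuity directly from the quotient topology, without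
  -- forming the product of the quotient map with the interval.
  let G : C(Glue f, C(I, Glue f)) :=
    ⟨desc f (fun y => .const I (inl f y)) (F.comp ContinuousMap.prodSwap).curry fun x => by
      ext t
      exact collarStage_bdry H t x, continuous_desc f _
        (ContinuousMap.const'.continuous.comp (inl f).continuous) (ContinuousMap.continuous _)⟩
  refine ContinuousMap.Homotopic.symm ⟨⟨G.uncurry.comp ContinuousMap.prodSwap, fun x => ?_,
    fun x => ?_⟩⟩
  · induction x using ind with
    | hl y => rfl
    | hr s => exact collarStage_zero H s
  · induction x using ind with
    | hl y => rfl
    | hr s => exact collarStage_one H s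

/-- Homotopic attaching maps give homotopy equivalent spaces. -/
theorem nonempty_homotopyEquiv (h : f.Homotopic f') :
    Nonempty (ContinuousMap.HomotopyEquiv (Glue f) (Glue f')) := by
  obtain ⟨H⟩ := h
  refine ⟨⟨collarMap H, collarMap H.symm, collarMap_symm_comp H, ?_⟩⟩
  have := collarMap_symm_comp H.symm
  rwa [ContinuousMap.Homotopy.symm_symm] at this

end Glue

/-! ### Monomial maps -/

/-- The character of `T³` with exponents `n`. -/
def mono (n : Fin 3 → ℤ) : C(T3, Circle) where
  toFun x := x.1.1 ^ n 0 * x.1.2 ^ n 1 * x.2 ^ n 2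
  continuous_toFun := by fun_prop

theorem mono_apply (n : Fin 3 → ℤ) (x : T3) : mono n x = x.1.1 ^ n 0 * x.1.2 ^ n 1 * x.2 ^ n 2 := rfl

theorem mono_add (m n : Fin 3 → ℤ) (x : T3) : mono (m + n) x = mono m x * mono n x := by
  simp only [mono_apply, Pi.add_apply, zpow_add]
  rw [mul_mul_mul_comm (x.1.1 ^ m 0), mul_mul_mul_comm]

theorem mono_smul (k : ℤ) (n : Fin 3 → ℤ) (x : T3) : mono (k • n) x = mono n x ^ k := by
  simp only [mono_apply, Pi.smul_apply, smul_eq_mul, mul_zpow, ← zpow_mul, mul_comm k]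

theorem deg_mono (n : Fin 3 → ℤ) (p : C(I, T3)) :
    deg ((mono n).comp p) = ∑ k, n k * deg ((proj k).comp p) := by
  have : (mono n).comp p = ((proj 0).comp p) ^ n 0 * ((proj 1).comp p) ^ n 1 *
      ((proj 2).comp p) ^ n 2 := by
    ext1 u
    simp [mono_apply, proj]
  rw [this, deg_mul, deg_mul, deg_zpow, deg_zpow, deg_zpow, Fin.sum_univ_three]

theorem proj_homotopic_mono {φ : C(T3, T3)} {A : Matrix (Fin 3) (Fin 3) ℤ} (h : IsMatrixOf φ A)
    (i : Fin 3) : ((proj i).comp φ).Homotopic (mono (A i)) := by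
  refine circle_homotopic fun x p => ?_
  have h1 : (degVec ((Path.Homotopic.Quotient.mk p).map φ) i : ℝ) =
    deg (((proj i).comp φ).comp (p : C(I, T3))) := degVec_cast _ _
  have h2 : ∀ k, (degVec (.mk p) k : ℝ) = deg ((proj k).comp (p : C(I, T3))) :=
    fun k => degVec_cast _ _
  rw [← h1, degVec_map h, deg_mono]
  simp [Matrix.mulVec, dotProduct, h2]

/-- The map from `T³` to `T² × D²` with values in `T² × {1}` given by the first two rows of a
matrix. -/
def monoSolid (A : Matrix (Fin 3) (Fin 3) ℤ) : C(T3, Solid) :=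
  ((mono (A 0)).prodMk (mono (A 1))).prodMk (.const _ ⟨1, by simp⟩)

/-- Circle coordinates are determined up to homotopy by degrees, and the disc coordinate moves
linearly to `1`. The homotopy may leave the boundary, which is why the third row of the matrix
becomes irrelevant. -/
theorem bdry_comp_homotopic {φ : C(T3, T3)} {A : Matrix (Fin 3) (Fin 3) ℤ} (h : IsMatrixOf φ A) :
    (bdry.comp φ).Homotopic (monoSolid A) := by
  obtain ⟨H0⟩ := proj_homotopic_mono h 0
  obtain ⟨H1⟩ := proj_homotopic_mono h 1
  refine ⟨⟨⟨fun x => ((H0 x, H1 x), discLine x.1 (bdry (φ x.2)).2 ⟨1, by simp⟩), by fun_prop⟩,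
    fun x => ?_, fun x => ?_⟩⟩
  · refine Prod.ext (Prod.ext (H0.apply_zero x) (H1.apply_zero x)) (discLine_zero _ _)
  · refine Prod.ext (Prod.ext (H0.apply_one x) (H1.apply_one x)) (discLine_one _ _)

/-- The endomorphism of `T²` given by a matrix. -/
def toric (M : Matrix (Fin 2) (Fin 2) ℤ) (v : T2) : T2 :=
  (v.1 ^ M 0 0 * v.2 ^ M 0 1, v.1 ^ M 1 0 * v.2 ^ M 1 1)

/-- The character of `T²` with exponents `s`. -/
def char2 (s : Fin 2 → ℤ) (v : T2) : Circle := v.1 ^ s 0 * v.2 ^ s 1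

theorem char2_add (s t : Fin 2 → ℤ) (v : T2) : char2 (s + t) v = char2 s v * char2 t v := by
  simp only [char2, Pi.add_apply, zpow_add]
  rw [mul_mul_mul_comm]

theorem char2_toric (s : Fin 2 → ℤ) (M : Matrix (Fin 2) (Fin 2) ℤ) (v : T2) :
    char2 s (toric M v) = char2 (Matrix.vecMul s M) v := by
  simp only [char2, toric, Matrix.vecMul, dotProduct, Fin.sum_univ_two, zpow_add, mul_zpow,
    ← zpow_mul, mul_comm (s _)]
  rw [mul_mul_mul_comm]

theorem toric_toric (M N : Matrix (Fin 2) (Fin 2) ℤ) (v : T2) :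
    toric M (toric N v) = toric (M * N) v := by
  have h : ∀ L v, toric L v = (char2 (L 0) v, char2 (L 1) v) := fun _ _ => rfl
  rw [h M, char2_toric, char2_toric]
  rfl

theorem toric_one (v : T2) : toric 1 v = v := by simp [toric]

theorem char2_zero (v : T2) : char2 0 v = 1 := by simp [char2]

/-- The self-map of `T² × D²` which acts by `M` on `T²` and rotates the disc by the character
`s`. -/
def solidMap (M : Matrix (Fin 2) (Fin 2) ℤ) (s : Fin 2 → ℤ) : C(Solid, Solid) where
  toFun x := (toric M x.1, ⟨x.2 * char2 s x.1, by
    rw [norm_mul, Circle.norm_coe, mul_one]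
    exact x.2.2⟩)
  continuous_toFun := by
    have h1 : Continuous fun x : Solid => toric M x.1 := by unfold toric; fun_prop
    have h2 : Continuous fun x : Solid => char2 s x.1 := by unfold char2; fun_prop
    have h3 := (by fun_prop : Continuous ((↑) : Circle → ℂ)).comp h2
    exact h1.prodMk (.subtype_mk ((by fun_prop : Continuous fun x : Solid => (x.2 : ℂ)).mul h3) _)

/-- The restriction of `solidMap` to the boundary. -/
def torusMap (M : Matrix (Fin 2) (Fin 2) ℤ) (s : Fin 2 → ℤ) : C(T3, T3) where
  toFun x := (toric M x.1, x.2 * char2 s x.1)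
  continuous_toFun := by unfold toric char2; fun_prop

theorem solidMap_bdry (M : Matrix (Fin 2) (Fin 2) ℤ) (s : Fin 2 → ℤ) (x : T3) :
    solidMap M s (bdry x) = bdry (torusMap M s x) := by
  refine Prod.ext rfl (Subtype.ext ?_)
  simp [solidMap, bdry, torusMap]

theorem solidMap_solidMap {M N : Matrix (Fin 2) (Fin 2) ℤ} (h : M * N = 1) {s t : Fin 2 → ℤ}
    (hst : t + Matrix.vecMul s N = 0) (x : Solid) : solidMap M s (solidMap N t x) = x := by
  refine Prod.ext ?_ (Subtype.ext ?_)
  · change toric M (toric N x.1) = x.1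
    rw [toric_toric, h, toric_one]
  · change (x.2 : ℂ) * char2 t x.1 * char2 s (toric N x.1) = x.2
    rw [mul_assoc, ← Circle.coe_mul, char2_toric, ← char2_add, hst, char2_zero, Circle.coe_one,
      mul_one]

/-- `solidMap` is a homeomorphism if the matrix is invertible. -/
def solidHomeo {M N : Matrix (Fin 2) (Fin 2) ℤ} (h : M * N = 1) (h' : N * M = 1)
    (s : Fin 2 → ℤ) : Solid ≃ₜ Solid where
  toFun := solidMap M s
  invFun := solidMap N (-Matrix.vecMul s N)
  left_inv := solidMap_solidMap h' (by
    rw [Matrix.neg_vecMul, Matrix.vecMul_vecMul, h', Matrix.vecMul_one, add_neg_cancel])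
  right_inv := solidMap_solidMap h (by rw [neg_add_cancel])
  continuous_toFun := (solidMap M s).continuous
  continuous_invFun := (solidMap N _).continuous

theorem bdry_injective : Function.Injective bdry := fun _ _ h =>
  Prod.ext (congrArg (·.1) h) (Circle.ext (congrArg (fun s : Solid => (s.2 : ℂ)) h))

/-- Compatible homeomorphisms induce a homeomorphism of glued spaces. -/
theorem Glue.nonempty_homeomorph {Y : Type} [TopologicalSpace Y] {f f' : C(T3, Y)} (a : Y ≃ₜ Y)
    (b : Solid ≃ₜ Solid) {β β' : T3 → T3} (hb : ∀ x, b (bdry x) = bdry (β x))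
    (hb' : ∀ x, b.symm (bdry x) = bdry (β' x)) (h : ∀ x, a (f x) = f' (β x)) :
    Nonempty (Glue f ≃ₜ Glue f') := by
  have hβ : ∀ x, β (β' x) = x := fun x => bdry_injective (by
    rw [← hb, ← hb', Homeomorph.apply_symm_apply])
  have h' : ∀ x, a.symm (f' x) = f (β' x) := fun x => by
    rw [Homeomorph.symm_apply_eq, h, hβ]
  have e : ∀ x, inr f' (b (bdry x)) = inl f' (a (f x)) := fun x => by rw [hb, inr_bdry, h]
  have e' : ∀ x, inr f (b.symm (bdry x)) = inl f (a.symm (f' x)) := fun x => by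
    rw [hb', inr_bdry, h']
  refine ⟨⟨⟨desc f (fun y => inl f' (a y)) (fun s => inr f' (b s)) e,
    desc f' (fun y => inl f (a.symm y)) (fun s => inr f (b.symm s)) e', fun x => ?_, fun x => ?_⟩,
    ?_, ?_⟩⟩
  · induction x using Glue.ind with
    | hl y => simp
    | hr s => simp
  · induction x using Glue.ind with
    | hl y => simp
    | hr s => simp
  · exact continuous_desc f e ((inl f').continuous.comp a.continuous)
      ((inr f').continuous.comp b.continuous)
  · exact continuous_desc f' e' ((inl f).continuous.comp a.symm.continuous)
      ((inr f).continuous.comp b.symm.continuous)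

/-! ### The model gluing -/

/-- The cyclic permutation of the factors of `T³`. -/
def cyc : T3 ≃ₜ T3 where
  toFun x := ((x.2, x.1.1), x.1.2)
  invFun x := ((x.1.2, x.2), x.1.1)
  left_inv _ := rfl
  right_inv _ := rfl
  continuous_toFun := by fun_prop
  continuous_invFun := by fun_prop

/-- The matrix of `cyc`. -/
def cycMatrix : Matrix (Fin 3) (Fin 3) ℤ := !![0, 0, 1; 1, 0, 0; 0, 1, 0]

theorem isMatrixOf_cyc : IsMatrixOf (cyc : C(T3, T3)) cycMatrix := by
  intro x j
  fin_cases j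
  · simp [cycMatrix]
    rfl
  · simp [cycMatrix]
    rfl
  · simp [cycMatrix]
    rfl

theorem mul_adjugate_fin_two {a b c d : ℤ} (h : a * d - b * c = 1) :
    !![a, b; c, d] * !![d, -b; -c, a] = 1 := by
  have := Matrix.mul_adjugate !![a, b; c, d]
  rwa [Matrix.adjugate_fin_two_of, Matrix.det_fin_two_of, h, one_smul] at this

/-- A unimodular matrix acting on the first piece turns the upper part `(g', h')` of the third
column into `(1, 0)`, and the two rows into `(s₀, s₁, 1)` and `(c, d, 0)`. On the second piece, a
twist of the disc by the character `s` absorbs the first row, and an automorphism of `T²` with first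
row `(c, d)` absorbs the second. -/
theorem Glue.nonempty_homeomorph_cyc {A B : Matrix (Fin 3) (Fin 3) ℤ} (hAB : A * B = 1)
    (h : Int.gcd (A 0 2) (A 1 2) = 1) :
    Nonempty (Glue (monoSolid A) ≃ₜ Glue (monoSolid cycMatrix)) := by
  obtain ⟨g', h', u, v, hg, hh, huv⟩ := exists_bezout (A 0 2) (A 1 2)
  rw [h, Nat.cast_one, one_mul] at hg hh
  have hc : ∀ i j, A i 0 * B 0 j + A i 1 * B 1 j + A i 2 * B 2 j = (1 : Matrix _ _ ℤ) i j :=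
    fun i j => by rw [← hAB, Matrix.mul_apply, Fin.sum_univ_three]
  have h00 := hc 0 0
  have h01 := hc 0 1
  have h10 := hc 1 0
  have h11 := hc 1 1
  simp only [Matrix.one_apply_eq, ne_eq, Fin.reduceEq, not_false_eq_true, Matrix.one_apply_ne,
    hg, hh] at h00 h01 h10 h11
  let c := -h' * A 0 0 + g' * A 1 0
  let d := -h' * A 0 1 + g' * A 1 1
  let r := u * B 0 1 - v * B 0 0
  let t := u * B 1 1 - v * B 1 0
  -- Primitivity of `(c, d)` comes from the inverse matrix: pairing `-h' A₀ + g' A₁` with `u` times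
  -- the second column of `B` minus `v` times the first gives `u g' + v h'`.
  have hcd : c * r + d * t = 1 := by
    simp only [c, d, r, t]
    linear_combination huv - u * h' * h01 + u * g' * h11 + v * h' * h00 - v * g' * h10
  have hN := mul_adjugate_fin_two (a := u) (b := v) (c := -h') (d := g') (by linear_combination huv)
  have hQ := mul_adjugate_fin_two (a := c) (b := d) (c := -t) (d := r) (by linear_combination hcd)
  have hN' := mul_eq_one_comm.1 hN
  have hQ' := mul_eq_one_comm.1 hQ
  let s : Fin 2 → ℤ := ![u * A 0 0 + v * A 1 0, u * A 0 1 + v * A 1 1]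
  refine Glue.nonempty_homeomorph (solidHomeo hN hN' 0) (solidHomeo hQ hQ' s)
    (solidMap_bdry _ _) (solidMap_bdry _ _) fun x => Prod.ext (Prod.ext ?_ ?_) (Subtype.ext ?_)
  · change mono (A 0) x ^ u * mono (A 1) x ^ v = _
    rw [← mono_smul, ← mono_smul, ← mono_add]
    have e : u • A 0 + v • A 1 = ![s 0, s 1, 1] := by
      ext i
      fin_cases i
      · rfl
      · rfl
      · simp [hg, hh, huv]
    rw [e]
    simp [mono_apply, monoSolid, cycMatrix, torusMap, char2, mul_comm]
  · change mono (A 0) x ^ (-h') * mono (A 1) x ^ g' = _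
    rw [← mono_smul, ← mono_smul, ← mono_add]
    have e : (-h') • A 0 + g' • A 1 = ![c, d, 0] := by
      ext i
      fin_cases i
      · rfl
      · rfl
      · simp [hg, hh]
        ring
    rw [e]
    simp [mono_apply, monoSolid, cycMatrix, torusMap, toric]
  · change (1 : ℂ) * (char2 0 _ : Circle) = 1
    rw [char2_zero, Circle.coe_one, mul_one]

theorem XGlue.nonempty_homotopyEquiv_cyc {φ : T3 ≃ₜ T3} {A : Matrix (Fin 3) (Fin 3) ℤ}
    (hA : IsMatrixOf (φ : C(T3, T3)) A) (h : Int.gcd (A 0 2) (A 1 2) = 1) :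
    Nonempty (ContinuousMap.HomotopyEquiv (XGlue φ) (XGlue cyc)) := by
  obtain ⟨B, hAB, -⟩ := hA.exists_inverse
  obtain ⟨e1⟩ := Glue.nonempty_homotopyEquiv (bdry_comp_homotopic hA)
  obtain ⟨e2⟩ := Glue.nonempty_homeomorph_cyc hAB h
  obtain ⟨e3⟩ := Glue.nonempty_homotopyEquiv (bdry_comp_homotopic isMatrixOf_cyc).symm
  exact ⟨(e1.trans e2.toHomotopyEquiv).trans e3⟩

/-! ### The Hopf surface as a glued space -/

instance : CompactSpace Disc := by
  have : IsCompact {z : ℂ | ‖z‖ ≤ 1} := by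
    have := isCompact_closedBall (0 : ℂ) 1
    simpa [Metric.closedBall, dist_zero_right] using this
  exact isCompact_iff_compactSpace.1 this

instance {Y : Type} [TopologicalSpace Y] [CompactSpace Y] (f : C(T3, Y)) :
    CompactSpace (Glue f) :=
  inferInstanceAs (CompactSpace (Quot (GlueRel f)))

/-- The radius of the other coordinate of a point of the 3-sphere. -/
def corad (z : Disc) : ℝ := Real.sqrt (2 - ‖(z : ℂ)‖ ^ 2)

theorem corad_sq (z : Disc) : corad z ^ 2 = 2 - ‖(z : ℂ)‖ ^ 2 :=
  Real.sq_sqrt (by nlinarith [z.2, norm_nonneg (z : ℂ)])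

theorem one_le_corad (z : Disc) : 1 ≤ corad z :=
  Real.one_le_sqrt.2 (by nlinarith [z.2, norm_nonneg (z : ℂ)])

@[fun_prop]
theorem continuous_corad : Continuous corad := by unfold corad; fun_prop

theorem norm_corad_mul (z : Disc) (p : Circle) : ‖(corad z : ℂ) * (p : ℂ)‖ = corad z :=
  norm_ofReal_mul_circle (zero_le_one.trans (one_le_corad z)) p

/-- The chart of the Hopf surface on the first copy of `T² × D²`. -/
def hopfFst : C(Solid, HopfSurface) where
  toFun s := (s.1.2, ⟨((corad s.2 : ℂ) * s.1.1, s.2), by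
    simp only [norm_corad_mul, corad_sq]
    ring⟩)
  continuous_toFun := by fun_prop

/-- The chart of the Hopf surface on the second copy of `T² × D²`. -/
def hopfSnd : C(Solid, HopfSurface) where
  toFun s := (s.1.1, ⟨(s.2, (corad s.2 : ℂ) * s.1.2), by
    simp only [norm_corad_mul, corad_sq]
    ring⟩)
  continuous_toFun := by fun_prop

theorem hopfSnd_bdry (x : T3) : hopfSnd (bdry x) = hopfFst (bdry (cyc x)) := by
  have h : ∀ x : T3, corad (bdry x).2 = 1 := fun x => by
    have : ‖((bdry x).2 : ℂ)‖ = 1 := Circle.norm_coe x.2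
    rw [corad, this]
    norm_num
  refine Prod.ext rfl (Subtype.ext (Prod.ext ?_ ?_))
  · simp only [hopfSnd, hopfFst, h, ContinuousMap.coe_mk]
    simp [cyc, bdry]
  · simp only [hopfSnd, hopfFst, h, ContinuousMap.coe_mk]
    simp [cyc, bdry]

theorem hopfFst_injective : Function.Injective hopfFst := by
  rintro ⟨⟨p, q⟩, w⟩ ⟨⟨p', q'⟩, w'⟩ h
  obtain ⟨rfl, h⟩ := Prod.ext_iff.1 h
  obtain ⟨h1, h2⟩ := Prod.ext_iff.1 (Subtype.ext_iff.1 h)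
  obtain rfl : w = w' := Subtype.ext h2
  have : (corad w : ℂ) ≠ 0 := Complex.ofReal_ne_zero.2 (by linarith [one_le_corad w])
  obtain rfl : p = p' := Circle.ext (mul_left_cancel₀ this h1)
  rfl

theorem hopfSnd_injective : Function.Injective hopfSnd := by
  rintro ⟨⟨p, q⟩, w⟩ ⟨⟨p', q'⟩, w'⟩ h
  obtain ⟨rfl, h⟩ := Prod.ext_iff.1 h
  obtain ⟨h1, h2⟩ := Prod.ext_iff.1 (Subtype.ext_iff.1 h)
  obtain rfl : w = w' := Subtype.ext h1
  have : (corad w : ℂ) ≠ 0 := Complex.ofReal_ne_zero.2 (by linarith [one_le_corad w])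
  obtain rfl : q = q' := Circle.ext (mul_left_cancel₀ this h2)
  rfl

theorem eq_corad_mul {a : ℂ} {b : Disc} (h : ‖a‖ ^ 2 + ‖(b : ℂ)‖ ^ 2 = 2) :
    (corad b : ℂ) * (nrm a : ℂ) = a := by
  have : corad b = ‖a‖ := by
    rw [corad, ← h, add_sub_cancel_right, Real.sqrt_sq (norm_nonneg a)]
  rw [this, norm_mul_nrm]

/-- The model gluing is the Hopf surface. -/
theorem nonempty_homeomorph_hopf : Nonempty (XGlue cyc ≃ₜ HopfSurface) := by
  let F : XGlue cyc → HopfSurface := Glue.desc _ hopfFst hopfSnd hopfSnd_bdry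
  have hF : Continuous F := Glue.continuous_desc _ _ hopfFst.continuous hopfSnd.continuous
  have hs : Function.Surjective F := by
    rintro ⟨u, ⟨⟨a, b⟩, h⟩⟩
    simp only at h
    -- As the squared norms add up to `2`, at least one coordinate has norm at most `1`, and the
    -- corresponding chart reaches the point.
    rcases le_total ‖b‖ 1 with hb | hb
    · refine ⟨Glue.inl _ ((nrm a, u), ⟨b, hb⟩), Prod.ext rfl (Subtype.ext (Prod.ext ?_ rfl))⟩
      exact eq_corad_mul (b := ⟨b, hb⟩) h
    · have ha : ‖a‖ ≤ 1 := by nlinarith [norm_nonneg a]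
      refine ⟨Glue.inr _ ((u, nrm b), ⟨a, ha⟩), Prod.ext rfl (Subtype.ext (Prod.ext rfl ?_))⟩
      exact eq_corad_mul (b := ⟨a, ha⟩) ((add_comm _ _).trans h)
  -- Common boundary points are assigned to the first copy. What remains of the second copy has `‖z‖
  -- < 1`, while the first chart has `‖z‖ ≥ 1`, so injectivity can be checked chart by chart.
  have hr : ∀ x : XGlue cyc, (∃ y, x = Glue.inl _ y) ∨
      ∃ s : Solid, ‖(s.2 : ℂ)‖ < 1 ∧ x = Glue.inr _ s := fun x => by
    induction x using Glue.ind with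
    | hl y => exact Or.inl ⟨y, rfl⟩
    | hr s =>
      rcases s.2.2.lt_or_eq with h | h
      · exact Or.inr ⟨s, h, rfl⟩
      · have hs : bdry (s.1, nrm s.2) = s := Prod.ext rfl (Subtype.ext (by
          have := norm_mul_nrm s.2
          rwa [h, Complex.ofReal_one, one_mul] at this))
        exact Or.inl ⟨_, (congrArg (Glue.inr _) hs.symm).trans
          (Glue.inr_bdry (bdry.comp (cyc : C(T3, T3))) (s.1, nrm s.2))⟩
  have hne : ∀ (y s : Solid), ‖(s.2 : ℂ)‖ < 1 → hopfFst y ≠ hopfSnd s := fun y s hs h => by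
    have h1 : (corad y.2 : ℂ) * (y.1.1 : ℂ) = s.2 :=
      congrArg (fun x : HopfSurface => x.2.1.1) h
    rw [← h1, norm_corad_mul] at hs
    linarith [one_le_corad y.2]
  have hi : Function.Injective F := fun x x' h => by
    rcases hr x with ⟨y, rfl⟩ | ⟨s, hs, rfl⟩ <;> rcases hr x' with ⟨y', rfl⟩ | ⟨s', hs', rfl⟩
    · exact congrArg _ (hopfFst_injective h)
    · exact (hne y s' hs' h).elim
    · exact (hne y' s hs h.symm).elim
    · exact congrArg _ (hopfSnd_injective h)
  exact ⟨hF.homeoOfEquivCompactToT2 (f := Equiv.ofBijective F ⟨hi, hs⟩)⟩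

/-! ### Homology Hopf surfaces -/

theorem nonempty_hlgy_iso {X Y : Type} [TopologicalSpace X] [TopologicalSpace Y]
    (e : ContinuousMap.HomotopyEquiv X Y) (n : ℕ) : Nonempty (Hlgy n X ≅ Hlgy n Y) := by
  let F := (AlgebraicTopology.singularHomologyFunctor (ModuleCat.{0} ℤ) n).obj (ModuleCat.of ℤ ℤ)
  have key : ∀ {Z W : TopCat.{0}} {f g : Z ⟶ W}, TopCat.Homotopy f g → F.map f = F.map g :=
    fun H => TopCat.Homotopy.congr_homologyMap_singularChainComplexFunctor H (ModuleCat.of ℤ ℤ) n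
  obtain ⟨H⟩ := e.left_inv
  obtain ⟨H'⟩ := e.right_inv
  let f : TopCat.of X ⟶ TopCat.of Y := TopCat.ofHom e.toFun
  let g : TopCat.of Y ⟶ TopCat.of X := TopCat.ofHom e.invFun
  have h1 : F.map (f ≫ g) = F.map (𝟙 _) := key H
  have h2 : F.map (g ≫ f) = F.map (𝟙 _) := key H'
  rw [F.map_comp, F.map_id] at h1 h2
  exact ⟨⟨F.map f, F.map g, h1, h2⟩⟩

/-- Necessity uses only `H₁`: the model gluing has fundamental group `ℤ × ZMod 1`, which is cyclic.
For sufficiency, `X_φ` is even homotopy equivalent to the Hopf surface. -/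
theorem XGlue.isHomologyHopfSurface_iff {φ : T3 ≃ₜ T3} {A : Matrix (Fin 3) (Fin 3) ℤ}
    (hA : IsMatrixOf (φ : C(T3, T3)) A) :
    IsHomologyHopfSurface (XGlue φ) ↔ Int.gcd (A 0 2) (A 1 2) = 1 := by
  obtain ⟨e⟩ := nonempty_homeomorph_hopf
  constructor
  · intro h
    obtain ⟨e1⟩ := h 1
    obtain ⟨e2⟩ := nonempty_hlgy_iso e.toHomotopyEquiv 1
    let y : XGlue cyc := XGlue.torus cyc 1
    obtain ⟨e3⟩ := XGlue.nonempty_mulEquiv isMatrixOf_cyc y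
    have : IsCyclic (FundamentalGroup (XGlue cyc) y) := by
      have h1 : Int.gcd (cycMatrix 0 2) (cycMatrix 1 2) = 1 := rfl
      rw [h1] at e3
      refine isCyclic_of_surjective (e3.symm.toMonoidHom.comp
        (AddMonoidHom.toMultiplicative (AddMonoidHom.inl ℤ (ZMod 1)))) fun x => ?_
      refine ⟨Multiplicative.ofAdd (e3 x).toAdd.1, e3.symm_apply_eq.2 ?_⟩
      exact Multiplicative.toAdd.injective (Prod.ext rfl (Subsingleton.elim _ _))
    exact XGlue.gcd_eq_one hA y (e2.trans e1.symm)
  · intro h n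
    obtain ⟨e1⟩ := XGlue.nonempty_homotopyEquiv_cyc hA h
    exact nonempty_hlgy_iso (e1.trans e.toHomotopyEquiv) n

end HopfLog

end

theorem mainTheorem3 :
    -- the fundamental group and the homology of `X_φ`
    (∀ (φ : HopfLog.T3 ≃ₜ HopfLog.T3) (A : Matrix (Fin 3) (Fin 3) ℤ),
      HopfLog.IsMatrixOf (φ : C(HopfLog.T3, HopfLog.T3)) A →
      ∀ g h : ℤ, g = A 0 2 → h = A 1 2 →
        (∀ g' h' : ℤ, g = (Int.gcd g h : ℤ) * g' → h = (Int.gcd g h : ℤ) * h' →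
          ∀ x : HopfLog.T3,
            ∃ e : PresentedGroup (HopfLog.relsGlue g' h' (Int.gcd g h)) ≃*
                FundamentalGroup (HopfLog.XGlue φ) (HopfLog.XGlue.torus φ x),
              e (PresentedGroup.of 0) =
                FundamentalGroup.map (HopfLog.XGlue.torus φ) x (HopfLog.basisClass x 0) ∧
              e (PresentedGroup.of 1) =
                FundamentalGroup.map (HopfLog.XGlue.torus φ) x (HopfLog.basisClass x 1)) ∧
        (∀ x : HopfLog.XGlue φ,
          Nonempty (FundamentalGroup (HopfLog.XGlue φ) x ≃*
            Multiplicative (ℤ × ZMod (Int.gcd g h)))) ∧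
        (HopfLog.IsHomologyHopfSurface (HopfLog.XGlue φ) ↔ Int.gcd g h = 1)) ∧
    -- the fundamental group of the result of two logarithmic transformations
    (∀ (φp φm : HopfLog.T3 ≃ₜ HopfLog.T3) (Ap Am : Matrix (Fin 3) (Fin 3) ℤ),
      HopfLog.IsMatrixOf (φp : C(HopfLog.T3, HopfLog.T3)) Ap →
      HopfLog.IsMatrixOf (φm : C(HopfLog.T3, HopfLog.T3)) Am →
      ∀ a b p c d q : ℤ, a = Ap 0 2 → b = Ap 1 2 → p = Ap 2 2 →
        c = Am 0 2 → d = Am 1 2 → q = Am 2 2 →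
        (∀ x : HopfLog.T3,
          ∃ e : PresentedGroup (HopfLog.relsLog a b p c d q) ≃*
              FundamentalGroup (HopfLog.XLog φp φm) (HopfLog.XLog.torus φp φm x),
            ∀ i : Fin 3, e (PresentedGroup.of i) =
              FundamentalGroup.map (HopfLog.XLog.torus φp φm) x (HopfLog.basisClass x i)) ∧
        (∀ x : HopfLog.XLog φp φm,
          Nonempty (FundamentalGroup (HopfLog.XLog φp φm) x ≃*
            Multiplicative
              (ℤ × ZMod (HopfLog.minorsGcd (HopfLog.presMatrix a b p c d q)))))) := by
  refine ⟨?_, ?_⟩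
  · rintro φ A hA g h rfl rfl
    refine ⟨fun g' h' hg hh x => HopfLog.XGlue.exists_presentation hA hg hh x,
      HopfLog.XGlue.nonempty_mulEquiv hA,
      HopfLog.XGlue.isHomologyHopfSurface_iff hA⟩
  · rintro φp φm Ap Am hp hm a b p c d q rfl rfl rfl rfl rfl rfl
    exact ⟨HopfLog.XLog.exists_presentation hp hm, HopfLog.XLog.nonempty_mulEquiv hp hm⟩
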